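/- Let $\mathbb T^2=(\mathbb R/2\pi\mathbb Z)^2$ with Lebesgue measure and $\langle n\rangle=(1+|n|^2)^{1/2}$ for $n\in\mathbb Z^2$. For $r\in\mathbb R$ and $q\in(1,\infty)$ put $\|f\|_{W^{r,q}}=\|D^rf\|_{L^q(\mathbb T^2)}$, where $D^re^{in\cdot x}=\langle n\rangle^re^{in\cdot x}$ (for vector-valued $f$, $L^q$ is taken with the Euclidean norm of the values). Let $(\Omega,\mathcal F,\mathbb P)$ be a probability space and let $(g_n)_{n\in\mathbb Z^2\setminus\{0\}}$ be standard complex Gaussian random variables ($\mathbb E|g_n|^2=1$), independent modulo the relation $g_{-n}=\overline{g_n}$. Let $\chi\in C^\infty(\mathbb R^2;\mathbb R)$ be supported in $\{|x|<1/2\}$ with $\int\chi=1$, and let $\rho(\zeta)=\int_{\mathbb R^2}\chi(x)e^{-ix\cdot\zeta}\,dx$. For $\varepsilon\in(0,1)$ set $$Y=-\sum_{n\ne0}\frac{g_n}{|n|^2}e^{in\cdot x},\qquad Y_\varepsilon=-\sum_{n\ne0}\rho(\varepsilon n)\frac{g_n}{|n|^2}e^{in\cdot x},$$ $$:\!|\nabla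 Y_\varepsilon|^2\!:\;=|\nabla Y_\varepsilon|^2-C_\varepsilon,\qquad C_\varepsilon=\sum_{n\neq0}\frac{|\rho(\varepsilon n)|^2}{|n|^2},$$ and let $:\!|\nabla Y|^2\!:$ be the random distribution $$:\!|\nabla Y|^2\!:\;=\sum_{n_1,n_2\ne0,\;n_1\ne n_2}\frac{n_1\cdot n_2}{|n_1|^2|n_2|^2}\,g_{n_1}\overline{g_{n_2}}\,e^{i(n_1-n_2)\cdot x}+\sum_{n\neq0}\frac{|g_n|^2-1}{|n|^2},$$ where the series for each Fourier coefficient converges unconditionally in $L^2(\Omega)$. Let $s\in(0,1)$ and $q\in(1,\infty)$. There exist $\kappa>0$ and an event $\Sigma_0$ with $\mathbb P(\Sigma_0)=1$ such that for every $\omega\in\Sigma_0$ the Fourier coefficients of $Y_\varepsilon(\cdot,\omega)$ decrease rapidly for all $\varepsilon\in(0,1)$ and $C_\varepsilon<\infty$, the distribution $Y(\cdot,\omega)$ is a continuous function, and there is a finite constant $C(\omega)>0$ such that for all $\varepsilon\in(0,1)$: - $\|e^{\pm Y_\varepsilon}\|_{L^\infty}<C(\omega)$ and $\|e^{\pm Y_\varepsilon}\|_{W^{s,q}}<C(\omega)$;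 - $\|\nabla Y_\varepsilon\|_{L^q}<C(\omega)(1+|\ln\varepsilon|)$ and $\|:\!|\nabla Y_\varepsilon|^2\!:\|_{L^q}<C(\omega)(1+|\ln\varepsilon|)^2$; - $\|:\!|\nabla Y_\varepsilon|^2\!:\|_{W^{-s,q}}<C(\omega)$; - $\|Y_\varepsilon-Y\|_{W^{s,q}}<C(\omega)\varepsilon^\kappa$ and $\|Y_\varepsilon-Y\|_{L^\infty}<C(\omega)\varepsilon^\kappa$; - $\|\nabla Y_\varepsilon-\nabla Y\|_{W^{-s,q}}<C(\omega)\varepsilon^\kappa$; - $\|:\!|\nabla Y_\varepsilon|^2\!:-:\!|\nabla Y|^2\!:\|_{W^{-s,q}}<C(\omega)\varepsilon^\kappa$. Moreover, for every $\omega\in\Sigma_0$ and $p\in\mathbb R$ there is a finite constant $C_p(\omega)>0$ such that $\|e^{-pY_\varepsilon}-e^{-pY}\|_{L^\infty}<C_p(\omega)\varepsilon^\kappa$ for all $\varepsilon\in(0,1)$. -/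

import Mathlib

open MeasureTheory ProbabilityTheory Filter Topology
open scoped NNReal ENNReal

noncomputable section

namespace WhiteNoiseNLS

instance fact_two_pi_pos : Fact (0 < 2 * Real.pi) := ⟨Real.two_pi_pos⟩

/-- The torus `𝕋² = (ℝ / 2πℤ)²`; its `volume` is Lebesgue measure, of total mass `(2π)²`. -/
abbrev Torus : Type := Fin 2 → AddCircle (2 * Real.pi)

/-- Frequencies `n ∈ ℤ²`. -/
abbrev Freq : Type := Fin 2 → ℤ

/-- The plane `ℝ²` with its Euclidean norm. -/
abbrev Plane : Type := EuclideanSpace ℝ (Fin 2)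

/-- Vectors of `ℂ²` with the Hermitian norm (values of gradients). -/
abbrev CVec : Type := EuclideanSpace ℂ (Fin 2)

/-- A frequency seen as a vector of `ℝ²`. -/
def vec (n : Freq) : Plane := WithLp.toLp 2 (fun j => (n j : ℝ))

/-- The japanese bracket `⟨n⟩ = (1 + |n|²)^{1/2}`. -/
def bracket (n : Freq) : ℝ := Real.sqrt (1 + ‖vec n‖ ^ 2)

/-- The character `x ↦ e^{i n·x}` of the torus. -/
def character (n : Freq) (x : Torus) : ℂ := ∏ j, fourier (n j) (x j)

section Fourier

variable {E : Type*} [NormedAddCommGroup E] [NormedSpace ℂ E]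

/-- Fourier coefficients `(2π)⁻² ∫ f(x) e^{-i n·x} dx` of a (vector valued) function. -/
def coeff (f : Torus → E) (n : Freq) : E :=
  (((2 * Real.pi) ^ 2)⁻¹ : ℂ) • ∫ x : Torus, character (-n) x • f x

/-- The sum `∑ₙ cₙ e^{i n·x}` of an absolutely convergent Fourier series. -/
def fourierSum (c : Freq → E) (x : Torus) : E := ∑' n, character n x • c n

/-- The norm `‖D^s f‖_{L^q}` in `W^{s,q}` (for any real `s`) of the distribution `f` on the torus
with Fourier coefficients `c`; here `D^s e^{i n·x} = ⟨n⟩^s e^{i n·x}`. The competitors `F` below are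
the `L^q` functions that represent `D^s f`. They agree almost everywhere, and if there are none the
norm is `∞`. -/
def sobolevNorm (s : ℝ) (q : ℝ≥0∞) (c : Freq → E) : ℝ≥0∞ :=
  ⨅ F ∈ {F : Torus → E | MemLp F q volume ∧
      ∀ n, coeff F n = ((bracket n ^ s : ℝ) : ℂ) • c n},
    eLpNorm F q volume

end Fourier

/-- Fourier coefficients of the gradient of the distribution with Fourier coefficients `c`. -/
def gradCoeff (c : Freq → ℂ) (n : Freq) : CVec :=
  WithLp.toLp 2 (fun j => Complex.I * (n j : ℂ) * c n)

/-- A smooth mollifier on `ℝ²`, supported in `{|x| < 1/2}` and of integral one. -/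
structure IsMollifier (χ : Plane → ℝ) : Prop where
  smooth : ContDiff ℝ ((⊤ : ℕ∞) : WithTop ℕ∞) χ
  support : tsupport χ ⊆ Metric.ball 0 (1 / 2)
  integral_eq_one : ∫ x, χ x = 1

/-- The Fourier transform `ρ(ζ) = ∫ χ(x) e^{-i x·ζ} dx` on `ℝ²`. -/
def rho (χ : Plane → ℝ) (ζ : Plane) : ℂ :=
  ∫ x : Plane, (χ x : ℂ) * Complex.exp (-Complex.I * (inner ℝ x ζ : ℝ))

/-- The standard complex Gaussian law (`𝔼 g = 𝔼 g² = 0`, `𝔼|g|² = 1`): independent real and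
imaginary parts, centred Gaussian of variance `1/2`. -/
def stdComplexGaussian : Measure ℂ :=
  ((gaussianReal 0 (1 / 2)).prod (gaussianReal 0 (1 / 2))).map (fun p : ℝ × ℝ => (⟨p.1, p.2⟩ : ℂ))

/-- Fourier coefficients `(gₙ)_{n ≠ 0}` of a real mean-zero white noise on the torus: standard
complex Gaussians, independent modulo the relation `g₋ₙ = conj gₙ`. The variable `g 0` plays no
role. -/
structure IsWhiteNoise {Ω : Type*} [MeasurableSpace Ω] (P : Measure Ω) (g : Freq → Ω → ℂ) :
    Prop where
  law : ∀ n, n ≠ 0 → HasLaw (g n) stdComplexGaussian P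
  conj : ∀ n, n ≠ 0 → ∀ᵐ ω ∂P, g (-n) ω = (starRingEnd ℂ) (g n ω)
  indep : ∀ S : Set Freq, (∀ n ∈ S, n ≠ 0 ∧ -n ∉ S) → iIndepFun (fun n : S => g n) P

section Noise

variable {Ω : Type*} (χ : Plane → ℝ) (g : Freq → Ω → ℂ)

/-- Fourier coefficients of `Y = Δ⁻¹ ξ`. -/
def YCoeff (ω : Ω) (n : Freq) : ℂ :=
  if n = 0 then 0 else -(g n ω / (‖vec n‖ : ℂ) ^ 2)

/-- Fourier coefficients of `Y_ε = Δ⁻¹ (χ_ε ∗ ξ)`. -/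
def YepsCoeff (ε : ℝ) (ω : Ω) (n : Freq) : ℂ := rho χ (ε • vec n) * YCoeff g ω n

/-- The function `Y_ε(·, ω)`. -/
def Yeps (ε : ℝ) (ω : Ω) (x : Torus) : ℂ := fourierSum (YepsCoeff χ g ε ω) x

/-- The function `∇Y_ε(·, ω)`. -/
def gradYeps (ε : ℝ) (ω : Ω) (x : Torus) : CVec := fourierSum (gradCoeff (YepsCoeff χ g ε ω)) x

/-- The renormalization constant `C_ε = ∑_{n ≠ 0} |ρ(εn)|² / |n|²`. -/
def renormConst (ε : ℝ) : ℝ := ∑' n : {n : Freq // n ≠ 0}, ‖rho χ (ε • vec n)‖ ^ 2 / ‖vec n‖ ^ 2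

/-- The function `:|∇Y_ε|²:(·, ω) = |∇Y_ε|²(·, ω) - C_ε`. -/
def wickSqEps (ε : ℝ) (ω : Ω) (x : Torus) : ℂ :=
  ((‖gradYeps χ g ε ω x‖ ^ 2 - renormConst χ ε : ℝ) : ℂ)

/-- The terms, indexed by `n = n₂`, of the series for the Fourier coefficient of `:|∇Y|²:` at the
frequency `m = n₁ - n₂`: for `m ≠ 0` these are `(n₁·n₂) / (|n₁|²|n₂|²) g_{n₁} conj g_{n₂}` over
`n₁, n₂ ≠ 0`, and for `m = 0` they are `(|gₙ|² - 1) / |n|²` over `n ≠ 0`. -/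
def wickTerm (m n : Freq) (ω : Ω) : ℂ :=
  if n = 0 ∨ n + m = 0 then 0
  else if m = 0 then ((‖g n ω‖ ^ 2 - 1 : ℝ) : ℂ) / (‖vec n‖ : ℂ) ^ 2
  else ((inner ℝ (vec (n + m)) (vec n) : ℝ) : ℂ) / ((‖vec (n + m)‖ : ℂ) ^ 2 * (‖vec n‖ : ℂ) ^ 2)
    * g (n + m) ω * (starRingEnd ℂ) (g n ω)

end Noise

/-- `Z` is the sum of the series `∑ᵢ Xᵢ` of random variables, which converges unconditionally in
`L²(Ω)`. It is unique up to almost sure equality. -/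
structure IsL2Sum {Ω ι : Type*} [MeasurableSpace Ω] (P : Measure Ω) (X : ι → Ω → ℂ)
    (Z : Ω → ℂ) : Prop where
  memLp_term : ∀ i, MemLp (X i) 2 P
  memLp_sum : MemLp Z 2 P
  tendsto : Tendsto (fun A : Finset ι => eLpNorm (fun ω => ∑ i ∈ A, X i ω - Z ω) 2 P) atTop (𝓝 0)

/-- `W m ω` are the Fourier coefficients of the random distribution `:|∇Y|²:(·, ω)`. -/
def IsWickSq {Ω : Type*} [MeasurableSpace Ω] (P : Measure Ω) (g : Freq → Ω → ℂ)
    (W : Ω → Freq → ℂ) : Prop :=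
  ∀ m, IsL2Sum P (fun n => wickTerm g m n) (fun ω => W ω m)

end WhiteNoiseNLS

end

/-!
The estimates are reduced to one fact about random Fourier series: if the random variables `ξ n`
satisfy the moment bounds of a Wiener chaos of fixed order (`HasChaosMoments`) and the weights `a n`
have `b` fractional derivatives in mean square, then `∑ a n ξ n e^{i n·x}` is almost surely the
pointwise limit of its dyadic partial sums and is Hölder continuous of every exponent `θ < b`
(`HasChaosMoments.ae_exists_isHolderSeries`). The reason is Nikolskii's inequality: the sup norm of a
trigonometric polynomial of degree `N` is at most `N^{d/(2k)}` times its `L^{2k}` norm, and all the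
moments of a chaos are controlled by the second one, so that `k` may be taken large. For the first
chaos the moment bounds are those of complex Gaussians; for the second one they follow by
symmetrization with an independent copy of the Gaussian vector and a rotation of the pair by `π/4`,
which turns a quadratic form into a bilinear one (`IsWhiteNoise.lintegral_quadratic`).

This fact is applied to three series. For `Y` itself it gives Hölder exponents up to `1`. For the
components of `D^{-s} ∇Y` it gives exponents up to `s`. The distribution `D^{-s} :|∇Y|²:` is treated
as the restriction to the diagonal of a function of two variables on `𝕋² × 𝕋²`, whose Fourier series
has the coefficient `⟨n₁ - n₂⟩^{-s} (n₁·n₂) |n₁|⁻² |n₂|⁻²` in front of the Wick product of `g_{n₁}`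
and `conj g_{n₂}`; the weighted lattice sum `summable_bracket_triple` yields Hölder exponents up to
`s` in both variables.

In all three cases the regularization at scale `ε` is the average of translates by vectors of length
at most `ε` (`mollify`), in one or in two variables, so that the convergence with a rate is the
elementary estimate `norm_mollify_sub_le` for Hölder functions: bounds in `W^{-s,q}` are sup norm
bounds for the functions that represent `D^{-s}`. For the positive order `s`, Hölder functions of
exponent `α > s` belong to `W^{s,q}` (`exists_sobolevNorm_le_of_holder`), by subordination of the
power `(1 - Δ)^{s/2}` to the heat semigroup, and `e^{±Y_ε}` are Hölder functions along with `Y_ε`.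

For the logarithmic bounds, the `L^{2k}` norms of the partial sums of `∇Y` over frequencies at most
`2^J` are `O(J)` almost surely (`IsWhiteNoise.ae_eLpNorm_grad_le`). With `2^J` of order `ε⁻²`, the
function `∇Y_ε` is the mollification of such a partial sum up to a bounded remainder, because the
Fourier transform of the mollifier decreases rapidly while the white noise grows polynomially.

Finally, the coefficients of `:|∇Y|²:` are defined as sums in `L²(Ω)`. They agree almost surely with
the coefficients of the continuous function constructed from the dyadic partial sums, since along
these the series converges both in `L²(Ω)` and pointwise (`IsL2Sum.ae_eq_of_tendsto`).
-/

noncomputable section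

namespace WhiteNoiseNLS

/-! ### Moments of linear combinations of the noise -/

section Moments

theorem stdComplexGaussian_eq_map : stdComplexGaussian =
    ((gaussianReal 0 (1 / 2)).prod (gaussianReal 0 (1 / 2))).map
      (Complex.equivRealProdCLM.symm : ℝ × ℝ →L[ℝ] ℂ) := by
  unfold stdComplexGaussian
  congr 1

instance isGaussian_stdComplexGaussian : IsGaussian stdComplexGaussian := by
  rw [stdComplexGaussian_eq_map]
  infer_instance

theorem integrable_sq_gaussianReal (v : ℝ≥0) :
    Integrable (fun x : ℝ => x ^ 2) (gaussianReal 0 v) := by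
  have := (memLp_id_gaussianReal (μ := 0) (v := v) 2).integrable_sq
  simpa using this

theorem integral_sq_gaussianReal (v : ℝ≥0) : ∫ x, x ^ 2 ∂(gaussianReal 0 v) = v := by
  have h := variance_fun_id_gaussianReal (μ := 0) (v := v)
  rw [variance_eq_sub (X := fun x : ℝ => x) (memLp_id_gaussianReal (μ := 0) (v := v) 2)] at h
  simpa using h

theorem integrable_id_gaussianReal (v : ℝ≥0) : Integrable (fun x : ℝ => x) (gaussianReal 0 v) :=
  (memLp_id_gaussianReal (μ := 0) (v := v) 1).integrable (by simp)

theorem integral_ofReal_gaussianReal (v : ℝ≥0) : ∫ x : ℝ, (x : ℂ) ∂(gaussianReal 0 v) = 0 := by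
  have h := integral_complex_ofReal (μ := gaussianReal 0 v) (f := fun x : ℝ => x)
  rw [h, integral_id_gaussianReal, Complex.ofReal_zero]

theorem integral_stdComplexGaussian (f : ℂ → ℂ) (hf : Continuous f) :
    ∫ z, f z ∂stdComplexGaussian =
      ∫ p : ℝ × ℝ, f ⟨p.1, p.2⟩ ∂((gaussianReal 0 (1 / 2)).prod (gaussianReal 0 (1 / 2))) := by
  unfold stdComplexGaussian
  rw [integral_map _ hf.aestronglyMeasurable]
  exact (Complex.equivRealProdCLM.symm.continuous.measurable).aemeasurable

theorem stdComplexGaussian_mean : ∫ z, z ∂stdComplexGaussian = 0 := by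
  rw [integral_stdComplexGaussian (fun z => z) continuous_id]
  have h1 : Integrable (fun p : ℝ × ℝ => (p.1 : ℂ))
      ((gaussianReal 0 (1 / 2)).prod (gaussianReal 0 (1 / 2))) :=
    ((integrable_id_gaussianReal _).comp_fst _).ofReal
  have h2 : Integrable (fun p : ℝ × ℝ => (p.2 : ℂ))
      ((gaussianReal 0 (1 / 2)).prod (gaussianReal 0 (1 / 2))) :=
    ((integrable_id_gaussianReal _).comp_snd _).ofReal
  simp only [Complex.mk_eq_add_mul_I]
  rw [integral_add h1 (h2.mul_const _), integral_mul_const,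
    integral_fun_fst (fun x : ℝ => (x : ℂ)), integral_fun_snd (fun x : ℝ => (x : ℂ))]
  simp [integral_ofReal_gaussianReal]

theorem stdComplexGaussian_norm_sq : ∫ z, z * (starRingEnd ℂ) z ∂stdComplexGaussian = 1 := by
  rw [integral_stdComplexGaussian _ (by fun_prop)]
  have h1 : Integrable (fun p : ℝ × ℝ => ((p.1 ^ 2 : ℝ) : ℂ))
      ((gaussianReal 0 (1 / 2)).prod (gaussianReal 0 (1 / 2))) :=
    ((integrable_sq_gaussianReal _).comp_fst _).ofReal
  have h2 : Integrable (fun p : ℝ × ℝ => ((p.2 ^ 2 : ℝ) : ℂ))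
      ((gaussianReal 0 (1 / 2)).prod (gaussianReal 0 (1 / 2))) :=
    ((integrable_sq_gaussianReal _).comp_snd _).ofReal
  have : ∀ p : ℝ × ℝ, (⟨p.1, p.2⟩ : ℂ) * (starRingEnd ℂ) ⟨p.1, p.2⟩ =
      ((p.1 ^ 2 : ℝ) : ℂ) + ((p.2 ^ 2 : ℝ) : ℂ) := by
    intro p
    rw [Complex.mul_conj, ← Complex.ofReal_add, Complex.normSq_mk]
    congr 1
    ring
  simp only [this]
  rw [integral_add h1 h2, integral_fun_fst (fun x : ℝ => ((x ^ 2 : ℝ) : ℂ)),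
    integral_fun_snd (fun x : ℝ => ((x ^ 2 : ℝ) : ℂ)), integral_complex_ofReal,
    integral_sq_gaussianReal]
  simp
  norm_num

theorem stdComplexGaussian_sq : ∫ z, z * z ∂stdComplexGaussian = 0 := by
  rw [integral_stdComplexGaussian _ (by fun_prop)]
  have h1 : Integrable (fun p : ℝ × ℝ => ((p.1 ^ 2 : ℝ) : ℂ))
      ((gaussianReal 0 (1 / 2)).prod (gaussianReal 0 (1 / 2))) :=
    ((integrable_sq_gaussianReal _).comp_fst _).ofReal
  have h2 : Integrable (fun p : ℝ × ℝ => ((p.2 ^ 2 : ℝ) : ℂ))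
      ((gaussianReal 0 (1 / 2)).prod (gaussianReal 0 (1 / 2))) :=
    ((integrable_sq_gaussianReal _).comp_snd _).ofReal
  have h3 : Integrable (fun p : ℝ × ℝ => (p.1 : ℂ) * (p.2 : ℂ))
      ((gaussianReal 0 (1 / 2)).prod (gaussianReal 0 (1 / 2))) :=
    (integrable_id_gaussianReal _).ofReal.mul_prod (integrable_id_gaussianReal _).ofReal
  have : ∀ p : ℝ × ℝ, (⟨p.1, p.2⟩ : ℂ) * ⟨p.1, p.2⟩ =
      (((p.1 ^ 2 : ℝ) : ℂ) - ((p.2 ^ 2 : ℝ) : ℂ)) + 2 * Complex.I * ((p.1 : ℂ) * (p.2 : ℂ)) := by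
    intro p
    rw [Complex.mk_eq_add_mul_I]
    push_cast
    linear_combination ((p.2 : ℂ) ^ 2) * Complex.I_sq
  simp only [this]
  rw [integral_add (f := fun p : ℝ × ℝ => ((p.1 ^ 2 : ℝ) : ℂ) - ((p.2 ^ 2 : ℝ) : ℂ))
    (h1.sub h2) (h3.const_mul _), integral_sub h1 h2, integral_const_mul,
    integral_prod_mul (fun x : ℝ => (x : ℂ)) (fun x : ℝ => (x : ℂ)),
    integral_fun_fst (fun x : ℝ => ((x ^ 2 : ℝ) : ℂ)),
    integral_fun_snd (fun x : ℝ => ((x ^ 2 : ℝ) : ℂ))]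
  simp [integral_ofReal_gaussianReal]

/-- One of the two halves of `ℤ² \ {0}` exchanged by `n ↦ -n`. -/
def halfLattice : Set Freq := {n | 0 < n 0 ∨ (n 0 = 0 ∧ 0 < n 1)}

theorem ne_zero_of_mem_halfLattice {n : Freq} (hn : n ∈ halfLattice) : n ≠ 0 := by
  rintro rfl
  simp [halfLattice] at hn

theorem neg_notMem_halfLattice {n : Freq} (hn : n ∈ halfLattice) : -n ∉ halfLattice := by
  simp only [halfLattice, Set.mem_ofPred_eq, Pi.neg_apply] at hn ⊢
  omega

theorem neg_mem_halfLattice {n : Freq} (h0 : n ≠ 0) (hn : n ∉ halfLattice) : -n ∈ halfLattice := by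
  simp only [halfLattice, Set.mem_ofPred_eq, Pi.neg_apply] at hn ⊢
  by_contra h
  apply h0
  ext i
  fin_cases i <;> simp <;> omega

variable {Ω : Type*} [MeasurableSpace Ω] {P : Measure Ω} {g : Freq → Ω → ℂ}

theorem IsWhiteNoise.hasGaussianLaw (hg : IsWhiteNoise P g) {n : Freq} (hn : n ≠ 0) :
    HasGaussianLaw (g n) P := (hg.law n hn).hasGaussianLaw

theorem IsWhiteNoise.aemeasurable (hg : IsWhiteNoise P g) {n : Freq} (hn : n ≠ 0) :
    AEMeasurable (g n) P := (hg.law n hn).aemeasurable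

theorem IsWhiteNoise.memLp (hg : IsWhiteNoise P g) {n : Freq} (hn : n ≠ 0) {p : ℝ≥0∞}
    (hp : p ≠ ∞) : MemLp (g n) p P := (hg.hasGaussianLaw hn).memLp hp

theorem IsWhiteNoise.integral_comp (hg : IsWhiteNoise P g) {n : Freq} (hn : n ≠ 0) {f : ℂ → ℂ}
    (hf : Continuous f) : ∫ ω, f (g n ω) ∂P = ∫ z, f z ∂stdComplexGaussian := by
  rw [← (hg.law n hn).map_eq, integral_map (hg.aemeasurable hn) hf.aestronglyMeasurable]

theorem IsWhiteNoise.integral_eq_zero (hg : IsWhiteNoise P g) {n : Freq} (hn : n ≠ 0) :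
    ∫ ω, g n ω ∂P = 0 := by
  rw [← stdComplexGaussian_mean]
  exact hg.integral_comp hn (f := fun z => z) continuous_id

/-- The variables of the noise are orthonormal in `L²(Ω)`, including the pairs `(g n, g (-n))`. -/
theorem IsWhiteNoise.integral_mul_conj (hg : IsWhiteNoise P g) {n m : Freq} (hn : n ≠ 0)
    (hm : m ≠ 0) : ∫ ω, g n ω * (starRingEnd ℂ) (g m ω) ∂P = if n = m then 1 else 0 := by
  split_ifs with h
  · subst h
    rw [← stdComplexGaussian_norm_sq,
      ← hg.integral_comp hn (f := fun z => z * (starRingEnd ℂ) z) (by fun_prop)]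
  · by_cases h' : m = -n
    · subst h'
      have : ∫ ω, g n ω * (starRingEnd ℂ) (g (-n) ω) ∂P = ∫ ω, g n ω * g n ω ∂P := by
        refine integral_congr_ae ?_
        filter_upwards [hg.conj n hn] with ω hω
        rw [hω, Complex.conj_conj]
      rw [this, hg.integral_comp hn (f := fun z => z * z) (by fun_prop), stdComplexGaussian_sq]
    · have hi := hg.indep {n, m} (by
        have self : ∀ k : Freq, k ≠ 0 → -k ≠ k := fun k hk h => hk (self_eq_neg.mp h.symm)
        intro k hk
        simp only [Set.mem_insert_iff, Set.mem_singleton_iff] at hk ⊢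
        rcases hk with rfl | rfl
        · exact ⟨hn, fun h => h.elim (self _ hn) (fun h => h' h.symm)⟩
        · exact ⟨hm, fun h => h.elim (fun h => h' (by rw [← h, neg_neg])) (self _ hm)⟩)
      have hi2 : IndepFun (g n) (g m) P :=
        hi.indepFun (i := ⟨n, by simp⟩) (j := ⟨m, by simp⟩) (by simpa using h)
      have hi3 : IndepFun (g n) (fun ω => (starRingEnd ℂ) (g m ω)) P :=
        hi2.comp (φ := id) (ψ := starRingEnd ℂ) measurable_id
          Complex.continuous_conj.measurable
      rw [hi3.integral_fun_mul_eq_mul_integral (hg.aemeasurable hn).aestronglyMeasurable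
        (Complex.continuous_conj.measurable.comp_aemeasurable
          (hg.aemeasurable hm)).aestronglyMeasurable,
        hg.integral_eq_zero hn, zero_mul]

/-- Finitely many variables of the noise are jointly Gaussian: they are the image under a real
linear map of the independent variables indexed by the half lattice. -/
theorem IsWhiteNoise.hasGaussianLaw_restrict (hg : IsWhiteNoise P g) {S : Finset Freq}
    (hS : ∀ n ∈ S, n ≠ 0) : HasGaussianLaw (fun ω (n : S) => g n ω) P := by
  classical
  let T : Set Freq := {n | n ∈ halfLattice ∧ (n ∈ S ∨ -n ∈ S)}
  have hfin : T.Finite := by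
    refine Set.Finite.subset (S.finite_toSet.union (S.image (fun n => -n)).finite_toSet) ?_
    rintro n ⟨-, (h | h)⟩
    · exact Or.inl h
    · exact Or.inr (by simpa using h)
  have : Fintype T := hfin.fintype
  have hG : HasGaussianLaw (fun ω (n : T) => g n ω) P := by
    refine iIndepFun.hasGaussianLaw (fun n => hg.hasGaussianLaw
      (ne_zero_of_mem_halfLattice n.2.1)) (hg.indep T fun n hn =>
      ⟨ne_zero_of_mem_halfLattice hn.1, fun h => neg_notMem_halfLattice hn.1 h.1⟩)
  let L : (T → ℂ) →L[ℝ] (S → ℂ) := ContinuousLinearMap.pi fun n =>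
    if h : (n : Freq) ∈ halfLattice then
      ContinuousLinearMap.proj (R := ℝ) (φ := fun _ : T => ℂ) ⟨n, h, Or.inl n.2⟩
    else Complex.conjCLE.toContinuousLinearMap.comp
      (ContinuousLinearMap.proj (R := ℝ) (φ := fun _ : T => ℂ)
        ⟨-n, neg_mem_halfLattice (hS n n.2) h, Or.inr (by rw [neg_neg]; exact n.2)⟩)
  refine (hG.map_fun L).congr ?_
  have hae : ∀ᵐ ω ∂P, ∀ n : S, g (-n) ω = (starRingEnd ℂ) (g n ω) :=
    ae_all_iff.2 fun n => hg.conj n (hS n n.2)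
  filter_upwards [hae] with ω hω
  funext n
  by_cases h : (n : Freq) ∈ halfLattice
  · simp [L, h]
  · simp [L, h, hω n]

theorem IsWhiteNoise.memLp_sum (hg : IsWhiteNoise P g) {S : Finset Freq}
    (hS : ∀ n ∈ S, n ≠ 0) (c : Freq → ℂ) {p : ℝ≥0∞} (hp : p ≠ ∞) :
    MemLp (fun ω => ∑ n ∈ S, c n * g n ω) p P :=
  memLp_finsetSum S fun n hn => (hg.memLp (hS n hn) hp).const_mul (c n)

theorem IsWhiteNoise.integral_norm_sq_sum (hg : IsWhiteNoise P g) {S : Finset Freq}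
    (hS : ∀ n ∈ S, n ≠ 0) (c : Freq → ℂ) :
    ∫ ω, ‖∑ n ∈ S, c n * g n ω‖ ^ 2 ∂P = ∑ n ∈ S, ‖c n‖ ^ 2 := by
  have hint : ∀ n ∈ S, ∀ m ∈ S, Integrable (fun ω => g n ω * (starRingEnd ℂ) (g m ω)) P := by
    intro n hn m hm
    exact (hg.memLp (hS n hn) (p := 2) (by simp)).integrable_mul
      (hg.memLp (hS m hm) (p := 2) (by simp)).star
  have key : ((∫ ω, ‖∑ n ∈ S, c n * g n ω‖ ^ 2 ∂P : ℝ) : ℂ) =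
      ((∑ n ∈ S, ‖c n‖ ^ 2 : ℝ) : ℂ) := by
    rw [← integral_complex_ofReal]
    have : ∀ ω, (((‖∑ n ∈ S, c n * g n ω‖ ^ 2 : ℝ)) : ℂ) =
        ∑ n ∈ S, ∑ m ∈ S, (c n * (starRingEnd ℂ) (c m)) *
          (g n ω * (starRingEnd ℂ) (g m ω)) := by
      intro ω
      rw [Complex.ofReal_pow, ← Complex.mul_conj', map_sum, Finset.sum_mul_sum]
      refine Finset.sum_congr rfl fun n _ => Finset.sum_congr rfl fun m _ => ?_
      rw [map_mul]
      ring
    simp only [this]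
    rw [integral_finsetSum _ fun n hn => integrable_finsetSum _ fun m hm =>
      (hint n hn m hm).const_mul _]
    push_cast
    refine Finset.sum_congr rfl fun n hn => ?_
    rw [integral_finsetSum _ fun m hm => (hint n hn m hm).const_mul _]
    rw [Finset.sum_eq_single n]
    · rw [integral_const_mul, hg.integral_mul_conj (hS n hn) (hS n hn)]
      simp [Complex.mul_conj']
    · intro m hm hmn
      rw [integral_const_mul, hg.integral_mul_conj (hS n hn) (hS m hm), if_neg (Ne.symm hmn)]
      simp
    · exact fun h => absurd hn h
  exact_mod_cast key

/-- The absolute moment of order `2k` of the standard real Gaussian. -/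
def gaussMoment (k : ℕ) : ℝ≥0∞ := ∫⁻ x, ‖x‖ₑ ^ (2 * k) ∂(gaussianReal 0 1)

theorem gaussMoment_ne_top (k : ℕ) : gaussMoment k ≠ ∞ := by
  have h := (memLp_id_gaussianReal (μ := 0) (v := 1) ((2 * k : ℕ) : ℝ≥0))
  rcases Nat.eq_zero_or_pos k with rfl | hk
  · simp [gaussMoment]
  have h2 := lintegral_rpow_enorm_lt_top_of_eLpNorm_lt_top (p := ((2 * k : ℕ) : ℝ≥0∞))
    (by exact_mod_cast (by omega : 2 * k ≠ 0)) (ENNReal.natCast_ne_top _) (by simpa using h.2)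
  have h3 : ∫⁻ x, ‖(id x : ℝ)‖ₑ ^ (((2 * k : ℕ) : ℝ)) ∂(gaussianReal 0 1) < ∞ := by
    simpa using h2
  simp only [ENNReal.rpow_natCast] at h3
  exact h3.ne

theorem lintegral_pow_gaussianReal (k : ℕ) (v : ℝ≥0) :
    ∫⁻ x, ‖x‖ₑ ^ (2 * k) ∂(gaussianReal 0 v) = gaussMoment k * (v : ℝ≥0∞) ^ k := by
  have h : gaussianReal 0 v = (gaussianReal 0 1).map (Real.sqrt v * ·) := by
    rw [gaussianReal_map_const_mul]
    congr 1
    · simp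
    · ext
      simp
  rw [h, lintegral_map (by fun_prop) (by fun_prop)]
  have : ∀ x : ℝ, ‖Real.sqrt v * x‖ₑ ^ (2 * k) = (v : ℝ≥0∞) ^ k * ‖x‖ₑ ^ (2 * k) := by
    intro x
    rw [enorm_mul, mul_pow, pow_mul ‖Real.sqrt v‖ₑ]
    congr 2
    rw [← enorm_pow, Real.sq_sqrt (NNReal.coe_nonneg v)]
    simp [enorm]
  simp only [this]
  rw [lintegral_const_mul _ (by fun_prop), mul_comm]
  rfl

theorem lintegral_pow_le_of_hasGaussianLaw [IsProbabilityMeasure P] {X : Ω → ℝ}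
    (hX : HasGaussianLaw X P)
    (h0 : ∫ ω, X ω ∂P = 0) {v : ℝ≥0} (hv : ∫ ω, X ω ^ 2 ∂P ≤ v) (k : ℕ) :
    ∫⁻ ω, ‖X ω‖ₑ ^ (2 * k) ∂P ≤ gaussMoment k * (v : ℝ≥0∞) ^ k := by
  have hm := hX.map_eq_gaussianReal
  rw [h0] at hm
  have hvar : Var[X; P] = ∫ ω, X ω ^ 2 ∂P := by
    rw [variance_eq_sub (hX.memLp (by simp)), h0]
    simp
  have : ∫⁻ ω, ‖X ω‖ₑ ^ (2 * k) ∂P = ∫⁻ x, ‖x‖ₑ ^ (2 * k) ∂(P.map X) := by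
    rw [lintegral_map' (by fun_prop) hX.aemeasurable]
  rw [this, hm, lintegral_pow_gaussianReal]
  gcongr
  rw [hvar]
  exact_mod_cast Real.toNNReal_le_iff_le_coe.2 hv

theorem ennreal_add_pow_le (a b : ℝ≥0∞) (k : ℕ) : (a + b) ^ k ≤ 2 ^ k * (a ^ k + b ^ k) := by
  have : a + b ≤ 2 * max a b := by
    rw [two_mul]
    exact add_le_add (le_max_left _ _) (le_max_right _ _)
  calc (a + b) ^ k ≤ (2 * max a b) ^ k := by gcongr
    _ = 2 ^ k * (max a b) ^ k := mul_pow _ _ _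
    _ ≤ 2 ^ k * (a ^ k + b ^ k) := by
      gcongr
      rcases le_total a b with h | h
      · rw [max_eq_right h]; exact le_add_self
      · rw [max_eq_left h]; exact le_self_add

/-- The constant in the moment bound for linear combinations of the noise. -/
def linConst (k : ℕ) : ℝ≥0∞ := 2 ^ (2 * k) * (gaussMoment k + gaussMoment k)

theorem linConst_ne_top (k : ℕ) : linConst k ≠ ∞ :=
  ENNReal.mul_ne_top (by simp) (by simp [gaussMoment_ne_top])

theorem enorm_sq_eq_coe (z : ℂ) : ‖z‖ₑ ^ 2 = ((‖z‖₊ ^ 2 : ℝ≥0) : ℝ≥0∞) := by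
  simp [enorm]

/-- Moments of the first chaos. -/
theorem IsWhiteNoise.lintegral_linear [IsProbabilityMeasure P] (hg : IsWhiteNoise P g) (k : ℕ)
    {S : Finset Freq}
    (hS : ∀ n ∈ S, n ≠ 0) (c : Freq → ℂ) :
    ∫⁻ ω, ‖∑ n ∈ S, c n * g n ω‖ₑ ^ (2 * k) ∂P ≤
      linConst k * (∑ n ∈ S, ‖c n‖ₑ ^ 2) ^ k := by
  set L : Ω → ℂ := fun ω => ∑ n ∈ S, c n * g n ω with hL
  let Λ : (S → ℂ) →L[ℝ] ℂ := ∑ n : S,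
    (ContinuousLinearMap.mul ℝ ℂ (c n)).comp
      (ContinuousLinearMap.proj (R := ℝ) (φ := fun _ : S => ℂ) n)
  have hGL : HasGaussianLaw L P := by
    have h := (hg.hasGaussianLaw_restrict hS).map_fun Λ
    have h2 : (fun ω => Λ (fun n : S => g n ω)) = L := by
      funext ω
      simp only [Λ, hL, sum_apply]
      rw [← Finset.sum_coe_sort S (fun n => c n * g n ω)]
      rfl
    rwa [h2] at h
  have hmemL : MemLp L 2 P := hg.memLp_sum hS c (by simp)
  have hmean : ∫ ω, L ω ∂P = 0 := by
    rw [hL, integral_finsetSum _ fun n hn =>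
      ((hg.memLp (hS n hn) (p := 1) (by simp)).integrable (by simp)).const_mul _]
    refine Finset.sum_eq_zero fun n hn => ?_
    rw [integral_const_mul, hg.integral_eq_zero (hS n hn), mul_zero]
  let v : ℝ≥0 := ∑ n ∈ S, ‖c n‖₊ ^ 2
  have hv : ∫ ω, ‖L ω‖ ^ 2 ∂P = v := by
    rw [hg.integral_norm_sq_sum hS c]
    simp [v]
  have hiL : Integrable L P := hmemL.integrable (by simp)
  have hi2 : Integrable (fun ω => ‖L ω‖ ^ 2) P := hmemL.integrable_norm_pow (by simp)
  have hre : ∫⁻ ω, ‖(L ω).re‖ₑ ^ (2 * k) ∂P ≤ gaussMoment k * (v : ℝ≥0∞) ^ k := by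
    refine lintegral_pow_le_of_hasGaussianLaw (hGL.map_fun Complex.reCLM) ?_ ?_ k
    · have := integral_re hiL
      simp only [RCLike.re_to_complex] at this
      simp [this, hmean]
    · rw [← hv]
      refine integral_mono_of_nonneg (ae_of_all _ fun ω => sq_nonneg _) hi2
        (ae_of_all _ fun ω => ?_)
      exact sq_le_sq.2 (by simpa using Complex.abs_re_le_norm (L ω))
  have him : ∫⁻ ω, ‖(L ω).im‖ₑ ^ (2 * k) ∂P ≤ gaussMoment k * (v : ℝ≥0∞) ^ k := by
    refine lintegral_pow_le_of_hasGaussianLaw (hGL.map_fun Complex.imCLM) ?_ ?_ k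
    · have := integral_im hiL
      simp only [RCLike.im_to_complex] at this
      simp [this, hmean]
    · rw [← hv]
      refine integral_mono_of_nonneg (ae_of_all _ fun ω => sq_nonneg _) hi2
        (ae_of_all _ fun ω => ?_)
      exact sq_le_sq.2 (by simpa using Complex.abs_im_le_norm (L ω))
  have hpt : ∀ ω, ‖L ω‖ₑ ^ (2 * k) ≤
      2 ^ (2 * k) * (‖(L ω).re‖ₑ ^ (2 * k) + ‖(L ω).im‖ₑ ^ (2 * k)) := by
    intro ω
    refine le_trans ?_ (ennreal_add_pow_le _ _ _)
    gcongr
    have h1 : ‖L ω‖ₑ ≤ ‖((L ω).re : ℂ)‖ₑ + ‖((L ω).im : ℂ) * Complex.I‖ₑ := by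
      conv_lhs => rw [← Complex.re_add_im (L ω)]
      exact enorm_add_le _ _
    refine h1.trans (le_of_eq ?_)
    rw [enorm_mul]
    simp [enorm, nnnorm]
  have hmre : AEMeasurable (fun ω => ‖(L ω).re‖ₑ ^ (2 * k)) P :=
    ((Complex.measurable_re.comp_aemeasurable
      hmemL.aestronglyMeasurable.aemeasurable).enorm).pow_const _
  calc ∫⁻ ω, ‖L ω‖ₑ ^ (2 * k) ∂P
      ≤ ∫⁻ ω, 2 ^ (2 * k) * (‖(L ω).re‖ₑ ^ (2 * k) + ‖(L ω).im‖ₑ ^ (2 * k)) ∂P :=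
        lintegral_mono hpt
    _ = 2 ^ (2 * k) * (∫⁻ ω, ‖(L ω).re‖ₑ ^ (2 * k) ∂P + ∫⁻ ω, ‖(L ω).im‖ₑ ^ (2 * k) ∂P) := by
        rw [lintegral_const_mul' _ _ (by simp), lintegral_add_left' hmre]
    _ ≤ 2 ^ (2 * k) * (gaussMoment k * (v : ℝ≥0∞) ^ k + gaussMoment k * (v : ℝ≥0∞) ^ k) := by
        gcongr
    _ = linConst k * (∑ n ∈ S, ‖c n‖ₑ ^ 2) ^ k := by
        have : (v : ℝ≥0∞) = ∑ n ∈ S, ‖c n‖ₑ ^ 2 := by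
          simp only [v, enorm_sq_eq_coe, ENNReal.ofNNReal_finsetSum]
        rw [this, linConst]
        ring

end Moments

/-! ### Moments of quadratic forms of the noise -/

section Quadratic

/-- Minkowski's inequality for a sum of squares. -/
theorem lintegral_sum_sq_pow_le {α ι : Type*} [MeasurableSpace α] {μ : Measure α} (s : Finset ι)
    {f : ι → α → ℝ≥0∞} (hf : ∀ i ∈ s, AEMeasurable (f i) μ) {k : ℕ} (hk : 1 ≤ k) {C : ℝ≥0∞}
    {w : ι → ℝ≥0∞} (hw : ∀ i ∈ s, ∫⁻ a, f i a ^ (2 * k) ∂μ ≤ C * w i ^ k) :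
    ∫⁻ a, (∑ i ∈ s, f i a ^ 2) ^ k ∂μ ≤ C * (∑ i ∈ s, w i) ^ k := by
  have hk0 : (k : ℝ) ≠ 0 := by positivity
  have key : ∀ t ⊆ s, (∫⁻ a, (∑ i ∈ t, f i a ^ 2) ^ (k : ℝ) ∂μ) ^ (1 / (k : ℝ)) ≤
      C ^ (1 / (k : ℝ)) * ∑ i ∈ t, w i := by
    classical
    intro t
    induction t using Finset.induction_on with
    | empty =>
      intro _
      have hk' : 0 < k := hk
      simp [hk'.ne', hk']
    | insert i t hit ih =>
      intro hts
      simp only [Finset.sum_insert hit]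
      have hi : i ∈ s := hts (Finset.mem_insert_self i t)
      have ht : t ⊆ s := fun j hj => hts (Finset.mem_insert_of_mem hj)
      refine (ENNReal.lintegral_Lp_add_le (f := fun a => f i a ^ 2)
        (g := fun a => ∑ j ∈ t, f j a ^ 2) ((hf i hi).pow_const 2)
        (Finset.aemeasurable_fun_sum t fun j hj => (hf j (ht hj)).pow_const 2)
        (by exact_mod_cast hk)).trans ?_
      rw [mul_add]
      refine add_le_add ?_ (ih ht)
      calc (∫⁻ a, (f i a ^ 2) ^ (k : ℝ) ∂μ) ^ (1 / (k : ℝ))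
          ≤ (C * w i ^ k) ^ (1 / (k : ℝ)) := by
            gcongr
            refine le_trans (le_of_eq ?_) (hw i hi)
            refine lintegral_congr fun a => ?_
            rw [ENNReal.rpow_natCast, pow_mul]
        _ = C ^ (1 / (k : ℝ)) * w i := by
            rw [ENNReal.mul_rpow_of_nonneg _ _ (by positivity), ← ENNReal.rpow_natCast,
              ← ENNReal.rpow_mul, mul_one_div_cancel hk0, ENNReal.rpow_one]
  have h := key s subset_rfl
  have h2 : ((∫⁻ a, (∑ i ∈ s, f i a ^ 2) ^ (k : ℝ) ∂μ) ^ (1 / (k : ℝ))) ^ (k : ℝ) ≤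
      (C ^ (1 / (k : ℝ)) * ∑ i ∈ s, w i) ^ (k : ℝ) := by gcongr
  rw [ENNReal.mul_rpow_of_nonneg _ _ (by positivity), ← ENNReal.rpow_mul, ← ENNReal.rpow_mul,
    one_div_mul_cancel hk0, ENNReal.rpow_one, ENNReal.rpow_one] at h2
  simpa only [ENNReal.rpow_natCast] using h2

/-- Symmetrization: a centred variable is dominated, in every even moment, by the difference of two
independent copies. -/
theorem lintegral_pow_le_of_integral_eq_zero {α : Type*} [MeasurableSpace α] {μ : Measure α}
    [IsProbabilityMeasure μ] {f : α → ℂ} (hf : Integrable f μ) (h0 : ∫ a, f a ∂μ = 0) {k : ℕ}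
    (hk : k ≠ 0) :
    ∫⁻ a, ‖f a‖ₑ ^ k ∂μ ≤ ∫⁻ a, ∫⁻ b, ‖f a - f b‖ₑ ^ k ∂μ ∂μ := by
  refine lintegral_mono fun a => ?_
  have h1 : f a = ∫ b, (f a - f b) ∂μ := by
    rw [integral_sub (integrable_const _) hf, h0]
    simp
  have hm : AEStronglyMeasurable (fun b => f a - f b) μ :=
    aestronglyMeasurable_const.sub hf.aestronglyMeasurable
  have h2 : ‖f a‖ₑ ≤ eLpNorm (fun b => f a - f b) k μ := by
    calc ‖f a‖ₑ ≤ ∫⁻ b, ‖f a - f b‖ₑ ∂μ := by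
          conv_lhs => rw [h1]
          exact enorm_integral_le_lintegral_enorm _
      _ = eLpNorm (fun b => f a - f b) 1 μ := eLpNorm_one_eq_lintegral_enorm.symm
      _ ≤ _ := eLpNorm_le_eLpNorm_of_exponent_le
          (by exact_mod_cast Nat.one_le_iff_ne_zero.2 hk) hm
  have h3 : eLpNorm (fun b => f a - f b) k μ ^ k = ∫⁻ b, ‖f a - f b‖ₑ ^ k ∂μ := by
    rw [eLpNorm_eq_lintegral_rpow_enorm_toReal (by exact_mod_cast hk) (ENNReal.natCast_ne_top _),
      ENNReal.toReal_natCast, ← ENNReal.rpow_natCast, ← ENNReal.rpow_mul,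
      one_div_mul_cancel (by exact_mod_cast hk), ENNReal.rpow_one]
    simp only [ENNReal.rpow_natCast]
  calc ‖f a‖ₑ ^ k ≤ eLpNorm (fun b => f a - f b) k μ ^ k := by gcongr
    _ = _ := h3

/-- The constant in the moment bound for quadratic forms of the noise. -/
def quadConst (k : ℕ) : ℝ≥0∞ := 2 ^ (2 * k) * (linConst k * linConst k + linConst k * linConst k)

theorem quadConst_ne_top (k : ℕ) : quadConst k ≠ ∞ := by
  have := linConst_ne_top k
  exact ENNReal.mul_ne_top (by simp) (by finiteness)

variable {ι : Type*} [Fintype ι] {μ : Measure (ι → ℂ)}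

theorem lintegral_linear_conj (hlin : ∀ (k : ℕ) (c : ι → ℂ),
      ∫⁻ z, ‖∑ n, c n * z n‖ₑ ^ (2 * k) ∂μ ≤
      linConst k * (∑ n, ‖c n‖ₑ ^ 2) ^ k) (k : ℕ) (c : ι → ℂ) :
    ∫⁻ z, ‖∑ n, c n * (starRingEnd ℂ) (z n)‖ₑ ^ (2 * k) ∂μ ≤
      linConst k * (∑ n, ‖c n‖ₑ ^ 2) ^ k := by
  have h := hlin k (fun n => (starRingEnd ℂ) (c n))
  have e1 : ∀ z : ι → ℂ, ‖∑ n, c n * (starRingEnd ℂ) (z n)‖ₑ =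
      ‖∑ n, (starRingEnd ℂ) (c n) * z n‖ₑ := by
    intro z
    have : ∑ n, c n * (starRingEnd ℂ) (z n) =
        (starRingEnd ℂ) (∑ n, (starRingEnd ℂ) (c n) * z n) := by
      simp [map_sum]
    rw [this, ← ofReal_norm, ← ofReal_norm, RCLike.norm_conj]
  have e2 : ∀ n, ‖(starRingEnd ℂ) (c n)‖ₑ = ‖c n‖ₑ := by
    intro n
    rw [← ofReal_norm, ← ofReal_norm, RCLike.norm_conj]
  simp only [e2] at h
  simpa only [e1] using h

/-- Moments of the decoupled form obtained from a quadratic form by symmetrization and rotation: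
it is linear in the second variable when the first one is fixed. -/
theorem lintegral_decoupled [IsProbabilityMeasure μ]
    (hlin : ∀ (k : ℕ) (c : ι → ℂ), ∫⁻ z, ‖∑ n, c n * z n‖ₑ ^ (2 * k) ∂μ ≤
      linConst k * (∑ n, ‖c n‖ₑ ^ 2) ^ k) {k : ℕ} (hk : 1 ≤ k) (a : ι → ι → ℂ) :
    ∫⁻ u, ∫⁻ v, ‖∑ n, ∑ m, a n m * (u n * (starRingEnd ℂ) (v m) + v n * (starRingEnd ℂ) (u m))‖ₑ
      ^ (2 * k) ∂μ ∂μ ≤ quadConst k * (∑ n, ∑ m, ‖a n m‖ₑ ^ 2) ^ k := by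
  have hpt : ∀ u v : ι → ℂ,
      ‖∑ n, ∑ m, a n m * (u n * (starRingEnd ℂ) (v m) + v n * (starRingEnd ℂ) (u m))‖ₑ ^ (2 * k) ≤
      2 ^ (2 * k) * (‖∑ m, (∑ n, a n m * u n) * (starRingEnd ℂ) (v m)‖ₑ ^ (2 * k) +
        ‖∑ n, (∑ m, a n m * (starRingEnd ℂ) (u m)) * v n‖ₑ ^ (2 * k)) := by
    intro u v
    refine le_trans ?_ (ennreal_add_pow_le _ _ _)
    gcongr
    refine le_trans (le_of_eq ?_) (enorm_add_le _ _)
    congr 1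
    simp only [mul_add, Finset.sum_add_distrib]
    congr 1
    · rw [Finset.sum_comm]
      refine Finset.sum_congr rfl fun m _ => ?_
      rw [Finset.sum_mul]
      exact Finset.sum_congr rfl fun n _ => by ring
    · refine Finset.sum_congr rfl fun n _ => ?_
      rw [Finset.sum_mul]
      exact Finset.sum_congr rfl fun m _ => by ring
  have hin : ∀ u : ι → ℂ,
      ∫⁻ v, ‖∑ n, ∑ m, a n m * (u n * (starRingEnd ℂ) (v m) + v n * (starRingEnd ℂ) (u m))‖ₑ
        ^ (2 * k) ∂μ ≤ 2 ^ (2 * k) * (linConst k * (∑ m, ‖∑ n, a n m * u n‖ₑ ^ 2) ^ k +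
          linConst k * (∑ n, ‖∑ m, a n m * (starRingEnd ℂ) (u m)‖ₑ ^ 2) ^ k) := by
    intro u
    refine (lintegral_mono (hpt u)).trans ?_
    rw [lintegral_const_mul' _ _ (by simp), lintegral_add_left
      ((by fun_prop : Continuous _).measurable.enorm.pow_const _)]
    gcongr
    · exact lintegral_linear_conj hlin k _
    · exact hlin k _
  refine (lintegral_mono hin).trans ?_
  have hm : Measurable fun u : ι → ℂ =>
      linConst k * (∑ m, ‖∑ n, a n m * u n‖ₑ ^ 2) ^ k := by
    have : ∀ m, Measurable fun u : ι → ℂ => ‖∑ n, a n m * u n‖ₑ :=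
      fun m => (by fun_prop : Continuous fun u : ι → ℂ => ∑ n, a n m * u n).measurable.enorm
    fun_prop
  rw [lintegral_const_mul' _ _ (by simp), lintegral_add_left hm,
    lintegral_const_mul' _ _ (linConst_ne_top k), lintegral_const_mul' _ _ (linConst_ne_top k)]
  have h1 : ∫⁻ u, (∑ m, ‖∑ n, a n m * u n‖ₑ ^ 2) ^ k ∂μ ≤
      linConst k * (∑ n, ∑ m, ‖a n m‖ₑ ^ 2) ^ k := by
    rw [Finset.sum_comm]
    exact lintegral_sum_sq_pow_le _
      (fun m _ => (by fun_prop : Continuous _).measurable.enorm.aemeasurable) hk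
      fun m _ => hlin k (fun n => a n m)
  have h2 : ∫⁻ u, (∑ n, ‖∑ m, a n m * (starRingEnd ℂ) (u m)‖ₑ ^ 2) ^ k ∂μ ≤
      linConst k * (∑ n, ∑ m, ‖a n m‖ₑ ^ 2) ^ k :=
    lintegral_sum_sq_pow_le _
      (fun m _ => (by fun_prop : Continuous _).measurable.enorm.aemeasurable) hk
      fun n _ => lintegral_linear_conj hlin k (fun m => a n m)
  calc _ ≤ 2 ^ (2 * k) * (linConst k * (linConst k * (∑ n, ∑ m, ‖a n m‖ₑ ^ 2) ^ k) +
        linConst k * (linConst k * (∑ n, ∑ m, ‖a n m‖ₑ ^ 2) ^ k)) := by gcongr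
    _ = _ := by rw [quadConst]; ring

/-- Moments of a centred quadratic form of a centred Gaussian vector: two independent copies
`z, z'` are replaced by `(u ± v) / √2`, which decouples the form. -/
theorem lintegral_quadratic [hμ : IsGaussian μ] (hmean : ∫ z, id z ∂μ = 0)
    (hlin : ∀ (k : ℕ) (c : ι → ℂ), ∫⁻ z, ‖∑ n, c n * z n‖ₑ ^ (2 * k) ∂μ ≤
      linConst k * (∑ n, ‖c n‖ₑ ^ 2) ^ k) {k : ℕ} (hk : 1 ≤ k) (a b : ι → ι → ℂ)
    (hint : Integrable (fun z : ι → ℂ => ∑ n, ∑ m, a n m * (z n * (starRingEnd ℂ) (z m) - b n m)) μ)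
    (h0 : ∫ z : ι → ℂ, ∑ n, ∑ m, a n m * (z n * (starRingEnd ℂ) (z m) - b n m) ∂μ = 0) :
    ∫⁻ z : ι → ℂ, ‖∑ n, ∑ m, a n m * (z n * (starRingEnd ℂ) (z m) - b n m)‖ₑ ^ (2 * k) ∂μ ≤
      quadConst k * (∑ n, ∑ m, ‖a n m‖ₑ ^ 2) ^ k := by
  refine (lintegral_pow_le_of_integral_eq_zero hint h0 (by omega)).trans ?_
  refine le_trans (le_of_eq ?_) (lintegral_decoupled hlin hk a)
  have hmeas : Measurable fun p : (ι → ℂ) × (ι → ℂ) =>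
      ‖(∑ n, ∑ m, a n m * (p.1 n * (starRingEnd ℂ) (p.1 m) - b n m)) -
        ∑ n, ∑ m, a n m * (p.2 n * (starRingEnd ℂ) (p.2 m) - b n m)‖ₑ ^ (2 * k) :=
    (by fun_prop : Continuous _).measurable.enorm.pow_const _
  have hmeas2 : Measurable fun p : (ι → ℂ) × (ι → ℂ) =>
      ‖∑ n, ∑ m, a n m * (p.1 n * (starRingEnd ℂ) (p.2 m) + p.2 n * (starRingEnd ℂ) (p.1 m))‖ₑ
        ^ (2 * k) :=
    (by fun_prop : Continuous _).measurable.enorm.pow_const _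
  rw [← lintegral_prod _ hmeas.aemeasurable, ← lintegral_prod _ hmeas2.aemeasurable,
    ← IsGaussian.map_rotation_eq_self hmean (Real.pi / 4), lintegral_map hmeas (by fun_prop)]
  rw [IsGaussian.map_rotation_eq_self hmean (Real.pi / 4)]
  refine lintegral_congr fun p => ?_
  congr 2
  rw [← Finset.sum_sub_distrib]
  refine Finset.sum_congr rfl fun n _ => ?_
  rw [← Finset.sum_sub_distrib]
  refine Finset.sum_congr rfl fun m _ => ?_
  have hs : ((Real.sqrt 2 : ℝ) : ℂ) ^ 2 = 2 := by
    rw [← Complex.ofReal_pow, Real.sq_sqrt (by norm_num)]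
    norm_num
  simp only [ContinuousLinearMap.rotation_apply, Real.cos_pi_div_four, Real.sin_pi_div_four,
    Pi.add_apply, Pi.smul_apply, Complex.real_smul, map_add, map_mul, Complex.conj_ofReal]
  push_cast
  linear_combination (a n m * (p.1 n * (starRingEnd ℂ) (p.2 m) +
    p.2 n * (starRingEnd ℂ) (p.1 m)) / 2) * hs

variable {Ω : Type*} [MeasurableSpace Ω] {P : Measure Ω}
  {g : Freq → Ω → ℂ}

/-- The centred products of the noise. -/
def wickProd (g : Freq → Ω → ℂ) (n m : Freq) (ω : Ω) : ℂ :=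
  g n ω * (starRingEnd ℂ) (g m ω) - if n = m then 1 else 0

theorem IsWhiteNoise.integrable_mul_conj (hg : IsWhiteNoise P g) {n m : Freq} (hn : n ≠ 0)
    (hm : m ≠ 0) : Integrable (fun ω => g n ω * (starRingEnd ℂ) (g m ω)) P :=
  (hg.memLp hn (p := 2) (by simp)).integrable_mul (hg.memLp hm (p := 2) (by simp)).star

theorem IsWhiteNoise.integrable_wickProd [IsProbabilityMeasure P]
    (hg : IsWhiteNoise P g) {n m : Freq} (hn : n ≠ 0)
    (hm : m ≠ 0) : Integrable (wickProd g n m) P :=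
  (hg.integrable_mul_conj hn hm).sub (integrable_const _)

theorem IsWhiteNoise.integral_wickProd [IsProbabilityMeasure P]
    (hg : IsWhiteNoise P g) {n m : Freq} (hn : n ≠ 0)
    (hm : m ≠ 0) : ∫ ω, wickProd g n m ω ∂P = 0 := by
  unfold wickProd
  rw [integral_sub (hg.integrable_mul_conj hn hm) (integrable_const _),
    hg.integral_mul_conj hn hm]
  simp

theorem IsWhiteNoise.lintegral_quadratic_square [IsProbabilityMeasure P]
    (hg : IsWhiteNoise P g) {k : ℕ} (hk : 1 ≤ k)
    {S : Finset Freq} (hS : ∀ n ∈ S, n ≠ 0) (a : Freq → Freq → ℂ) :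
    ∫⁻ ω, ‖∑ n ∈ S, ∑ m ∈ S, a n m * wickProd g n m ω‖ₑ ^ (2 * k) ∂P ≤
      quadConst k * (∑ n ∈ S, ∑ m ∈ S, ‖a n m‖ₑ ^ 2) ^ k := by
  classical
  set X : Ω → S → ℂ := fun ω n => g n ω with hX
  have hG : HasGaussianLaw X P := hg.hasGaussianLaw_restrict hS
  have hXm : AEMeasurable X P := hG.aemeasurable
  have hGm : IsGaussian (P.map X) := hG.isGaussian_map
  have hsum : ∀ f : Freq → ℂ, ∑ n ∈ S, f n = ∑ n : S, f n :=
    fun f => (Finset.sum_coe_sort S f).symm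
  have hsum' : ∀ f : Freq → ℝ≥0∞, ∑ n ∈ S, f n = ∑ n : S, f n :=
    fun f => (Finset.sum_coe_sort S f).symm
  have hmean : ∫ z, id z ∂(P.map X) = 0 := by
    rw [integral_map hXm (by fun_prop)]
    funext n
    have : Integrable X P := hG.integrable
    simp only [id_eq]
    have he : (∫ x, X x ∂P) n = ∫ x, X x n ∂P := eval_integral (fun i => this.eval i) n
    rw [he]
    exact hg.integral_eq_zero (hS n n.2)
  have hlin : ∀ (k : ℕ) (c : S → ℂ), ∫⁻ z, ‖∑ n, c n * z n‖ₑ ^ (2 * k) ∂(P.map X) ≤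
      linConst k * (∑ n, ‖c n‖ₑ ^ 2) ^ k := by
    intro k c
    rw [lintegral_map' ((by fun_prop : Continuous fun z : S → ℂ =>
      ∑ n, c n * z n).measurable.enorm.pow_const _).aemeasurable hXm]
    have h := hg.lintegral_linear k hS (fun n => if h : n ∈ S then c ⟨n, h⟩ else 0)
    simp only [hsum, hsum', Finset.coe_mem, dite_true, Subtype.coe_eta] at h
    exact h
  have hint : Integrable (fun z : S → ℂ => ∑ n : S, ∑ m : S, a n m *
      (z n * (starRingEnd ℂ) (z m) - if (n : Freq) = m then 1 else 0)) (P.map X) := by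
    rw [integrable_map_measure (by fun_prop) hXm]
    exact integrable_finsetSum _ fun n _ => integrable_finsetSum _ fun m _ =>
      (hg.integrable_wickProd (hS n n.2) (hS m m.2)).const_mul _
  have h0 : ∫ z : S → ℂ, ∑ n : S, ∑ m : S, a n m *
      (z n * (starRingEnd ℂ) (z m) - if (n : Freq) = m then 1 else 0) ∂(P.map X) = 0 := by
    rw [integral_map hXm (by fun_prop)]
    change ∫ ω, ∑ n : S, ∑ m : S, a n m * wickProd g n m ω ∂P = 0
    rw [integral_finsetSum _ fun (n : S) _ => integrable_finsetSum _ fun (m : S) _ =>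
      (hg.integrable_wickProd (hS n n.2) (hS m m.2)).const_mul _]
    refine Finset.sum_eq_zero fun n _ => ?_
    rw [integral_finsetSum _ fun (m : S) _ =>
      (hg.integrable_wickProd (hS n n.2) (hS m m.2)).const_mul _]
    refine Finset.sum_eq_zero fun m _ => ?_
    have h := hg.integral_wickProd (hS n n.2) (hS m m.2)
    rw [integral_const_mul]
    exact mul_eq_zero_of_right _ h
  have h := lintegral_quadratic (μ := P.map X) hmean hlin hk (fun n m => a n m)
    (fun n m => if (n : Freq) = m then 1 else 0) hint h0
  rw [lintegral_map' ((by fun_prop : Continuous fun z : S → ℂ => ∑ n : S, ∑ m : S, a n m *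
    (z n * (starRingEnd ℂ) (z m) - if (n : Freq) = m then 1 else 0)).measurable.enorm.pow_const
      _).aemeasurable hXm] at h
  simp only [hsum, hsum']
  exact h

/-- Moments of the second chaos. -/
theorem IsWhiteNoise.lintegral_quadratic [IsProbabilityMeasure P]
    (hg : IsWhiteNoise P g) {k : ℕ} (hk : 1 ≤ k)
    {A : Finset (Freq × Freq)} (hA : ∀ p ∈ A, p.1 ≠ 0 ∧ p.2 ≠ 0) (a : Freq × Freq → ℂ) :
    ∫⁻ ω, ‖∑ p ∈ A, a p * wickProd g p.1 p.2 ω‖ₑ ^ (2 * k) ∂P ≤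
      quadConst k * (∑ p ∈ A, ‖a p‖ₑ ^ 2) ^ k := by
  classical
  set S : Finset Freq := A.image Prod.fst ∪ A.image Prod.snd with hSdef
  have hS : ∀ n ∈ S, n ≠ 0 := by
    intro n hn
    simp only [hSdef, Finset.mem_union, Finset.mem_image] at hn
    rcases hn with ⟨p, hp, rfl⟩ | ⟨p, hp, rfl⟩
    · exact (hA p hp).1
    · exact (hA p hp).2
  have hAS : A ⊆ S ×ˢ S := fun p hp => Finset.mem_product.2
    ⟨Finset.mem_union_left _ (Finset.mem_image_of_mem _ hp),
      Finset.mem_union_right _ (Finset.mem_image_of_mem _ hp)⟩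
  have h := hg.lintegral_quadratic_square hk hS (fun n m => if (n, m) ∈ A then a (n, m) else 0)
  have e1 : ∀ ω, ∑ n ∈ S, ∑ m ∈ S, (if (n, m) ∈ A then a (n, m) else 0) * wickProd g n m ω =
      ∑ p ∈ A, a p * wickProd g p.1 p.2 ω := by
    intro ω
    rw [← Finset.sum_product' (f := fun n m =>
      (if (n, m) ∈ A then a (n, m) else 0) * wickProd g n m ω)]
    symm
    refine Finset.sum_subset_zero_on_sdiff hAS (fun p hp => ?_) (fun p hp => ?_)
    · simp [(Finset.mem_sdiff.1 hp).2]
    · simp [hp]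
  have e2 : ∑ n ∈ S, ∑ m ∈ S, ‖(if (n, m) ∈ A then a (n, m) else 0)‖ₑ ^ 2 =
      ∑ p ∈ A, ‖a p‖ₑ ^ 2 := by
    rw [← Finset.sum_product' (f := fun n m => ‖(if (n, m) ∈ A then a (n, m) else 0)‖ₑ ^ 2)]
    symm
    refine Finset.sum_subset_zero_on_sdiff hAS (fun p hp => ?_) (fun p hp => ?_)
    · simp [(Finset.mem_sdiff.1 hp).2]
    · simp [hp]
  simp only [e1] at h
  rwa [e2] at h

end Quadratic

/-! ### Trigonometric polynomials on a torus -/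

section TrigPoly

/-- The torus `(ℝ / 2πℤ)^d`. -/
abbrev MTorus (d : Type*) : Type _ := d → AddCircle (2 * Real.pi)

/-- The canonical projection `ℝ^d → (ℝ / 2πℤ)^d`. -/
def toTorus {d : Type*} (h : d → ℝ) : MTorus d := fun j => (h j : AddCircle (2 * Real.pi))

variable {d : Type*} [Fintype d]

/-- The character `x ↦ e^{i n·x}` of the torus `(ℝ / 2πℤ)^d`. -/
def mchar (n : d → ℤ) (x : MTorus d) : ℂ := ∏ j, fourier (n j) (x j)

/-- The frequencies of sup norm at most `N`. -/
def mbox (d : Type*) [Fintype d] (N : ℕ) : Finset (d → ℤ) :=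
  open Classical in Fintype.piFinset fun _ => Finset.Icc (-(N : ℤ)) N

theorem mem_mbox {N : ℕ} {n : d → ℤ} : n ∈ mbox d N ↔ ∀ j, |n j| ≤ N := by
  simp [mbox, Fintype.mem_piFinset, abs_le]

theorem card_mbox (N : ℕ) : (mbox d N).card = (2 * N + 1) ^ Fintype.card d := by
  simp [mbox, Fintype.card_piFinset]
  congr 1
  omega

theorem mbox_mono {N M : ℕ} (h : N ≤ M) : mbox d N ⊆ mbox d M := by
  intro n hn
  rw [mem_mbox] at hn ⊢
  exact fun j => (hn j).trans (by exact_mod_cast h)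

theorem mchar_zero (x : MTorus d) : mchar (0 : d → ℤ) x = 1 := by simp [mchar]

theorem mchar_add (n m : d → ℤ) (x : MTorus d) : mchar (n + m) x = mchar n x * mchar m x := by
  simp [mchar, Finset.prod_mul_distrib]

theorem mchar_neg (n : d → ℤ) (x : MTorus d) : mchar (-n) x = (starRingEnd ℂ) (mchar n x) := by
  simp [mchar, map_prod]

theorem mchar_add_right (n : d → ℤ) (x y : MTorus d) :
    mchar n (x + y) = mchar n x * mchar n y := by
  simp only [mchar, Pi.add_apply, ← Finset.prod_mul_distrib]
  refine Finset.prod_congr rfl fun j _ => ?_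
  simp only [fourier_apply, smul_add, AddCircle.toCircle_add, Circle.coe_mul]

@[simp]
theorem norm_mchar (n : d → ℤ) (x : MTorus d) : ‖mchar n x‖ = 1 := by
  rw [mchar, norm_prod]
  exact Finset.prod_eq_one fun j _ => by rw [fourier_apply, Circle.norm_coe]

theorem continuous_mchar (n : d → ℤ) : Continuous (mchar n) := by
  unfold mchar
  fun_prop

theorem mchar_toTorus (n : d → ℤ) (h : d → ℝ) :
    mchar n (toTorus h) = Complex.exp (Complex.I * (∑ j, n j * h j : ℝ)) := by
  simp only [mchar, toTorus, fourier_coe_apply]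
  rw [← Complex.exp_sum]
  congr 1
  push_cast
  rw [Finset.mul_sum]
  refine Finset.sum_congr rfl fun j _ => ?_
  have : (Real.pi : ℂ) ≠ 0 := by exact_mod_cast Real.pi_ne_zero
  field_simp

theorem volume_univ_MTorus : (volume : Measure (MTorus d)) Set.univ =
    ENNReal.ofReal (2 * Real.pi) ^ Fintype.card d := by
  rw [volume_pi, Measure.pi_univ]
  simp [AddCircle.measure_univ]

theorem one_le_volume_MTorus : 1 ≤ (2 * Real.pi) ^ Fintype.card d :=
  one_le_pow₀ (by linarith [Real.pi_gt_three])

theorem integral_fourier (n : ℤ) :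
    ∫ x : AddCircle (2 * Real.pi), fourier n x = if n = 0 then ((2 * Real.pi : ℝ) : ℂ) else 0 := by
  split_ifs with h
  · subst h
    simp [measureReal_def, AddCircle.measure_univ, Real.pi_nonneg]
  · exact integral_eq_zero_of_add_right_eq_neg
      (fun x => fourier_add_half_inv_index h Real.two_pi_pos x)

theorem integral_mchar (n : d → ℤ) :
    ∫ x : MTorus d, mchar n x =
      if n = 0 then (((2 * Real.pi) ^ Fintype.card d : ℝ) : ℂ) else 0 := by
  unfold mchar
  rw [integral_fintype_prod_volume_eq_prod (fun j (x : AddCircle (2 * Real.pi)) => fourier (n j) x)]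
  simp only [integral_fourier]
  split_ifs with h
  · subst h
    simp
  · obtain ⟨j, hj⟩ := Function.ne_iff.1 h
    exact Finset.prod_eq_zero (Finset.mem_univ j) (if_neg hj)

theorem integral_mchar_mul_conj (n m : d → ℤ) :
    ∫ x : MTorus d, mchar n x * (starRingEnd ℂ) (mchar m x) =
      if n = m then (((2 * Real.pi) ^ Fintype.card d : ℝ) : ℂ) else 0 := by
  simp only [← mchar_neg, ← mchar_add, integral_mchar, ← sub_eq_add_neg, sub_eq_zero]

/-- The trigonometric polynomial with frequencies in `A` and coefficients `c`. -/
def trigPoly (A : Finset (d → ℤ)) (c : (d → ℤ) → ℂ) (x : MTorus d) : ℂ :=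
  ∑ n ∈ A, c n * mchar n x

theorem continuous_trigPoly (A : Finset (d → ℤ)) (c : (d → ℤ) → ℂ) :
    Continuous (trigPoly A c) := by
  unfold trigPoly
  exact continuous_finsetSum _ fun n _ => continuous_const.mul (continuous_mchar n)

theorem norm_trigPoly_le (A : Finset (d → ℤ)) (c : (d → ℤ) → ℂ) (x : MTorus d) :
    ‖trigPoly A c x‖ ≤ ∑ n ∈ A, ‖c n‖ := by
  refine (norm_sum_le _ _).trans (le_of_eq ?_)
  simp

theorem integrable_of_continuous {E : Type*} [NormedAddCommGroup E] {f : MTorus d → E}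
    (hf : Continuous f) : Integrable f volume :=
  hf.integrable_of_hasCompactSupport (HasCompactSupport.of_compactSpace f)

/-- Parseval's identity for trigonometric polynomials. -/
theorem integral_norm_sq_trigPoly (A : Finset (d → ℤ)) (c : (d → ℤ) → ℂ) :
    ∫ x : MTorus d, ‖trigPoly A c x‖ ^ 2 =
      (2 * Real.pi) ^ Fintype.card d * ∑ n ∈ A, ‖c n‖ ^ 2 := by
  have key : ((∫ x : MTorus d, ‖trigPoly A c x‖ ^ 2 : ℝ) : ℂ) =
      (((2 * Real.pi) ^ Fintype.card d * ∑ n ∈ A, ‖c n‖ ^ 2 : ℝ) : ℂ) := by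
    rw [← integral_complex_ofReal]
    have : ∀ x : MTorus d, ((‖trigPoly A c x‖ ^ 2 : ℝ) : ℂ) =
        ∑ n ∈ A, ∑ m ∈ A, (c n * (starRingEnd ℂ) (c m)) *
          (mchar n x * (starRingEnd ℂ) (mchar m x)) := by
      intro x
      rw [Complex.ofReal_pow, ← Complex.mul_conj', trigPoly, map_sum, Finset.sum_mul_sum]
      refine Finset.sum_congr rfl fun n _ => Finset.sum_congr rfl fun m _ => ?_
      rw [map_mul]
      ring
    simp only [this]
    have hi : ∀ n m : d → ℤ, Integrable (fun x : MTorus d =>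
        (c n * (starRingEnd ℂ) (c m)) * (mchar n x * (starRingEnd ℂ) (mchar m x))) volume := by
      intro n m
      refine integrable_of_continuous ?_
      have h1 := continuous_mchar n
      have h2 := continuous_mchar m
      fun_prop
    rw [integral_finsetSum _ fun n _ => integrable_finsetSum _ fun m _ => hi n m]
    push_cast
    rw [Finset.mul_sum]
    refine Finset.sum_congr rfl fun n hn => ?_
    rw [integral_finsetSum _ fun m _ => hi n m, Finset.sum_eq_single n]
    · rw [integral_const_mul, integral_mchar_mul_conj, if_pos rfl, Complex.mul_conj']
      push_cast
      ring
    · intro m _ hmn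
      rw [integral_const_mul, integral_mchar_mul_conj, if_neg (Ne.symm hmn), mul_zero]
    · exact fun h => absurd hn h
  exact_mod_cast key

theorem trigPoly_mul (N M : ℕ) (a b : (d → ℤ) → ℂ) :
    ∃ c, ∀ x, trigPoly (mbox d N) a x * trigPoly (mbox d M) b x =
      trigPoly (mbox d (N + M)) c x := by
  classical
  refine ⟨fun l => ∑ p ∈ mbox d N ×ˢ mbox d M with p.1 + p.2 = l, a p.1 * b p.2, fun x => ?_⟩
  simp only [trigPoly, Finset.sum_mul_sum, ← Finset.sum_product']
  have hmap : ∀ p ∈ mbox d N ×ˢ mbox d M, p.1 + p.2 ∈ mbox d (N + M) := by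
    intro p hp
    obtain ⟨h1, h2⟩ := Finset.mem_product.1 hp
    rw [mem_mbox] at h1 h2 ⊢
    intro j
    push_cast
    exact (abs_add_le _ _).trans (add_le_add (h1 j) (h2 j))
  rw [← Finset.sum_fiberwise_of_maps_to hmap]
  refine Finset.sum_congr rfl fun l _ => ?_
  rw [Finset.sum_mul]
  refine Finset.sum_congr rfl fun p hp => ?_
  rw [← (Finset.mem_filter.1 hp).2, mchar_add]
  ring

theorem trigPoly_pow (N : ℕ) (a : (d → ℤ) → ℂ) (k : ℕ) :
    ∃ c, ∀ x, trigPoly (mbox d N) a x ^ k = trigPoly (mbox d (k * N)) c x := by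
  induction k with
  | zero =>
    refine ⟨fun _ => 1, fun x => ?_⟩
    have : mbox d (0 * N) = {0} := by
      ext n
      simp [mem_mbox, funext_iff]
    rw [this]
    simp [trigPoly, mchar_zero]
  | succ k ih =>
    obtain ⟨c, hc⟩ := ih
    obtain ⟨c', hc'⟩ := trigPoly_mul (k * N) N c a
    refine ⟨c', fun x => ?_⟩
    rw [pow_succ, hc x, hc' x, Nat.succ_mul]

theorem norm_sq_trigPoly_le (A : Finset (d → ℤ)) (c : (d → ℤ) → ℂ) (x : MTorus d) :
    ‖trigPoly A c x‖ ^ 2 ≤ A.card * ∫ y : MTorus d, ‖trigPoly A c y‖ ^ 2 := by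
  rw [integral_norm_sq_trigPoly]
  have h1 : ‖trigPoly A c x‖ ^ 2 ≤ (∑ n ∈ A, ‖c n‖) ^ 2 :=
    pow_le_pow_left₀ (norm_nonneg _) (norm_trigPoly_le A c x) 2
  have h2 : (∑ n ∈ A, ‖c n‖) ^ 2 ≤ A.card * ∑ n ∈ A, ‖c n‖ ^ 2 := sq_sum_le_card_mul_sum_sq
  refine h1.trans (h2.trans ?_)
  gcongr
  exact le_mul_of_one_le_left (Finset.sum_nonneg fun _ _ => sq_nonneg _) one_le_volume_MTorus

/-- Nikolskii's inequality: a trigonometric polynomial of degree `N` is bounded by its `L^{2k}` norm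
up to a power of `N`. Applied to the `k`-th power, the loss `N^{d/2}` of the case `k = 1` becomes
`N^{d/(2k)}`. -/
theorem norm_pow_trigPoly_le (N k : ℕ) (c : (d → ℤ) → ℂ) (x : MTorus d) :
    ‖trigPoly (mbox d N) c x‖ₑ ^ (2 * k) ≤
      ((2 * (k * N) + 1) ^ Fintype.card d : ℕ) *
        ∫⁻ y : MTorus d, ‖trigPoly (mbox d N) c y‖ₑ ^ (2 * k) := by
  obtain ⟨c', hc'⟩ := trigPoly_pow N c k
  have h := norm_sq_trigPoly_le (mbox d (k * N)) c' x
  simp only [← hc', norm_pow, ← pow_mul, card_mbox, mul_comm k 2] at h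
  have hc : Continuous fun y : MTorus d => ‖trigPoly (mbox d N) c y‖ ^ (2 * k) :=
    (continuous_trigPoly _ _).norm.pow _
  have e : ∫⁻ y : MTorus d, ‖trigPoly (mbox d N) c y‖ₑ ^ (2 * k) =
      ENNReal.ofReal (∫ y : MTorus d, ‖trigPoly (mbox d N) c y‖ ^ (2 * k)) := by
    rw [ofReal_integral_eq_lintegral_ofReal (integrable_of_continuous hc)
      (ae_of_all _ fun y => by positivity)]
    refine lintegral_congr fun y => ?_
    rw [← ofReal_norm, ENNReal.ofReal_pow (norm_nonneg _)]
  rw [e, ← ofReal_norm, ← ENNReal.ofReal_pow (norm_nonneg _), ← ENNReal.ofReal_natCast,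
    ← ENNReal.ofReal_mul (Nat.cast_nonneg _)]
  exact ENNReal.ofReal_le_ofReal h

theorem exists_toTorus_eq (x : MTorus d) : ∃ h : d → ℝ, toTorus h = x ∧ ∀ j, |h j| ≤ ‖x‖ := by
  have : ∀ j, ∃ r : ℝ, (r : AddCircle (2 * Real.pi)) = x j ∧ |r| = ‖x j‖ := by
    intro j
    obtain ⟨r, hr⟩ := QuotientAddGroup.mk_surjective (x j)
    have hr' : (r : AddCircle (2 * Real.pi)) = x j := hr
    refine ⟨r - round ((2 * Real.pi)⁻¹ * r) * (2 * Real.pi), ?_, ?_⟩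
    · rw [← hr', AddCircle.coe_sub, ← zsmul_eq_mul, AddCircle.coe_zsmul, AddCircle.coe_period]
      simp
    · rw [← hr', AddCircle.norm_eq]
  choose h h1 h2 using this
  exact ⟨h, funext h1, fun j => (h2 j).trans_le (norm_le_pi_norm x j)⟩

theorem norm_toTorus_le {h : d → ℝ} {r : ℝ} (hr : 0 ≤ r) (hh : ∀ j, |h j| ≤ r) :
    ‖toTorus h‖ ≤ r := by
  refine (pi_norm_le_iff_of_nonneg hr).2 fun j => ?_
  refine le_trans ?_ (hh j)
  have : ‖((h j : ℝ) : AddCircle (2 * Real.pi))‖ ≤ ‖h j‖ := QuotientAddGroup.norm_mk_le_norm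
  simpa [toTorus] using this

/-- A trigonometric polynomial is Lipschitz with the constant given by its partial derivatives. -/
theorem norm_trigPoly_sub_le (A : Finset (d → ℤ)) (c : (d → ℤ) → ℂ) {M : ℝ}
    (hM : ∀ j x, ‖trigPoly A (fun n => n j * c n) x‖ ≤ M) (x y : MTorus d) :
    ‖trigPoly A c x - trigPoly A c y‖ ≤ Fintype.card d * M * dist x y := by
  obtain ⟨h, hh, hle⟩ := exists_toTorus_eq (x - y)
  rw [← dist_eq_norm] at hle
  let F : ℝ → ℂ := fun t => trigPoly A c (y + toTorus (t • h))
  have hF : ∀ t, F t = ∑ n ∈ A, (c n * mchar n y) *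
      Complex.exp (Complex.I * ((∑ j, n j * h j : ℝ) : ℂ) * (t : ℂ)) := by
    intro t
    refine Finset.sum_congr rfl fun n _ => ?_
    rw [mchar_add_right, mchar_toTorus, mul_assoc, mul_assoc Complex.I]
    congr 4
    rw [← Complex.ofReal_mul, Finset.sum_mul]
    congr 1
    refine Finset.sum_congr rfl fun j _ => ?_
    simp only [Pi.smul_apply, smul_eq_mul]
    ring
  have hder : ∀ t : ℝ, HasDerivAt F (Complex.I * ∑ j, (h j : ℂ) *
      trigPoly A (fun n => n j * c n) (y + toTorus (t • h))) t := by
    intro t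
    have h1 : HasDerivAt F (∑ n ∈ A, (c n * mchar n y) *
        (Complex.exp (Complex.I * ((∑ j, n j * h j : ℝ) : ℂ) * (t : ℂ)) *
          (Complex.I * ((∑ j, n j * h j : ℝ) : ℂ)))) t := by
      rw [funext hF]
      refine HasDerivAt.fun_sum fun n _ => HasDerivAt.const_mul _ ?_
      have h2 : HasDerivAt (fun s : ℝ => Complex.I * ((∑ j, n j * h j : ℝ) : ℂ) * (s : ℂ))
          (Complex.I * ((∑ j, n j * h j : ℝ) : ℂ)) t := by
        simpa using (HasDerivAt.ofReal_comp (hasDerivAt_id t)).const_mul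
          (Complex.I * ((∑ j, n j * h j : ℝ) : ℂ))
      exact h2.cexp
    convert h1 using 1
    simp only [trigPoly, Finset.mul_sum]
    rw [Finset.sum_comm]
    refine Finset.sum_congr rfl fun n _ => ?_
    have e : mchar n (y + toTorus (t • h)) = mchar n y *
        Complex.exp (Complex.I * ((∑ j, n j * h j : ℝ) : ℂ) * (t : ℂ)) := by
      rw [mchar_add_right, mchar_toTorus, mul_assoc Complex.I]
      congr 3
      rw [← Complex.ofReal_mul, Finset.sum_mul]
      congr 1
      refine Finset.sum_congr rfl fun j _ => ?_
      simp only [Pi.smul_apply, smul_eq_mul]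
      ring
    rw [e]
    push_cast
    simp only [Finset.mul_sum]
    exact Finset.sum_congr rfl fun j _ => by ring
  have hbound : ∀ t ∈ Set.Ico (0 : ℝ) 1, ‖Complex.I * ∑ j, (h j : ℂ) *
      trigPoly A (fun n => n j * c n) (y + toTorus (t • h))‖ ≤ Fintype.card d * M * dist x y := by
    intro t _
    rw [norm_mul, Complex.norm_I, one_mul]
    refine (norm_sum_le _ _).trans ?_
    refine (Finset.sum_le_card_nsmul _ _ (dist x y * M) fun j _ => ?_).trans (le_of_eq ?_)
    · rw [norm_mul, Complex.norm_real]
      exact mul_le_mul (hle j) (hM j _) (norm_nonneg _) dist_nonneg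
    · simp [Finset.card_univ]
      ring
  have := norm_image_sub_le_of_norm_deriv_le_segment_01' (f := F)
    (fun t _ => (hder t).hasDerivWithinAt) hbound
  have e1 : F 1 = trigPoly A c x := by
    simp [F, hh]
  have e0 : F 0 = trigPoly A c y := by
    have : toTorus (0 : d → ℝ) = 0 := by
      ext j
      simp [toTorus]
    simp [F, this]
  rwa [e1, e0] at this

end TrigPoly

/-! ### Random Fourier series with Hölder continuous sums -/

section RandomSeries

variable {d : Type*} [Fintype d]

theorem norm_pow_trigPoly_le_of_subset {A : Finset (d → ℤ)} {N : ℕ} (hA : A ⊆ mbox d N) (k : ℕ)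
    (c : (d → ℤ) → ℂ) (x : MTorus d) :
    ‖trigPoly A c x‖ₑ ^ (2 * k) ≤ ((2 * (k * N) + 1) ^ Fintype.card d : ℕ) *
      ∫⁻ y : MTorus d, ‖trigPoly A c y‖ₑ ^ (2 * k) := by
  classical
  have e : ∀ y : MTorus d, trigPoly A c y =
      trigPoly (mbox d N) (fun n => if n ∈ A then c n else 0) y := by
    intro y
    refine Finset.sum_subset_zero_on_sdiff hA (fun n hn => ?_) (fun n hn => ?_)
    · simp [(Finset.mem_sdiff.1 hn).2]
    · simp [hn]
  simp only [e]
  exact norm_pow_trigPoly_le N k _ x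

/-- The dyadic block of frequencies of sup norm in `(2^j, 2^(j+1)]`. -/
def dyadicBlock (d : Type*) [Fintype d] (j : ℕ) : Finset (d → ℤ) :=
  open Classical in mbox d (2 ^ (j + 1)) \ mbox d (2 ^ j)

theorem dyadicBlock_subset (j : ℕ) : dyadicBlock d j ⊆ mbox d (2 ^ (j + 1)) := by
  classical
  exact Finset.sdiff_subset

theorem trigPoly_add_block (j : ℕ) (c : (d → ℤ) → ℂ) (x : MTorus d) :
    trigPoly (mbox d (2 ^ j)) c x + trigPoly (dyadicBlock d j) c x =
      trigPoly (mbox d (2 ^ (j + 1))) c x := by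
  classical
  rw [add_comm]
  exact Finset.sum_sdiff (mbox_mono (Nat.pow_le_pow_right (by norm_num) (Nat.le_succ j)))

theorem trigPoly_eq_add_sum_blocks (j : ℕ) (c : (d → ℤ) → ℂ) (x : MTorus d) :
    trigPoly (mbox d (2 ^ j)) c x =
      trigPoly (mbox d 1) c x + ∑ i ∈ Finset.range j, trigPoly (dyadicBlock d i) c x := by
  induction j with
  | zero => simp
  | succ j ih => rw [← trigPoly_add_block, ih, Finset.sum_range_succ, add_assoc]

variable {Ω : Type*} [MeasurableSpace Ω] {P : Measure Ω}

/-- The random variables `ξ` behave like an orthonormal family in a fixed Gaussian chaos: the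
moments of their linear combinations are bounded by the `ℓ²` norm of the coefficients. -/
structure HasChaosMoments {ι : Type*} (P : Measure Ω) (ξ : ι → Ω → ℂ) : Prop where
  aemeasurable : ∀ i, AEMeasurable (ξ i) P
  moment : ∀ k : ℕ, 1 ≤ k → ∃ C : ℝ≥0∞, C ≠ ∞ ∧ ∀ (A : Finset ι) (c : ι → ℂ),
    ∫⁻ ω, ‖∑ i ∈ A, c i * ξ i ω‖ₑ ^ (2 * k) ∂P ≤ C * (∑ i ∈ A, ‖c i‖ₑ ^ 2) ^ k

theorem aemeasurable_trigPoly_prod {ξ : (d → ℤ) → Ω → ℂ} (hξ : ∀ n, AEMeasurable (ξ n) P)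
    (A : Finset (d → ℤ)) (a : (d → ℤ) → ℂ) :
    AEMeasurable (fun p : Ω × MTorus d => trigPoly A (fun n => a n * ξ n p.1) p.2)
      (P.prod volume) := by
  refine Finset.aemeasurable_fun_sum A fun n _ => ?_
  refine (AEMeasurable.const_mul ?_ _).mul ?_
  · exact (hξ n).comp_quasiMeasurePreserving Measure.quasiMeasurePreserving_fst
  · exact ((continuous_mchar n).measurable.comp measurable_snd).aemeasurable

theorem lintegral_lintegral_trigPoly_le [IsProbabilityMeasure P] {ξ : (d → ℤ) → Ω → ℂ}
    (hξ : ∀ n, AEMeasurable (ξ n) P) {k : ℕ} {C : ℝ≥0∞}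
    (hC : ∀ (A : Finset (d → ℤ)) (c : (d → ℤ) → ℂ),
      ∫⁻ ω, ‖∑ i ∈ A, c i * ξ i ω‖ₑ ^ (2 * k) ∂P ≤ C * (∑ i ∈ A, ‖c i‖ₑ ^ 2) ^ k)
    (A : Finset (d → ℤ)) (a : (d → ℤ) → ℂ) :
    ∫⁻ ω, (∫⁻ x : MTorus d, ‖trigPoly A (fun n => a n * ξ n ω) x‖ₑ ^ (2 * k)) ∂P ≤
      ENNReal.ofReal (2 * Real.pi) ^ Fintype.card d * (C * (∑ i ∈ A, ‖a i‖ₑ ^ 2) ^ k) := by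
  rw [lintegral_lintegral_swap ((aemeasurable_trigPoly_prod hξ A a).enorm.pow_const _)]
  calc ∫⁻ x : MTorus d, ∫⁻ ω, ‖trigPoly A (fun n => a n * ξ n ω) x‖ₑ ^ (2 * k) ∂P
      ≤ ∫⁻ _ : MTorus d, C * (∑ i ∈ A, ‖a i‖ₑ ^ 2) ^ k := by
        refine lintegral_mono fun x => ?_
        have h := hC A (fun n => a n * mchar n x)
        simp only [enorm_mul] at h
        have h1 : ∀ n, ‖mchar n x‖ₑ = 1 := fun n => by rw [← ofReal_norm]; simp
        simp only [h1, mul_one] at h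
        refine le_trans (le_of_eq ?_) h
        refine lintegral_congr fun ω => ?_
        congr 2
        exact Finset.sum_congr rfl fun n _ => by ring
    _ = _ := by rw [lintegral_const, volume_univ_MTorus, mul_comm]

theorem sum_enorm_sq_eq_ofReal {ι : Type*} (A : Finset ι) (a : ι → ℂ) :
    ∑ i ∈ A, ‖a i‖ₑ ^ 2 = ENNReal.ofReal (∑ i ∈ A, ‖a i‖ ^ 2) := by
  rw [ENNReal.ofReal_sum_of_nonneg fun _ _ => sq_nonneg _]
  refine Finset.sum_congr rfl fun i _ => ?_
  rw [← ofReal_norm, ENNReal.ofReal_pow (norm_nonneg _)]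

/-- A sequence of nonnegative random variables with summable expectations is a.s. bounded. -/
theorem ae_exists_bound {ι : Type*} [Countable ι] {F : ι → Ω → ℝ≥0∞}
    (hF : ∀ j, AEMeasurable (F j) P) {w : ι → ℝ}
    (hw0 : ∀ j, 0 ≤ w j) (hw : Summable w) {C : ℝ≥0∞} (hC : C ≠ ∞)
    (h : ∀ j, ∫⁻ ω, F j ω ∂P ≤ C * ENNReal.ofReal (w j)) :
    ∀ᵐ ω ∂P, ∃ M : ℝ, 1 ≤ M ∧ ∀ j, F j ω ≤ ENNReal.ofReal M := by
  have h1 : ∫⁻ ω, ∑' j, F j ω ∂P ≠ ∞ := by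
    rw [lintegral_tsum hF]
    refine ne_top_of_le_ne_top ?_ (ENNReal.tsum_le_tsum h)
    rw [ENNReal.tsum_mul_left, ← ENNReal.ofReal_tsum_of_nonneg hw0 hw]
    exact ENNReal.mul_ne_top hC ENNReal.ofReal_ne_top
  filter_upwards [ae_lt_top' (AEMeasurable.tsum hF) h1] with ω hω
  refine ⟨max 1 (∑' j, F j ω).toReal, le_max_left _ _, fun j => ?_⟩
  refine (ENNReal.le_tsum (f := fun j => F j ω) j).trans ?_
  refine (ENNReal.ofReal_toReal hω.ne).symm.le.trans ?_
  exact ENNReal.ofReal_le_ofReal (le_max_right _ _)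

/-- The sup norms of the dyadic blocks decay almost as fast as their standard deviations: by
Nikolskii's inequality for `L^{2k}` norms the loss in the passage to the supremum is an arbitrarily
small power of `2^j`. -/
theorem ae_block_bound [IsProbabilityMeasure P] {ξ : (d → ℤ) → Ω → ℂ} (hξ : HasChaosMoments P ξ)
    {a : (d → ℤ) → ℂ} {K q q' : ℝ} (hK : 0 ≤ K) (hq : 0 < q) (hqq : q < q')
    (ha : ∀ j, ∑ n ∈ dyadicBlock d j, ‖a n‖ ^ 2 ≤ K * q ^ (2 * j)) :
    ∀ᵐ ω ∂P, ∃ C : ℝ, 0 ≤ C ∧ ∀ j x,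
      ‖trigPoly (dyadicBlock d j) (fun n => a n * ξ n ω) x‖ ≤ C * q' ^ j := by
  have hq' : 0 < q' := hq.trans hqq
  set D := Fintype.card d
  -- for `k` large, Nikolskii's factor `2^{jD}` is absorbed by `(q' / q)^{2kj}`
  obtain ⟨k, hk1, hk⟩ : ∃ k : ℕ, 1 ≤ k ∧ 2 ^ D * (q / q') ^ (2 * k) < 1 := by
    have h1 : q / q' < 1 := (div_lt_one hq').2 hqq
    have h2 : Tendsto (fun k : ℕ => (2 : ℝ) ^ D * ((q / q') ^ 2) ^ k) atTop (𝓝 (2 ^ D * 0)) :=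
      (tendsto_pow_atTop_nhds_zero_of_lt_one (by positivity)
        (pow_lt_one₀ (by positivity) h1 (by norm_num))).const_mul _
    rw [mul_zero] at h2
    obtain ⟨k, hk⟩ := ((h2.eventually_lt_const one_pos).and (eventually_ge_atTop 1)).exists
    exact ⟨k, hk.2, by rw [pow_mul]; exact hk.1⟩
  obtain ⟨C, hC, hmom⟩ := hξ.moment k hk1
  set I : ℕ → Ω → ℝ≥0∞ := fun j ω =>
    ∫⁻ x : MTorus d, ‖trigPoly (dyadicBlock d j) (fun n => a n * ξ n ω) x‖ₑ ^ (2 * k) with hI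
  have hIm : ∀ j, AEMeasurable (I j) P := fun j =>
    ((aemeasurable_trigPoly_prod hξ.aemeasurable _ a).enorm.pow_const _).lintegral_prod_right'
  set F : ℕ → Ω → ℝ≥0∞ := fun j ω => ENNReal.ofReal ((2 ^ D / q' ^ (2 * k)) ^ j) * I j ω with hF
  have hbd := ae_exists_bound (P := P) (F := F) (fun j => (hIm j).const_mul _)
    (w := fun j => K ^ k * (2 ^ D * (q / q') ^ (2 * k)) ^ j) (fun j => by positivity)
    ((summable_geometric_of_lt_one (by positivity) hk).mul_left _)
    (C := ENNReal.ofReal (2 * Real.pi) ^ D * C) (by finiteness) ?_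
  · filter_upwards [hbd] with ω ⟨M, hM1, hM⟩
    refine ⟨(4 * k + 1) ^ D * M, by positivity, fun j x => ?_⟩
    have hC1 : (1 : ℝ) ≤ (4 * k + 1) ^ D * M := one_le_mul_of_one_le_of_one_le
      (one_le_pow₀ (by linarith [(Nat.cast_nonneg k : (0 : ℝ) ≤ k)])) hM1
    have h1 := norm_pow_trigPoly_le_of_subset (dyadicBlock_subset j) k
      (fun n => a n * ξ n ω) x
    have h2 : ((2 * (k * 2 ^ (j + 1)) + 1) ^ D : ℕ) ≤ (4 * k + 1) ^ D * (2 ^ D) ^ j := by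
      rw [← pow_mul, mul_comm D j, pow_mul, ← mul_pow]
      refine Nat.pow_le_pow_left ?_ _
      have : 1 ≤ 2 ^ j := Nat.one_le_two_pow
      rw [pow_succ]
      nlinarith
    have h3 : I j ω ≤ ENNReal.ofReal ((q' ^ (2 * k) / 2 ^ D) ^ j * M) := by
      calc I j ω = ENNReal.ofReal ((q' ^ (2 * k) / 2 ^ D) ^ j) * F j ω := by
            rw [hF]
            simp only
            rw [← mul_assoc, ← ENNReal.ofReal_mul (by positivity), ← mul_pow]
            have : q' ^ (2 * k) / 2 ^ D * (2 ^ D / q' ^ (2 * k)) = 1 := by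
              field_simp
            rw [this]
            simp
        _ ≤ ENNReal.ofReal ((q' ^ (2 * k) / 2 ^ D) ^ j) * ENNReal.ofReal M := by
            gcongr
            exact hM j
        _ = _ := by rw [← ENNReal.ofReal_mul (by positivity)]
    have h4 : ‖trigPoly (dyadicBlock d j) (fun n => a n * ξ n ω) x‖ₑ ^ (2 * k) ≤
        ENNReal.ofReal ((4 * k + 1) ^ D * (2 ^ D) ^ j * ((q' ^ (2 * k) / 2 ^ D) ^ j * M)) := by
      refine h1.trans ?_
      rw [ENNReal.ofReal_mul (by positivity)]
      gcongr
      rw [← ENNReal.ofReal_natCast]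
      refine ENNReal.ofReal_le_ofReal ?_
      exact_mod_cast h2
    rw [← ofReal_norm, ← ENNReal.ofReal_pow (norm_nonneg _),
      ENNReal.ofReal_le_ofReal_iff (by positivity)] at h4
    have h5 : ((4 * k + 1 : ℝ)) ^ D * (2 ^ D) ^ j * ((q' ^ (2 * k) / 2 ^ D) ^ j * M) ≤
        ((4 * k + 1) ^ D * M * q' ^ j) ^ (2 * k) := by
      have e1 : ((4 * k + 1 : ℝ)) ^ D * (2 ^ D) ^ j * ((q' ^ (2 * k) / 2 ^ D) ^ j * M) =
          ((4 * k + 1) ^ D * M) * (q' ^ j) ^ (2 * k) := by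
        rw [div_pow, ← pow_mul q', ← pow_mul q', mul_comm (2 * k) j]
        field_simp
      rw [e1, mul_pow _ (q' ^ j)]
      gcongr
      exact le_self_pow₀ hC1 (by omega)
    exact le_of_pow_le_pow_left₀ (by omega) (by positivity) (h4.trans h5)
  · intro j
    rw [hF]
    simp only
    rw [lintegral_const_mul' _ _ ENNReal.ofReal_ne_top]
    have h1 := lintegral_lintegral_trigPoly_le hξ.aemeasurable hmom (dyadicBlock d j) a
    have h2 : (∑ i ∈ dyadicBlock d j, ‖a i‖ₑ ^ 2) ^ k ≤
        ENNReal.ofReal ((K * q ^ (2 * j)) ^ k) := by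
      rw [sum_enorm_sq_eq_ofReal, ← ENNReal.ofReal_pow (Finset.sum_nonneg fun _ _ => sq_nonneg _)]
      exact ENNReal.ofReal_le_ofReal (pow_le_pow_left₀
        (Finset.sum_nonneg fun _ _ => sq_nonneg _) (ha j) k)
    calc _ ≤ ENNReal.ofReal ((2 ^ D / q' ^ (2 * k)) ^ j) *
          (ENNReal.ofReal (2 * Real.pi) ^ D * (C * ENNReal.ofReal ((K * q ^ (2 * j)) ^ k))) := by
          gcongr
          exact h1.trans (by gcongr)
      _ = ENNReal.ofReal (2 * Real.pi) ^ D * C *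
          (ENNReal.ofReal ((2 ^ D / q' ^ (2 * k)) ^ j) *
              ENNReal.ofReal ((K * q ^ (2 * j)) ^ k)) := by
          ring
      _ = _ := by
          rw [← ENNReal.ofReal_mul (by positivity)]
          congr 2
          rw [mul_pow K, mul_pow, div_pow, div_pow, div_pow, ← pow_mul, ← pow_mul, ← pow_mul,
            ← pow_mul q]
          have : 2 * j * k = 2 * k * j := by ring
          rw [this]
          field_simp

end RandomSeries

section HolderSeries

variable {d : Type*} [Fintype d]

/-- The dyadic partial sums of the Fourier series with coefficients `c` are bounded by `C` and
converge pointwise to `V`, which is `θ`-Hölder continuous with constant `C`. -/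
structure IsHolderSeries (c : (d → ℤ) → ℂ) (θ C : ℝ) (V : MTorus d → ℂ) : Prop where
  bound : ∀ j x, ‖trigPoly (mbox d (2 ^ j)) c x‖ ≤ C
  tendsto : ∀ x, Tendsto (fun j => trigPoly (mbox d (2 ^ j)) c x) atTop (𝓝 (V x))
  holder : ∀ x y, ‖V x - V y‖ ≤ C * dist x y ^ θ

theorem IsHolderSeries.nonneg {c : (d → ℤ) → ℂ} {θ C : ℝ} {V : MTorus d → ℂ}
    (h : IsHolderSeries c θ C V) : 0 ≤ C := (norm_nonneg _).trans (h.bound 0 0)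

theorem IsHolderSeries.norm_le {c : (d → ℤ) → ℂ} {θ C : ℝ} {V : MTorus d → ℂ}
    (h : IsHolderSeries c θ C V) (x : MTorus d) : ‖V x‖ ≤ C :=
  le_of_tendsto (h.tendsto x).norm (Eventually.of_forall fun j => h.bound j x)

theorem continuous_of_holder {X : Type*} [PseudoMetricSpace X] {V : X → ℂ} {C θ : ℝ} (hθ : 0 < θ)
    (h : ∀ x y, ‖V x - V y‖ ≤ C * dist x y ^ θ) : Continuous V := by
  rw [continuous_iff_continuousAt]
  intro y
  rw [ContinuousAt, tendsto_iff_norm_sub_tendsto_zero]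
  have h1 : Tendsto (fun x => C * dist x y ^ θ) (𝓝 y) (𝓝 (C * 0 ^ θ)) := by
    refine Tendsto.const_mul _ ?_
    have h2 : Tendsto (fun x => dist x y) (𝓝 y) (𝓝 0) := tendsto_iff_dist_tendsto_zero.1 tendsto_id
    exact ((Real.continuousAt_rpow_const 0 θ (Or.inr hθ.le)).tendsto).comp h2
  rw [Real.zero_rpow hθ.ne', mul_zero] at h1
  exact squeeze_zero (fun _ => norm_nonneg _) (fun x => h x y) h1

theorem IsHolderSeries.continuous {c : (d → ℤ) → ℂ} {θ C : ℝ} {V : MTorus d → ℂ}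
    (h : IsHolderSeries c θ C V) (hθ : 0 < θ) : Continuous V :=
  continuous_of_holder hθ h.holder

theorem le_rpow_mul_rpow_of_le {t a b θ : ℝ} (ht : 0 ≤ t) (hθ : 0 ≤ θ) (hθ1 : θ ≤ 1)
    (ha : t ≤ a) (hb : t ≤ b) : t ≤ a ^ (1 - θ) * b ^ θ := by
  rcases ht.eq_or_lt with rfl | ht'
  · exact mul_nonneg (Real.rpow_nonneg ha _) (Real.rpow_nonneg hb _)
  calc t = t ^ (1 - θ) * t ^ θ := by rw [← Real.rpow_add ht']; simp
    _ ≤ a ^ (1 - θ) * b ^ θ := mul_le_mul (Real.rpow_le_rpow ht ha (by linarith))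
      (Real.rpow_le_rpow ht hb hθ) (Real.rpow_nonneg ht _) (Real.rpow_nonneg (ht.trans ha) _)

/-- Blocks of sup norm `O(q^j)` and Lipschitz constant `O((2q)^j)` add up to a `θ`-Hölder function
when `q 2^θ < 1`. -/
theorem exists_isHolderSeries {c : (d → ℤ) → ℂ} {θ q C L : ℝ} (hθ : 0 < θ) (hθ1 : θ ≤ 1)
    (hq : 0 < q) (hq1 : q * 2 ^ θ < 1) (hC : 0 ≤ C) (hL : 0 ≤ L)
    (hbound : ∀ j x, ‖trigPoly (dyadicBlock d j) c x‖ ≤ C * q ^ j)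
    (hderiv : ∀ i j x, ‖trigPoly (dyadicBlock d j) (fun n => n i * c n) x‖ ≤ L * (2 * q) ^ j) :
    ∃ V C', IsHolderSeries c θ C' V := by
  have h2θ : (1 : ℝ) ≤ 2 ^ θ := Real.one_le_rpow (by norm_num) hθ.le
  have hqlt : q < 1 := by nlinarith
  have hsum : Summable fun j : ℕ => C * q ^ j :=
    (summable_geometric_of_lt_one hq.le hqlt).mul_left C
  have hs : ∀ x, Summable fun j => trigPoly (dyadicBlock d j) c x := fun x =>
    Summable.of_norm_bounded hsum fun j => hbound j x
  -- the interpolation of the two bounds on a block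
  have hint : ∀ (A : Finset (d → ℤ)) (M N : ℝ), 0 ≤ N →
      (∀ x, ‖trigPoly A c x‖ ≤ M) →
      (∀ i x, ‖trigPoly A (fun n => n i * c n) x‖ ≤ N) → ∀ x y,
      ‖trigPoly A c x - trigPoly A c y‖ ≤
        ((2 * M) ^ (1 - θ) * (Fintype.card d * N) ^ θ) * dist x y ^ θ := by
    intro A M N hN hM hN' x y
    have h1 : ‖trigPoly A c x - trigPoly A c y‖ ≤ 2 * M := by
      refine (norm_sub_le _ _).trans ?_
      linarith [hM x, hM y]
    have h2 := norm_trigPoly_sub_le A c hN' x y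
    have h3 := le_rpow_mul_rpow_of_le (norm_nonneg _) hθ.le hθ1 h1 h2
    rwa [Real.mul_rpow (by positivity) dist_nonneg, ← mul_assoc] at h3
  set M₀ := ∑ n ∈ mbox d 1, ‖c n‖ with hM₀
  have hT0 : ∀ x, ‖trigPoly (mbox d 1) c x‖ ≤ M₀ := norm_trigPoly_le _ c
  have hT0' : ∀ i x, ‖trigPoly (mbox d 1) (fun n => n i * c n) x‖ ≤ M₀ := by
    intro i x
    refine (norm_trigPoly_le _ _ x).trans (Finset.sum_le_sum fun n hn => ?_)
    rw [norm_mul, Complex.norm_intCast]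
    refine mul_le_of_le_one_left (norm_nonneg _) ?_
    have := (mem_mbox.1 hn) i
    exact_mod_cast this
  have hM₀0 : 0 ≤ M₀ := Finset.sum_nonneg fun _ _ => norm_nonneg _
  set H₀ := (2 * M₀) ^ (1 - θ) * (Fintype.card d * M₀) ^ θ with hH₀
  set H := (2 * C) ^ (1 - θ) * (Fintype.card d * L) ^ θ with hH
  have hH₀0 : 0 ≤ H₀ := by positivity
  have hH0 : 0 ≤ H := by positivity
  have hblock : ∀ j x y, ‖trigPoly (dyadicBlock d j) c x - trigPoly (dyadicBlock d j) c y‖ ≤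
      (H * dist x y ^ θ) * (q * 2 ^ θ) ^ j := by
    intro j x y
    refine (hint _ _ _ (by positivity) (hbound j) (fun i => hderiv i j) x y).trans (le_of_eq ?_)
    have e1 : (2 * (C * q ^ j)) ^ (1 - θ) = (2 * C) ^ (1 - θ) * (q ^ (1 - θ)) ^ j := by
      rw [← mul_assoc, Real.mul_rpow (by positivity) (by positivity), ← Real.rpow_natCast,
        ← Real.rpow_mul hq.le, mul_comm (j : ℝ), Real.rpow_mul hq.le, Real.rpow_natCast]
    have e2 : (Fintype.card d * (L * (2 * q) ^ j)) ^ θ =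
        (Fintype.card d * L) ^ θ * ((2 * q) ^ θ) ^ j := by
      rw [← mul_assoc, Real.mul_rpow (by positivity) (by positivity), ← Real.rpow_natCast,
        ← Real.rpow_mul (by positivity), mul_comm (j : ℝ), Real.rpow_mul (by positivity),
        Real.rpow_natCast]
    have e3 : q ^ (1 - θ) * (2 * q) ^ θ = q * 2 ^ θ := by
      rw [Real.mul_rpow (by norm_num) hq.le, mul_left_comm, ← Real.rpow_add hq]
      simp [mul_comm]
    rw [e1, e2, ← e3, mul_pow, hH]
    ring
  have hr : 0 ≤ q * 2 ^ θ := by positivity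
  have hsumθ : Summable fun j : ℕ => (q * 2 ^ θ) ^ j := summable_geometric_of_lt_one hr hq1
  set S := ∑' j : ℕ, C * q ^ j
  set S' := ∑' j : ℕ, (q * 2 ^ θ) ^ j
  have hS0 : 0 ≤ S := tsum_nonneg fun j => by positivity
  have hS0' : 0 ≤ S' := tsum_nonneg fun j => by positivity
  refine ⟨fun x => trigPoly (mbox d 1) c x + ∑' j, trigPoly (dyadicBlock d j) c x,
    (M₀ + S) + (H₀ + H * S'), ⟨fun j x => ?_, fun x => ?_, fun x y => ?_⟩⟩
  · rw [trigPoly_eq_add_sum_blocks]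
    have h1 : ‖∑ i ∈ Finset.range j, trigPoly (dyadicBlock d i) c x‖ ≤ S :=
      (norm_sum_le_of_le _ fun i _ => hbound i x).trans
        (hsum.sum_le_tsum _ fun i _ => by positivity)
    have := norm_add_le (trigPoly (mbox d 1) c x)
      (∑ i ∈ Finset.range j, trigPoly (dyadicBlock d i) c x)
    have := hT0 x
    have : 0 ≤ H * S' := by positivity
    linarith
  · simp only [trigPoly_eq_add_sum_blocks]
    exact tendsto_const_nhds.add (hs x).hasSum.tendsto_sum_nat
  · have h1 : ‖∑' j, trigPoly (dyadicBlock d j) c x - ∑' j, trigPoly (dyadicBlock d j) c y‖ ≤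
        (H * S') * dist x y ^ θ := by
      rw [← (hs x).tsum_sub (hs y)]
      have := tsum_of_norm_bounded ((hsumθ.mul_left (H * dist x y ^ θ)).hasSum)
        (fun j => hblock j x y)
      rw [tsum_mul_left] at this
      refine this.trans (le_of_eq ?_)
      ring
    have h2 := hint (mbox d 1) M₀ M₀ hM₀0 hT0 hT0' x y
    have h3 : 0 ≤ dist x y ^ θ := Real.rpow_nonneg dist_nonneg _
    rw [add_sub_add_comm]
    refine (norm_add_le _ _).trans ?_
    have h4 : 0 ≤ (M₀ + S) * dist x y ^ θ := by positivity
    linarith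

variable {Ω : Type*} [MeasurableSpace Ω] {P : Measure Ω}

/-- A random Fourier series whose dyadic blocks have variance `O(q^(2j))` is almost surely
`θ`-Hölder continuous when `q 2^θ < 1`. -/
theorem ae_exists_isHolderSeries [IsProbabilityMeasure P] {ξ : (d → ℤ) → Ω → ℂ}
    (hξ : HasChaosMoments P ξ) {a : (d → ℤ) → ℂ} {K q θ : ℝ} (hK : 0 ≤ K) (hq : 0 < q)
    (hθ : 0 < θ) (hθ1 : θ ≤ 1) (hqθ : q * 2 ^ θ < 1)
    (ha : ∀ j, ∑ n ∈ dyadicBlock d j, ‖a n‖ ^ 2 ≤ K * q ^ (2 * j)) :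
    ∀ᵐ ω ∂P, ∃ V C, IsHolderSeries (fun n => a n * ξ n ω) θ C V := by
  have h2θ : (0 : ℝ) < 2 ^ θ := by positivity
  obtain ⟨q', hqq, hq'⟩ : ∃ q', q < q' ∧ q' * 2 ^ θ < 1 := by
    obtain ⟨q', h1, h2⟩ := exists_between ((lt_div_iff₀ h2θ).2 hqθ)
    exact ⟨q', h1, (lt_div_iff₀ h2θ).1 h2⟩
  have h1 := ae_block_bound hξ hK hq hqq ha
  -- the derivatives of the blocks are again random series, with `2q` in place of `q`
  have h2 : ∀ᵐ ω ∂P, ∀ i : d, ∃ C : ℝ, 0 ≤ C ∧ ∀ j x,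
      ‖trigPoly (dyadicBlock d j) (fun n => (n i * a n) * ξ n ω) x‖ ≤ C * (2 * q') ^ j := by
    rw [ae_all_iff]
    intro i
    refine ae_block_bound (a := fun n => n i * a n) hξ (K := 4 * K) (by positivity)
      (q := 2 * q) (by positivity) (by linarith) fun j => ?_
    calc ∑ n ∈ dyadicBlock d j, ‖(n i : ℂ) * a n‖ ^ 2
        ≤ ∑ n ∈ dyadicBlock d j, (4 * 2 ^ (2 * j)) * ‖a n‖ ^ 2 := by
          refine Finset.sum_le_sum fun n hn => ?_
          rw [norm_mul, mul_pow, Complex.norm_intCast]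
          gcongr
          have h3 := mem_mbox.1 (dyadicBlock_subset j hn) i
          have h4 : |(n i : ℝ)| ≤ 2 ^ (j + 1) := by exact_mod_cast h3
          calc |(n i : ℝ)| ^ 2 ≤ (2 ^ (j + 1)) ^ 2 := by gcongr
            _ = 4 * 2 ^ (2 * j) := by ring
      _ ≤ 4 * 2 ^ (2 * j) * (K * q ^ (2 * j)) := by
          rw [← Finset.mul_sum]
          gcongr
          exact ha j
      _ = _ := by rw [mul_pow]; ring
  filter_upwards [h1, h2] with ω ⟨C, hC, hb⟩ h
  choose L hL0 hL using h
  refine exists_isHolderSeries hθ hθ1 (hq.trans hqq) hq' hC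
    (L := ∑ i, L i) (Finset.sum_nonneg fun i _ => hL0 i) hb fun i j x => ?_
  have h3 : L i ≤ ∑ i, L i :=
    Finset.single_le_sum (fun i _ => hL0 i) (Finset.mem_univ i)
  have h4 := hL i j x
  simp only [mul_assoc] at h4
  have h5 : 0 < q' := hq.trans hqq
  exact h4.trans (by gcongr)

/-! ### Mollification -/

section Mollify

variable {H : Type*} [MeasurableSpace H] {ν : Measure H}

/-- The average of the translates of `V` by `-τ h` with the signed weight `k`. -/
def mollify (ν : Measure H) (k : H → ℝ) (τ : H → MTorus d) (V : MTorus d → ℂ) (x : MTorus d) : ℂ :=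
  ∫ h, (k h : ℂ) * V (x - τ h) ∂ν

/-- The Fourier multiplier of `mollify`. -/
def mollifySymbol (ν : Measure H) (k : H → ℝ) (τ : H → MTorus d) (n : d → ℤ) : ℂ :=
  ∫ h, (k h : ℂ) * mchar n (-τ h) ∂ν

theorem integrable_mul_of_bounded {k : H → ℝ} (hk : Integrable k ν) {f : H → ℂ} {C : ℝ}
    (hf : AEStronglyMeasurable f ν) (hC : ∀ h, ‖f h‖ ≤ C) :
    Integrable (fun h => (k h : ℂ) * f h) ν :=
  hk.ofReal.mul_bdd hf (ae_of_all _ hC)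

theorem mollify_trigPoly {k : H → ℝ} (hk : Integrable k ν) {τ : H → MTorus d} (hτ : Measurable τ)
    (A : Finset (d → ℤ)) (c : (d → ℤ) → ℂ) (x : MTorus d) :
    mollify ν k τ (trigPoly A c) x = trigPoly A (fun n => mollifySymbol ν k τ n * c n) x := by
  have hi : ∀ n, Integrable (fun h => (k h : ℂ) * mchar n (-τ h)) ν := fun n =>
    integrable_mul_of_bounded hk
      ((continuous_mchar n).measurable.comp hτ.neg).aestronglyMeasurable
      (C := 1) (fun h => by simp)
  simp only [mollify, trigPoly, Finset.mul_sum]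
  rw [integral_finsetSum]
  · refine Finset.sum_congr rfl fun n _ => ?_
    rw [mollifySymbol, mul_assoc, ← integral_mul_const]
    refine integral_congr_ae (ae_of_all _ fun h => ?_)
    simp only [sub_eq_add_neg, mchar_add_right]
    ring
  · intro n _
    have := (hi n).mul_const (c n * mchar n x)
    refine this.congr (ae_of_all _ fun h => ?_)
    simp only [sub_eq_add_neg, mchar_add_right]
    ring

theorem norm_mollify_le {d : Type*} {k : H → ℝ} (hk : Integrable k ν) {τ : H → MTorus d}
    {V : MTorus d → ℂ}
    {C : ℝ} (hV : ∀ x, ‖V x‖ ≤ C) (x : MTorus d) :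
    ‖mollify ν k τ V x‖ ≤ (∫ h, |k h| ∂ν) * C := by
  rw [mollify, ← integral_mul_const]
  refine norm_integral_le_of_norm_le (hk.abs.mul_const C) (ae_of_all _ fun h => ?_)
  rw [norm_mul, Complex.norm_real, Real.norm_eq_abs]
  gcongr
  exact hV _

/-- Mollification acts on Hölder continuous Fourier series as a Fourier multiplier. -/
theorem IsHolderSeries.mollify {k : H → ℝ} (hk : Integrable k ν) {τ : H → MTorus d}
    (hτ : Measurable τ) {c : (d → ℤ) → ℂ} {θ C : ℝ} {V : MTorus d → ℂ} (hθ : 0 < θ)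
    (hV : IsHolderSeries c θ C V) :
    IsHolderSeries (fun n => mollifySymbol ν k τ n * c n) θ ((∫ h, |k h| ∂ν) * C)
      (mollify ν k τ V) := by
  have hVm : ∀ x, AEStronglyMeasurable (fun h => V (x - τ h)) ν := fun x =>
    ((hV.continuous hθ).measurable.comp (measurable_const.sub hτ)).aestronglyMeasurable
  refine ⟨fun j x => ?_, fun x => ?_, fun x y => ?_⟩
  · rw [← mollify_trigPoly hk hτ]
    exact norm_mollify_le hk (hV.bound j) x
  · simp only [← mollify_trigPoly hk hτ]
    refine tendsto_integral_of_dominated_convergence (fun h => |k h| * C) (fun j => ?_)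
      (hk.abs.mul_const C) (fun j => ae_of_all _ fun h => ?_) (ae_of_all _ fun h => ?_)
    · exact hk.ofReal.aestronglyMeasurable.mul
        ((continuous_trigPoly _ _).measurable.comp
          (measurable_const.sub hτ)).aestronglyMeasurable
    · rw [norm_mul, Complex.norm_real, Real.norm_eq_abs]
      gcongr
      exact hV.bound j _
    · exact (hV.tendsto _).const_mul _
  · have hi : ∀ x, Integrable (fun h => (k h : ℂ) * V (x - τ h)) ν := fun x =>
      integrable_mul_of_bounded hk (hVm x) fun h => hV.norm_le _
    rw [WhiteNoiseNLS.mollify, WhiteNoiseNLS.mollify, ← integral_sub (hi x) (hi y), mul_assoc,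
      ← integral_mul_const]
    refine norm_integral_le_of_norm_le (hk.abs.mul_const _) (ae_of_all _ fun h => ?_)
    rw [← mul_sub, norm_mul, Complex.norm_real, Real.norm_eq_abs]
    gcongr
    refine (hV.holder _ _).trans (le_of_eq ?_)
    rw [dist_sub_right]

/-- The rate of convergence of the mollification of a Hölder continuous function. -/
theorem norm_mollify_sub_le {k : H → ℝ} (hk : Integrable k ν) (hk1 : ∫ h, k h ∂ν = 1)
    {τ : H → MTorus d} (hτ : Measurable τ) {θ C r : ℝ} {V : MTorus d → ℂ} (hθ : 0 < θ)
    (hC : 0 ≤ C) (hbd : ∀ x, ‖V x‖ ≤ C) (hV : ∀ x y, ‖V x - V y‖ ≤ C * dist x y ^ θ)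
    (hr : ∀ h, k h ≠ 0 → ‖τ h‖ ≤ r) (x : MTorus d) :
    ‖mollify ν k τ V x - V x‖ ≤ (∫ h, |k h| ∂ν) * (C * r ^ θ) := by
  have hi : Integrable (fun h => (k h : ℂ) * V (x - τ h)) ν :=
    integrable_mul_of_bounded hk (((continuous_of_holder hθ hV).measurable.comp
      (measurable_const.sub hτ)).aestronglyMeasurable) fun h => hbd _
  have h1 : V x = ∫ h, (k h : ℂ) * V x ∂ν := by
    rw [integral_mul_const, integral_complex_ofReal, hk1]
    simp
  conv_lhs => rw [h1]
  have hi2 : Integrable (fun h => (k h : ℂ) * V x) ν := hk.ofReal.mul_const _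
  rw [mollify, ← integral_sub hi hi2, ← integral_mul_const]
  refine norm_integral_le_of_norm_le (hk.abs.mul_const _) (ae_of_all _ fun h => ?_)
  rw [← mul_sub, norm_mul, Complex.norm_real, Real.norm_eq_abs]
  by_cases h0 : k h = 0
  · simp [h0]
  · gcongr
    refine (hV _ _).trans ?_
    have : dist (x - τ h) x ≤ r := by
      rw [dist_eq_norm]
      simpa using hr h h0
    gcongr

end Mollify

end HolderSeries

/-! ### Fourier coefficients and Sobolev norms -/

section Coefficients

theorem character_eq_mchar (n : Freq) (x : Torus) : character n x = mchar n x := rfl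

variable {E : Type*} [NormedAddCommGroup E] [NormedSpace ℂ E]

theorem tendsto_coeff {f : ℕ → Torus → E} {F : Torus → E} {C : ℝ} (hf : ∀ j, Continuous (f j))
    (hC : ∀ j x, ‖f j x‖ ≤ C) (h : ∀ x, Tendsto (fun j => f j x) atTop (𝓝 (F x))) (n : Freq) :
    Tendsto (fun j => coeff (f j) n) atTop (𝓝 (coeff F n)) := by
  refine Tendsto.const_smul ?_ _
  refine tendsto_integral_of_dominated_convergence (fun _ => C) (fun j => ?_)
    (integrable_const _) (fun j => ae_of_all _ fun x => ?_) (ae_of_all _ fun x => ?_)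
  · exact ((continuous_mchar (-n)).smul (hf j)).aestronglyMeasurable
  · rw [norm_smul, character_eq_mchar, norm_mchar, one_mul]
    exact hC j x
  · exact (h x).const_smul _

theorem coeff_mchar_smul (m n : Freq) (v : E) [CompleteSpace E] :
    coeff (fun x => character m x • v) n = if m = n then v else 0 := by
  unfold coeff
  simp only [smul_smul, character_eq_mchar, ← mchar_add]
  rw [integral_smul_const, integral_mchar, smul_smul]
  by_cases h : m = n
  · rw [if_pos (by rw [h]; simp), if_pos h]
    have : (((2 * Real.pi) ^ 2)⁻¹ : ℂ) * (((2 * Real.pi) ^ Fintype.card (Fin 2) : ℝ) : ℂ) = 1 := by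
      have : (Real.pi : ℂ) ≠ 0 := by exact_mod_cast Real.pi_ne_zero
      simp only [Fintype.card_fin]
      push_cast
      field_simp
    rw [this, one_smul]
  · rw [if_neg (by rwa [neg_add_eq_zero, eq_comm]), if_neg h]
    simp

theorem coeff_finset_sum {ι : Type*} (A : Finset ι) (f : ι → Torus → E)
    (hf : ∀ i ∈ A, Continuous (f i)) (n : Freq) :
    coeff (fun x => ∑ i ∈ A, f i x) n = ∑ i ∈ A, coeff (f i) n := by
  unfold coeff
  simp only [Finset.smul_sum]
  rw [integral_finsetSum, Finset.smul_sum]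
  exact fun i hi => integrable_of_continuous ((continuous_mchar (-n)).smul (hf i hi))

theorem coeff_sum_character {ι : Type*} (A : Finset ι) (m : ι → Freq) (v : ι → E)
    [CompleteSpace E] (n : Freq) :
    coeff (fun x => ∑ i ∈ A, character (m i) x • v i) n =
      ∑ i ∈ A, if m i = n then v i else 0 := by
  rw [coeff_finset_sum A (fun i x => character (m i) x • v i)
    fun i _ => (continuous_mchar (m i)).smul continuous_const]
  exact Finset.sum_congr rfl fun i _ => coeff_mchar_smul _ _ _

theorem coeff_trigPoly (A : Finset Freq) (c : Freq → ℂ) (n : Freq) :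
    coeff (trigPoly A c) n = if n ∈ A then c n else 0 := by
  have : trigPoly A c = fun x => ∑ i ∈ A, character i x • c i := by
    funext x
    exact Finset.sum_congr rfl fun i _ => mul_comm _ _
  rw [this, coeff_sum_character A (fun i => i) c n]
  simp

theorem exists_mem_mbox {d : Type*} [Fintype d] (n : d → ℤ) :
    ∀ᶠ j in atTop, n ∈ mbox d (2 ^ j) := by
  filter_upwards [eventually_ge_atTop (∑ i, (n i).natAbs)] with j hj
  rw [mem_mbox]
  intro i
  have h1 : (n i).natAbs ≤ ∑ i, (n i).natAbs :=
    Finset.single_le_sum (f := fun i => (n i).natAbs) (fun _ _ => Nat.zero_le _) (Finset.mem_univ i)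
  have h2 : j ≤ 2 ^ j := Nat.lt_two_pow_self.le
  rw [Int.abs_eq_natAbs]
  exact_mod_cast h1.trans (hj.trans h2)

theorem IsHolderSeries.coeff_eq {c : Freq → ℂ} {θ C : ℝ} {V : Torus → ℂ}
    (h : IsHolderSeries c θ C V) (n : Freq) : coeff V n = c n := by
  have h1 := tendsto_coeff (fun j => continuous_trigPoly (mbox (Fin 2) (2 ^ j)) c) h.bound
    h.tendsto n
  refine tendsto_nhds_unique h1 (tendsto_const_nhds.congr' ?_)
  filter_upwards [exists_mem_mbox n] with j hj
  rw [coeff_trigPoly, if_pos hj]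

theorem volume_Torus : (volume : Measure Torus) Set.univ = ENNReal.ofReal ((2 * Real.pi) ^ 2) := by
  rw [volume_univ_MTorus, ENNReal.ofReal_pow Real.two_pi_pos.le, Fintype.card_fin]

theorem eLpNorm_le_of_bounded {E : Type*} [NormedAddCommGroup E] {F : Torus → E} {M : ℝ}
    {q : ℝ≥0∞} (hq : 1 ≤ q)
    (hM : ∀ x, ‖F x‖ ≤ M) :
    eLpNorm F q volume ≤ ENNReal.ofReal ((2 * Real.pi) ^ 2 * M) := by
  refine (eLpNorm_le_of_ae_bound (ae_of_all _ hM)).trans ?_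
  rw [volume_Torus, ENNReal.ofReal_mul (by positivity)]
  gcongr
  have h1 : (1 : ℝ≥0∞) ≤ ENNReal.ofReal ((2 * Real.pi) ^ 2) := by
    rw [← ENNReal.ofReal_one]
    refine ENNReal.ofReal_le_ofReal ?_
    simpa using one_le_volume_MTorus (d := Fin 2)
  have h2 : q.toReal⁻¹ ≤ 1 := by
    rcases eq_or_ne q ∞ with rfl | hq'
    · simp
    · refine inv_le_one_of_one_le₀ ?_
      rw [← ENNReal.toReal_one]
      exact ENNReal.toReal_mono hq' hq
  calc _ ≤ ENNReal.ofReal ((2 * Real.pi) ^ 2) ^ (1 : ℝ) := ENNReal.rpow_le_rpow_of_exponent_le h1 h2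
    _ = _ := ENNReal.rpow_one _

theorem sobolevNorm_le {s : ℝ} {q : ℝ≥0∞} (hq : 1 ≤ q) {c : Freq → E} {F : Torus → E} {M : ℝ}
    (hF : AEStronglyMeasurable F volume) (hM : ∀ x, ‖F x‖ ≤ M)
    (hc : ∀ n, coeff F n = ((bracket n ^ s : ℝ) : ℂ) • c n) :
    sobolevNorm s q c ≤ ENNReal.ofReal ((2 * Real.pi) ^ 2 * M) := by
  refine le_trans ?_ (eLpNorm_le_of_bounded hq hM)
  exact iInf₂_le F ⟨MemLp.of_bound hF M (ae_of_all _ hM), hc⟩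

end Coefficients

/-! ### Sobolev norms of Hölder continuous functions -/

section Heat

/-- The point `√(2t) z` of the torus, for `z ∈ ℝ²`. -/
def heatShift (t : ℝ) (z : ℝ × ℝ) : Torus :=
  toTorus ![Real.sqrt (2 * t) * z.1, Real.sqrt (2 * t) * z.2]

/-- The standard Gaussian measure of the plane. -/
def planeGaussian : Measure (ℝ × ℝ) := (gaussianReal 0 1).prod (gaussianReal 0 1)

instance : IsProbabilityMeasure planeGaussian := by
  unfold planeGaussian
  infer_instance

/-- The heat semigroup `e^{tΔ} f`, as a Gaussian average of the translates of `f`. -/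
def heatSemigroup (t : ℝ) (f : Torus → ℂ) (x : Torus) : ℂ :=
  ∫ z, f (x + heatShift t z) ∂planeGaussian

theorem continuous_heatShift : Continuous fun p : ℝ × (ℝ × ℝ) => heatShift p.1 p.2 := by
  unfold heatShift toTorus
  refine continuous_pi fun j => ?_
  refine (AddCircle.continuous_mk' (2 * Real.pi)).comp ?_
  fin_cases j <;> simp <;> fun_prop

theorem norm_heatShift_le (t : ℝ) (z : ℝ × ℝ) :
    ‖heatShift t z‖ ≤ Real.sqrt (2 * t) * (|z.1| + |z.2|) := by
  refine norm_toTorus_le (by positivity) fun j => ?_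
  have h := Real.sqrt_nonneg (2 * t)
  fin_cases j
  · simp only [Fin.zero_eta, Matrix.cons_val_zero, abs_mul, abs_of_nonneg h]
    gcongr
    linarith [abs_nonneg z.2]
  · change |Real.sqrt (2 * t) * z.2| ≤ _
    rw [abs_mul, abs_of_nonneg h]
    gcongr
    linarith [abs_nonneg z.1]

theorem integral_mchar_heatShift (n : Freq) {t : ℝ} (ht : 0 ≤ t) :
    ∫ z, character n (heatShift t z) ∂planeGaussian = Real.exp (-t * ‖vec n‖ ^ 2) := by
  have h1 : ∀ z : ℝ × ℝ, character n (heatShift t z) =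
      Complex.exp (((Real.sqrt (2 * t) * n 0 : ℝ) : ℂ) * (z.1 : ℂ) * Complex.I) *
      Complex.exp (((Real.sqrt (2 * t) * n 1 : ℝ) : ℂ) * (z.2 : ℂ) * Complex.I) := by
    intro z
    rw [character_eq_mchar, heatShift, mchar_toTorus, ← Complex.exp_add]
    congr 1
    simp [Fin.sum_univ_two]
    ring
  simp only [h1]
  rw [planeGaussian, integral_prod_mul (fun x : ℝ =>
    Complex.exp (((Real.sqrt (2 * t) * n 0 : ℝ) : ℂ) * (x : ℂ) * Complex.I))
    (fun x : ℝ => Complex.exp (((Real.sqrt (2 * t) * n 1 : ℝ) : ℂ) * (x : ℂ) * Complex.I)),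
    ← charFun_apply_real, ← charFun_apply_real, charFun_gaussianReal, charFun_gaussianReal,
    ← Complex.exp_add, Complex.ofReal_exp]
  congr 1
  have hs : Real.sqrt (2 * t) ^ 2 = 2 * t := Real.sq_sqrt (by positivity)
  have hv : ‖vec n‖ ^ 2 = (n 0 : ℝ) ^ 2 + (n 1 : ℝ) ^ 2 := by
    rw [EuclideanSpace.norm_sq_eq]
    simp [vec, Fin.sum_univ_two]
  rw [hv]
  have hs' : ((Real.sqrt (2 * t) : ℝ) : ℂ) ^ 2 = 2 * t := by
    exact_mod_cast congrArg ((↑) : ℝ → ℂ) hs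
  push_cast
  simp only [mul_pow, hs']
  ring

theorem coeff_translate {f : Torus → ℂ} (a : Torus) (n : Freq) :
    coeff (fun x => f (x + a)) n = character n a * coeff f n := by
  unfold coeff
  have h := integral_add_right_eq_self (μ := (volume : Measure Torus))
    (fun x => character (-n) x • f x) a
  rw [← h]
  simp only [smul_eq_mul]
  rw [mul_left_comm, ← integral_const_mul (character n a)]
  congr 1
  refine integral_congr_ae (ae_of_all _ fun x => ?_)
  simp only [character_eq_mchar, mchar_add_right]
  have : mchar n a * mchar (-n) a = 1 := by
    rw [← mchar_add]
    simp [mchar_zero]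
  linear_combination (-(mchar (-n) x * f (x + a))) * this

theorem continuous_heat_integrand {f : Torus → ℂ} (hf : Continuous f) :
    Continuous fun p : (ℝ × Torus) × (ℝ × ℝ) => f (p.1.2 + heatShift p.1.1 p.2) :=
  hf.comp (continuous_fst.snd.add
    (continuous_heatShift.comp (continuous_fst.fst.prodMk continuous_snd)))

theorem stronglyMeasurable_heatSemigroup {f : Torus → ℂ} (hf : Continuous f) :
    StronglyMeasurable fun p : ℝ × Torus => heatSemigroup p.1 f p.2 :=
  (continuous_heat_integrand hf).stronglyMeasurable.integral_prod_right

theorem coeff_heatSemigroup {f : Torus → ℂ} (hf : Continuous f) {t : ℝ} (ht : 0 ≤ t) (n : Freq) :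
    coeff (heatSemigroup t f) n = Real.exp (-t * ‖vec n‖ ^ 2) * coeff f n := by
  obtain ⟨C, hC⟩ : ∃ C, ∀ x, ‖f x‖ ≤ C := by
    obtain ⟨C, hC⟩ := isCompact_univ.exists_bound_of_continuousOn hf.continuousOn
    exact ⟨C, fun x => hC x (Set.mem_univ x)⟩
  have hcont : Continuous fun p : Torus × (ℝ × ℝ) =>
      character (-n) p.1 * f (p.1 + heatShift t p.2) :=
    ((continuous_mchar (-n)).comp continuous_fst).mul
      ((continuous_heat_integrand hf).comp
        ((continuous_const.prodMk continuous_fst).prodMk continuous_snd))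
  have hint : Integrable (fun p : Torus × (ℝ × ℝ) =>
      character (-n) p.1 * f (p.1 + heatShift t p.2)) (volume.prod planeGaussian) := by
    refine Integrable.of_bound hcont.aestronglyMeasurable C (ae_of_all _ fun p => ?_)
    rw [norm_mul, character_eq_mchar, norm_mchar, one_mul]
    exact hC _
  have h1 : coeff (heatSemigroup t f) n =
      ∫ z, coeff (fun x => f (x + heatShift t z)) n ∂planeGaussian := by
    unfold coeff heatSemigroup
    rw [integral_smul]
    congr 1
    simp only [smul_eq_mul, ← integral_const_mul]
    exact integral_integral_swap hint
  rw [h1]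
  simp only [coeff_translate]
  rw [integral_mul_const, integral_mchar_heatShift n ht]

/-- The integral of `1 + |z₁| + |z₂|` over the planar Gaussian, which bounds the absolute moments of
order at most one. -/
def gaussA : ℝ := ∫ z : ℝ × ℝ, (1 + (|z.1| + |z.2|)) ∂planeGaussian

theorem integrable_gaussA : Integrable (fun z : ℝ × ℝ => 1 + (|z.1| + |z.2|)) planeGaussian :=
  (integrable_const _).add (((integrable_id_gaussianReal 1).abs.comp_fst _).add
    ((integrable_id_gaussianReal 1).abs.comp_snd _))

theorem gaussA_nonneg : 0 ≤ gaussA := integral_nonneg fun z => by positivity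

theorem norm_sub_heatSemigroup_le {f : Torus → ℂ} {α M t : ℝ} (hα : 0 < α) (hα1 : α ≤ 1)
    (hM : 0 ≤ M) (ht : 0 ≤ t)
    (hf : ∀ x y, ‖f x - f y‖ ≤ M * dist x y ^ α) (x : Torus) :
    ‖f x - heatSemigroup t f x‖ ≤ M * (gaussA * (2 * t) ^ (α / 2)) := by
  have hcont : Continuous f := continuous_of_holder hα hf
  obtain ⟨C, hC⟩ := isCompact_univ.exists_bound_of_continuousOn hcont.continuousOn
  have hi : Integrable (fun z => f (x + heatShift t z)) planeGaussian :=
    Integrable.of_bound ((continuous_heat_integrand hcont).comp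
        (continuous_const.prodMk continuous_id : Continuous fun z : ℝ × ℝ => ((t, x), z))
      ).aestronglyMeasurable C (ae_of_all _ fun z => hC _ (Set.mem_univ _))
  have h1 : f x - heatSemigroup t f x = ∫ z, (f x - f (x + heatShift t z)) ∂planeGaussian := by
    rw [integral_sub (integrable_const _) hi]
    simp [heatSemigroup]
  rw [h1, gaussA, ← integral_mul_const, ← integral_const_mul]
  refine norm_integral_le_of_norm_le ((integrable_gaussA.mul_const _).const_mul _)
    (ae_of_all _ fun z => ?_)
  refine (hf _ _).trans ?_
  gcongr
  have h2 : dist x (x + heatShift t z) ≤ Real.sqrt (2 * t) * (|z.1| + |z.2|) := by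
    rw [dist_self_add_right]
    exact norm_heatShift_le t z
  calc dist x (x + heatShift t z) ^ α
      ≤ (Real.sqrt (2 * t) * (|z.1| + |z.2|)) ^ α := by gcongr
    _ = (|z.1| + |z.2|) ^ α * (2 * t) ^ (α / 2) := by
        rw [Real.mul_rpow (Real.sqrt_nonneg _) (by positivity), Real.sqrt_eq_rpow,
          ← Real.rpow_mul (by positivity), mul_comm, one_div, inv_mul_eq_div]
    _ ≤ (1 + (|z.1| + |z.2|)) * (2 * t) ^ (α / 2) := by
        gcongr
        calc (|z.1| + |z.2|) ^ α ≤ (1 + (|z.1| + |z.2|)) ^ α := 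
            Real.rpow_le_rpow (by positivity) (by linarith) hα.le
          _ ≤ (1 + (|z.1| + |z.2|)) ^ (1 : ℝ) :=
            Real.rpow_le_rpow_of_exponent_le (by linarith [abs_nonneg z.1, abs_nonneg z.2]) hα1
          _ = _ := Real.rpow_one _

/-- The integral `∫₀^∞ t^{-1-s/2} (1 - e^{-t}) dt`. -/
def subordConst (s : ℝ) : ℝ := ∫ t in Set.Ioi (0 : ℝ), t ^ (-1 - s / 2) * (1 - Real.exp (-t))

theorem integrableOn_rpow_mul_min {s α : ℝ} (hs : 0 < s) (hsα : s < α) :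
    IntegrableOn (fun t : ℝ => t ^ (-1 - s / 2) * min 1 (t ^ (α / 2))) (Set.Ioi 0) := by
  have hm : Measurable fun t : ℝ => t ^ (-1 - s / 2) * min 1 (t ^ (α / 2)) := by fun_prop
  rw [← Set.Ioc_union_Ioi_eq_Ioi (zero_le_one (α := ℝ))]
  refine IntegrableOn.union ?_ ?_
  · have h1 : IntegrableOn (fun t : ℝ => t ^ (-1 - s / 2 + α / 2)) (Set.Ioc 0 1) :=
      (intervalIntegrable_iff_integrableOn_Ioc_of_le zero_le_one).1
        (intervalIntegral.intervalIntegrable_rpow' (by linarith))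
    refine Integrable.mono' h1 hm.aestronglyMeasurable ?_
    filter_upwards [ae_restrict_mem measurableSet_Ioc] with t ht
    have h0 : 0 ≤ t ^ (-1 - s / 2) := Real.rpow_nonneg ht.1.le _
    have h2 : 0 ≤ t ^ (α / 2) := Real.rpow_nonneg ht.1.le _
    rw [Real.norm_of_nonneg (mul_nonneg h0 (le_min zero_le_one h2)), Real.rpow_add ht.1]
    exact mul_le_mul_of_nonneg_left (min_le_right _ _) h0
  · refine Integrable.mono' (integrableOn_Ioi_rpow_of_lt (a := -1 - s / 2) (by linarith)
      zero_lt_one) hm.aestronglyMeasurable ?_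
    filter_upwards [ae_restrict_mem measurableSet_Ioi] with t ht
    have ht0 : (0 : ℝ) < t := zero_lt_one.trans ht
    have h0 : 0 ≤ t ^ (-1 - s / 2) := Real.rpow_nonneg ht0.le _
    have h2 : 0 ≤ t ^ (α / 2) := Real.rpow_nonneg ht0.le _
    rw [Real.norm_of_nonneg (mul_nonneg h0 (le_min zero_le_one h2))]
    exact mul_le_of_le_one_right h0 (min_le_left _ _)

theorem one_sub_exp_neg_le_min {α t : ℝ} (hα : 0 < α) (hα1 : α ≤ 1) (ht : 0 < t) :
    1 - Real.exp (-t) ≤ min 1 (t ^ (α / 2)) := by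
  have h1 := Real.exp_pos (-t)
  have h2 := Real.add_one_le_exp (-t)
  refine le_min (by linarith) ?_
  rcases le_total t 1 with h | h
  · calc 1 - Real.exp (-t) ≤ t ^ (1 : ℝ) := by rw [Real.rpow_one]; linarith
      _ ≤ t ^ (α / 2) := Real.rpow_le_rpow_of_exponent_ge ht h (by linarith)
  · have : 1 ≤ t ^ (α / 2) := Real.one_le_rpow h (by linarith)
    linarith

theorem integrableOn_subord {s : ℝ} (hs : 0 < s) (hs1 : s < 1) :
    IntegrableOn (fun t : ℝ => t ^ (-1 - s / 2) * (1 - Real.exp (-t))) (Set.Ioi 0) := by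
  refine Integrable.mono' (integrableOn_rpow_mul_min hs hs1)
    (by fun_prop : Measurable _).aestronglyMeasurable ?_
  filter_upwards [ae_restrict_mem measurableSet_Ioi] with t ht
  have ht0 : (0 : ℝ) < t := ht
  have h0 : 0 ≤ t ^ (-1 - s / 2) := Real.rpow_nonneg ht0.le _
  have h2 : 0 ≤ 1 - Real.exp (-t) := by
    have : Real.exp (-t) ≤ 1 := Real.exp_le_one_iff.2 (by linarith)
    linarith
  rw [Real.norm_of_nonneg (mul_nonneg h0 h2)]
  exact mul_le_mul_of_nonneg_left (one_sub_exp_neg_le_min one_pos le_rfl ht0) h0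

theorem subordConst_pos {s : ℝ} (hs : 0 < s) (hs1 : s < 1) : 0 < subordConst s := by
  have hpos : ∀ t ∈ Set.Ioi (0 : ℝ), 0 < t ^ (-1 - s / 2) * (1 - Real.exp (-t)) := by
    intro t ht
    have ht0 : (0 : ℝ) < t := ht
    have : Real.exp (-t) < 1 := by simpa using ht0
    exact mul_pos (Real.rpow_pos_of_pos ht0 _) (by linarith)
  refine (setIntegral_pos_iff_support_of_nonneg_ae ?_ (integrableOn_subord hs hs1)).2 ?_
  · filter_upwards [ae_restrict_mem measurableSet_Ioi] with t ht using (hpos t ht).le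
  · have : Function.support (fun t : ℝ => t ^ (-1 - s / 2) * (1 - Real.exp (-t))) ∩ Set.Ioi 0 =
        Set.Ioi 0 := Set.inter_eq_right.2 fun t ht => (hpos t ht).ne'
    rw [this]
    simp

theorem integral_subord_mul {s l : ℝ} (hl : 0 < l) :
    ∫ t in Set.Ioi (0 : ℝ), t ^ (-1 - s / 2) * (1 - Real.exp (-(l * t))) =
      l ^ (s / 2) * subordConst s := by
  have h := integral_comp_mul_left_Ioi
    (fun t : ℝ => t ^ (-1 - s / 2) * (1 - Real.exp (-t))) 0 hl
  rw [mul_zero] at h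
  have e : ∫ t in Set.Ioi (0 : ℝ), (l * t) ^ (-1 - s / 2) * (1 - Real.exp (-(l * t))) =
      l ^ (-1 - s / 2) *
        ∫ t in Set.Ioi (0 : ℝ), t ^ (-1 - s / 2) * (1 - Real.exp (-(l * t))) := by
    rw [← integral_const_mul]
    refine setIntegral_congr_fun measurableSet_Ioi fun t ht => ?_
    rw [Real.mul_rpow hl.le (le_of_lt ht), mul_assoc]
  rw [e, smul_eq_mul] at h
  have h2 : l ^ (-1 - s / 2) * (l ^ (s / 2) * l) = 1 := by
    nth_rewrite 3 [← Real.rpow_one l]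
    rw [← Real.rpow_add hl, ← Real.rpow_add hl]
    ring_nf
    simp
  have h3 := congrArg (fun y => (l ^ (s / 2) * l) * y) h
  rw [← mul_assoc, mul_comm (l ^ (s / 2) * l) (l ^ (-1 - s / 2)), h2, one_mul] at h3
  rw [h3, subordConst]
  field_simp

theorem norm_sub_exp_heatSemigroup_le {f : Torus → ℂ} {α M t : ℝ} (hα : 0 < α) (hα1 : α ≤ 1)
    (hM : 0 ≤ M) (ht : 0 < t) (hbd : ∀ x, ‖f x‖ ≤ M)
    (hf : ∀ x y, ‖f x - f y‖ ≤ M * dist x y ^ α) (x : Torus) :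
    ‖f x - Real.exp (-t) * heatSemigroup t f x‖ ≤
      (2 + 2 * gaussA) * M * min 1 (t ^ (α / 2)) := by
  have hA := gaussA_nonneg
  have he0 := Real.exp_pos (-t)
  have he1 : Real.exp (-t) ≤ 1 := Real.exp_le_one_iff.2 (by linarith)
  have hP : ‖heatSemigroup t f x‖ ≤ M := by
    refine (norm_integral_le_of_norm_le_const (ae_of_all _ fun z => hbd _)).trans ?_
    simp
  rcases le_total 1 (t ^ (α / 2)) with h | h
  · rw [min_eq_left h, mul_one]
    calc _ ≤ ‖f x‖ + ‖(Real.exp (-t) : ℂ) * heatSemigroup t f x‖ := norm_sub_le _ _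
      _ ≤ M + 1 * M := by
        refine add_le_add (hbd x) ?_
        rw [norm_mul]
        refine mul_le_mul ?_ hP (norm_nonneg _) zero_le_one
        rw [Complex.norm_real, Real.norm_of_nonneg he0.le]
        exact he1
      _ ≤ _ := by nlinarith
  · rw [min_eq_right h]
    have h1 : f x - Real.exp (-t) * heatSemigroup t f x =
        ((1 - Real.exp (-t) : ℝ) : ℂ) * f x +
          ((Real.exp (-t) : ℝ) : ℂ) * (f x - heatSemigroup t f x) := by
      push_cast
      ring
    rw [h1]
    have h2 := norm_sub_heatSemigroup_le hα hα1 hM ht.le hf x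
    have h3 : (2 * t) ^ (α / 2) ≤ 2 * t ^ (α / 2) := by
      rw [Real.mul_rpow (by norm_num) ht.le]
      gcongr
      calc (2 : ℝ) ^ (α / 2) ≤ 2 ^ (1 : ℝ) :=
            Real.rpow_le_rpow_of_exponent_le (by norm_num) (by linarith)
        _ = 2 := Real.rpow_one _
    have h4 := (one_sub_exp_neg_le_min hα hα1 ht).trans (min_le_right _ _)
    have h5 : 0 ≤ t ^ (α / 2) := Real.rpow_nonneg ht.le _
    calc _ ≤ ‖((1 - Real.exp (-t) : ℝ) : ℂ) * f x‖ +
          ‖((Real.exp (-t) : ℝ) : ℂ) * (f x - heatSemigroup t f x)‖ := norm_add_le _ _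
      _ ≤ t ^ (α / 2) * M + 1 * (M * (gaussA * (2 * t ^ (α / 2)))) := by
        rw [norm_mul, norm_mul, Complex.norm_real, Complex.norm_real,
          Real.norm_of_nonneg he0.le, Real.norm_of_nonneg (by linarith)]
        gcongr
        · exact hbd x
        · exact h2.trans (by gcongr)
      _ ≤ _ := by nlinarith [mul_nonneg hM h5]

theorem bracket_sq (n : Freq) : bracket n ^ 2 = 1 + ‖vec n‖ ^ 2 :=
  Real.sq_sqrt (by positivity)

theorem bracket_pos (n : Freq) : 0 < bracket n := Real.sqrt_pos.2 (by positivity)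

/-- Hölder continuous functions of exponent `α > s` belong to every `W^{s,q}`: by subordination
`D^s f = c ∫₀^∞ t^{-1-s/2} (f - e^{-t} e^{tΔ} f) dt`, where the integrand is `O(t^{-1-s/2+α/2})`
near zero. -/
theorem exists_sobolevNorm_le_of_holder {s α : ℝ} (hs : 0 < s) (hsα : s < α) (hα1 : α ≤ 1) :
    ∃ K : ℝ, 0 < K ∧ ∀ (f : Torus → ℂ) (M : ℝ), 0 ≤ M → (∀ x, ‖f x‖ ≤ M) →
      (∀ x y, ‖f x - f y‖ ≤ M * dist x y ^ α) → ∀ q : ℝ≥0∞, 1 ≤ q →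
      sobolevNorm s q (coeff f) ≤ ENNReal.ofReal (K * M) := by
  have hα : 0 < α := hs.trans hsα
  have hs1 : s < 1 := hsα.trans_le hα1
  have hc := subordConst_pos hs hs1
  set w : ℝ → ℝ := fun t => t ^ (-1 - s / 2) * min 1 (t ^ (α / 2)) with hw
  have hwi : IntegrableOn w (Set.Ioi 0) := integrableOn_rpow_mul_min hs hsα
  have hw0 : 0 ≤ ∫ t in Set.Ioi 0, w t := setIntegral_nonneg measurableSet_Ioi fun t ht =>
    mul_nonneg (Real.rpow_nonneg (le_of_lt ht) _)
      (le_min zero_le_one (Real.rpow_nonneg (le_of_lt ht) _))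
  have hA := gaussA_nonneg
  set B := (subordConst s)⁻¹ * ((2 + 2 * gaussA) * ∫ t in Set.Ioi 0, w t) with hB
  have hB0 : 0 ≤ B := by positivity
  refine ⟨(2 * Real.pi) ^ 2 * (B + 1), by positivity, fun f M hM hbd hf q hq => ?_⟩
  have hcont : Continuous f := continuous_of_holder hα hf
  let G : ℝ → Torus → ℂ := fun t x =>
    ((t ^ (-1 - s / 2) : ℝ) : ℂ) * (f x - Real.exp (-t) * heatSemigroup t f x)
  have hGm : StronglyMeasurable (Function.uncurry G) := by
    have h1 := stronglyMeasurable_heatSemigroup hcont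
    have h2 : Measurable fun p : ℝ × Torus => ((p.1 ^ (-1 - s / 2) : ℝ) : ℂ) :=
      Complex.measurable_ofReal.comp (measurable_fst.pow_const _)
    have h3 : Continuous fun p : ℝ × Torus => f p.2 := hcont.comp continuous_snd
    have h4 : Continuous fun p : ℝ × Torus => ((Real.exp (-p.1) : ℝ) : ℂ) := by fun_prop
    exact h2.stronglyMeasurable.mul
      (h3.stronglyMeasurable.sub (h4.stronglyMeasurable.mul h1))
  have hGb : ∀ x, ∀ t ∈ Set.Ioi (0 : ℝ), ‖G t x‖ ≤ ((2 + 2 * gaussA) * M) * w t := by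
    intro x t ht
    have ht0 : (0 : ℝ) < t := ht
    simp only [G, hw]
    rw [norm_mul, Complex.norm_real, Real.norm_of_nonneg (Real.rpow_nonneg ht0.le _),
      mul_left_comm]
    exact mul_le_mul_of_nonneg_left
      (norm_sub_exp_heatSemigroup_le hα hα1 hM ht0 hbd hf x) (Real.rpow_nonneg ht0.le _)
  -- the function representing `D^s f`
  let F : Torus → ℂ := fun x => ((subordConst s)⁻¹ : ℂ) * ∫ t in Set.Ioi 0, G t x
  have hFm : StronglyMeasurable F := by
    have h1 : StronglyMeasurable fun x => ∫ t in Set.Ioi (0 : ℝ), G t x :=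
      (hGm.comp_measurable measurable_swap).integral_prod_right (f := fun x t => G t x)
    exact stronglyMeasurable_const.mul h1
  have hFb : ∀ x, ‖F x‖ ≤ B * M := by
    intro x
    have h1 : ‖∫ t in Set.Ioi 0, G t x‖ ≤ ∫ t in Set.Ioi 0, ((2 + 2 * gaussA) * M) * w t :=
      norm_integral_le_of_norm_le (hwi.const_mul _)
        ((ae_restrict_mem measurableSet_Ioi).mono fun t ht => hGb x t ht)
    rw [integral_const_mul] at h1
    simp only [F]
    rw [norm_mul, norm_inv, Complex.norm_real, Real.norm_of_nonneg hc.le, hB, mul_assoc,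
      mul_assoc]
    gcongr
    refine h1.trans (le_of_eq ?_)
    ring
  refine (sobolevNorm_le hq hFm.aestronglyMeasurable hFb fun n => ?_).trans
    (ENNReal.ofReal_le_ofReal ?_)
  · have hint : Integrable (fun p : Torus × ℝ => character (-n) p.1 * G p.2 p.1)
        (volume.prod (volume.restrict (Set.Ioi 0))) := by
      have hm : StronglyMeasurable fun p : Torus × ℝ => character (-n) p.1 * G p.2 p.1 :=
        ((continuous_mchar (-n)).comp continuous_fst).stronglyMeasurable.mul
          (hGm.comp_measurable measurable_swap)
      have hdom : Integrable (fun p : Torus × ℝ => (1 : ℝ) * (((2 + 2 * gaussA) * M) * w p.2))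
          (volume.prod (volume.restrict (Set.Ioi 0))) :=
        (integrable_const (1 : ℝ)).mul_prod (hwi.const_mul _)
      refine Integrable.mono' hdom hm.aestronglyMeasurable ?_
      have hae : ∀ᵐ p : Torus × ℝ ∂(volume.prod (volume.restrict (Set.Ioi 0))),
          p.2 ∈ Set.Ioi (0 : ℝ) :=
        Measure.quasiMeasurePreserving_snd.ae (ae_restrict_mem measurableSet_Ioi)
      filter_upwards [hae] with p hp
      rw [norm_mul, character_eq_mchar, norm_mchar]
      gcongr
      exact hGb _ _ hp
    have h1 : coeff F n = ((subordConst s)⁻¹ : ℂ) * ∫ t in Set.Ioi 0, coeff (G t) n := by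
      unfold coeff
      rw [integral_smul, smul_eq_mul, smul_eq_mul, mul_left_comm]
      congr 1
      rw [← integral_integral_swap hint, ← integral_const_mul]
      refine integral_congr_ae (ae_of_all _ fun x => ?_)
      simp only [F, smul_eq_mul]
      rw [integral_const_mul]
      ring
    -- `f - e^{-t} e^{tΔ} f` has the Fourier multiplier `1 - e^{-t⟨n⟩²}`
    have h2 : ∀ t ∈ Set.Ioi (0 : ℝ), coeff (G t) n =
        ((t ^ (-1 - s / 2) * (1 - Real.exp (-(bracket n ^ 2 * t))) : ℝ) : ℂ) * coeff f n := by
      intro t ht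
      have ht0 : (0 : ℝ) < t := ht
      have hPc : Integrable (fun x => character (-n) x • heatSemigroup t f x) volume := by
        have hPm : StronglyMeasurable (heatSemigroup t f) :=
          (stronglyMeasurable_heatSemigroup hcont).comp_measurable
            (g := fun x => (t, x)) (by fun_prop)
        refine Integrable.of_bound ((continuous_mchar (-n)).stronglyMeasurable.smul
          hPm).aestronglyMeasurable M (ae_of_all _ fun x => ?_)
        rw [norm_smul, character_eq_mchar, norm_mchar, one_mul]
        refine (norm_integral_le_of_norm_le_const (ae_of_all _ fun z => hbd _)).trans ?_
        simp
      have hfc : Integrable (fun x => character (-n) x • f x) volume :=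
        integrable_of_continuous ((continuous_mchar (-n)).smul hcont)
      have h3 : coeff (G t) n = ((t ^ (-1 - s / 2) : ℝ) : ℂ) *
          (coeff f n - Real.exp (-t) * coeff (heatSemigroup t f) n) := by
        unfold coeff
        simp only [G, smul_eq_mul] at hPc hfc ⊢
        have e : ∀ x, character (-n) x * (((t ^ (-1 - s / 2) : ℝ) : ℂ) *
            (f x - Real.exp (-t) * heatSemigroup t f x)) =
            ((t ^ (-1 - s / 2) : ℝ) : ℂ) * (character (-n) x * f x -
              Real.exp (-t) * (character (-n) x * heatSemigroup t f x)) := by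
          intro x
          ring
        simp only [e]
        rw [integral_const_mul, integral_sub hfc (hPc.const_mul _), integral_const_mul]
        ring
      rw [h3, coeff_heatSemigroup hcont ht0.le, ← mul_assoc, ← Complex.ofReal_mul,
        ← Real.exp_add, bracket_sq]
      have : -t + -t * ‖vec n‖ ^ 2 = -((1 + ‖vec n‖ ^ 2) * t) := by ring
      rw [this]
      push_cast
      ring
    rw [h1, setIntegral_congr_fun measurableSet_Ioi h2, integral_mul_const,
      integral_complex_ofReal, integral_subord_mul (by have := bracket_pos n; positivity),
      smul_eq_mul, ← Real.rpow_natCast, ← Real.rpow_mul (bracket_pos n).le]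
    have : ((2 : ℕ) : ℝ) * (s / 2) = s := by push_cast; ring
    rw [this]
    have hc' : (subordConst s : ℂ) ≠ 0 := by exact_mod_cast hc.ne'
    push_cast
    field_simp
  · rw [← mul_assoc]
    gcongr
    linarith

end Heat

/-! ### The mollifier and its Fourier transform -/

section Mollifier

variable {χ : Plane → ℝ}

theorem IsMollifier.continuous (hχ : IsMollifier χ) : Continuous χ := hχ.smooth.continuous

theorem IsMollifier.hasCompactSupport (hχ : IsMollifier χ) : HasCompactSupport χ :=
  (isCompact_closedBall (0 : Plane) (1 / 2)).of_isClosed_subset (isClosed_tsupport χ)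
    (hχ.support.trans Metric.ball_subset_closedBall)

theorem IsMollifier.integrable (hχ : IsMollifier χ) : Integrable χ :=
  hχ.continuous.integrable_of_hasCompactSupport hχ.hasCompactSupport

theorem IsMollifier.norm_le_of_ne_zero (hχ : IsMollifier χ) {z : Plane} (hz : χ z ≠ 0) :
    ‖z‖ ≤ 1 := by
  have := hχ.support (subset_tsupport χ hz)
  rw [mem_ball_zero_iff] at this
  linarith

theorem norm_rho_le (χ : Plane → ℝ) (ζ : Plane) : ‖rho χ ζ‖ ≤ ∫ x, |χ x| := by
  refine (norm_integral_le_integral_norm _).trans (le_of_eq ?_)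
  refine integral_congr_ae (ae_of_all _ fun x => ?_)
  have : -Complex.I * ((inner ℝ x ζ : ℝ) : ℂ) = ((-(inner ℝ x ζ : ℝ) : ℝ) : ℂ) * Complex.I := by
    push_cast
    ring
  simp only [norm_mul, Complex.norm_real, Real.norm_eq_abs]
  rw [this, Complex.norm_exp_ofReal_mul_I, mul_one]

theorem rho_neg (χ : Plane → ℝ) (ζ : Plane) : rho χ (-ζ) = (starRingEnd ℂ) (rho χ ζ) := by
  rw [rho, rho, ← integral_conj]
  refine integral_congr_ae (ae_of_all _ fun x => ?_)
  simp [← Complex.exp_conj]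

/-- The Fourier transform of a mollifier is rapidly decreasing. -/
theorem IsMollifier.exists_rho_decay (hχ : IsMollifier χ) (k : ℕ) :
    ∃ C, 0 < C ∧ ∀ ζ, (1 + ‖ζ‖) ^ k * ‖rho χ ζ‖ ≤ C := by
  have hc : HasCompactSupport fun x => (χ x : ℂ) :=
    hχ.hasCompactSupport.comp_left (g := fun r : ℝ => (r : ℂ)) (by simp)
  have hs : ContDiff ℝ ((⊤ : ℕ∞) : WithTop ℕ∞) fun x => (χ x : ℂ) :=
    Complex.ofRealCLM.contDiff.comp hχ.smooth
  let f : SchwartzMap Plane ℂ := hc.toSchwartzMap hs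
  have hf : ∀ x, f x = (χ x : ℂ) := fun x => rfl
  let F : SchwartzMap Plane ℂ := FourierTransform.fourier f
  have hF : ∀ ζ, rho χ ζ = F ((2 * Real.pi)⁻¹ • ζ) := by
    intro ζ
    change _ = (FourierTransform.fourier f : SchwartzMap Plane ℂ) _
    rw [SchwartzMap.fourier_coe, Real.fourier_eq', rho]
    refine integral_congr_ae (ae_of_all _ fun x => ?_)
    simp only [hf, smul_eq_mul, inner_smul_right]
    rw [mul_comm]
    congr 2
    have : (Real.pi : ℂ) ≠ 0 := by exact_mod_cast Real.pi_ne_zero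
    push_cast
    field_simp
  obtain ⟨C, hC⟩ : ∃ C, ∀ ζ, (1 + ‖ζ‖) ^ k * ‖F ζ‖ ≤ C := by
    have := SchwartzMap.one_add_le_sup_seminorm_apply (𝕜 := ℝ) (m := (k, 0)) le_rfl le_rfl F
    simp only [norm_iteratedFDeriv_zero] at this
    exact ⟨_, this⟩
  refine ⟨(2 * Real.pi) ^ k * (|C| + 1), by positivity, fun ζ => ?_⟩
  have h1 := hC ((2 * Real.pi)⁻¹ • ζ)
  rw [← hF, norm_smul, Real.norm_of_nonneg (by positivity)] at h1
  have hpi : 1 ≤ 2 * Real.pi := by linarith [Real.pi_gt_three]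
  calc (1 + ‖ζ‖) ^ k * ‖rho χ ζ‖
      ≤ (2 * Real.pi * (1 + (2 * Real.pi)⁻¹ * ‖ζ‖)) ^ k * ‖rho χ ζ‖ := by
        have : 1 + ‖ζ‖ ≤ 2 * Real.pi * (1 + (2 * Real.pi)⁻¹ * ‖ζ‖) := by
          rw [mul_add, mul_inv_cancel_left₀ (by positivity)]
          linarith
        gcongr
    _ = (2 * Real.pi) ^ k * ((1 + (2 * Real.pi)⁻¹ * ‖ζ‖) ^ k * ‖rho χ ζ‖) := by
        rw [mul_pow]
        ring
    _ ≤ _ := by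
        gcongr
        exact h1.trans (by linarith [le_abs_self C])

/-- The translation vectors `εz` of the mollification at scale `ε`. -/
def scaleShift (ε : ℝ) (z : Plane) : Torus := toTorus fun j => ε * z j

/-- The translation vectors of the mollification at scale `ε` of a function of two points. -/
def scaleShift₂ (ε : ℝ) (p : Plane × Plane) : MTorus (Fin 2 ⊕ Fin 2) :=
  toTorus (Sum.elim (fun j => ε * p.1 j) (fun j => ε * p.2 j))

theorem continuous_toTorus {d : Type*} : Continuous (toTorus : (d → ℝ) → MTorus d) :=
  continuous_pi fun j => (AddCircle.continuous_mk' _).comp (continuous_apply j)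

theorem neg_toTorus {d : Type*} (h : d → ℝ) : -toTorus h = toTorus (-h) := by
  ext j
  simp [toTorus]

theorem measurable_scaleShift (ε : ℝ) : Measurable (scaleShift ε) := by
  refine (continuous_toTorus.comp ?_).measurable
  fun_prop

theorem measurable_scaleShift₂ (ε : ℝ) : Measurable (scaleShift₂ ε) := by
  refine (continuous_toTorus.comp (continuous_pi fun j => ?_)).measurable
  rcases j with j | j
  · simp only [Sum.elim_inl]
    fun_prop
  · simp only [Sum.elim_inr]
    fun_prop

theorem abs_apply_le_norm (z : Plane) (j : Fin 2) : |z j| ≤ ‖z‖ := by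
  simpa using PiLp.norm_apply_le z j

theorem IsMollifier.norm_scaleShift_le (hχ : IsMollifier χ) {ε : ℝ} (hε : 0 ≤ ε) {z : Plane}
    (hz : χ z ≠ 0) : ‖scaleShift ε z‖ ≤ ε := by
  refine norm_toTorus_le hε fun j => ?_
  rw [abs_mul, abs_of_nonneg hε]
  exact mul_le_of_le_one_right hε ((abs_apply_le_norm z j).trans (hχ.norm_le_of_ne_zero hz))

theorem IsMollifier.norm_scaleShift₂_le (hχ : IsMollifier χ) {ε : ℝ} (hε : 0 ≤ ε)
    {p : Plane × Plane} (hp : χ p.1 * χ p.2 ≠ 0) : ‖scaleShift₂ ε p‖ ≤ ε := by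
  refine norm_toTorus_le hε fun j => ?_
  rcases j with j | j
  · rw [Sum.elim_inl, abs_mul, abs_of_nonneg hε]
    exact mul_le_of_le_one_right hε
      ((abs_apply_le_norm _ j).trans (hχ.norm_le_of_ne_zero (left_ne_zero_of_mul hp)))
  · rw [Sum.elim_inr, abs_mul, abs_of_nonneg hε]
    exact mul_le_of_le_one_right hε
      ((abs_apply_le_norm _ j).trans (hχ.norm_le_of_ne_zero (right_ne_zero_of_mul hp)))

theorem mchar_neg_scaleShift (n : Freq) (ε : ℝ) (z : Plane) :
    mchar n (-scaleShift ε z) = Complex.exp (-Complex.I * (inner ℝ z (ε • vec n) : ℝ)) := by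
  rw [scaleShift, neg_toTorus, mchar_toTorus, neg_mul, ← mul_neg, ← Complex.ofReal_neg]
  congr 3
  simp only [PiLp.inner_apply, vec, Pi.neg_apply, ← Finset.sum_neg_distrib]
  refine Finset.sum_congr rfl fun j _ => ?_
  simp
  ring

theorem mollifySymbol_scaleShift (χ : Plane → ℝ) (ε : ℝ) (n : Freq) :
    mollifySymbol volume χ (scaleShift ε) n = rho χ (ε • vec n) := by
  simp only [mollifySymbol, rho, mchar_neg_scaleShift]

theorem mchar_sumElim {d d' : Type*} [Fintype d] [Fintype d'] (l : d ⊕ d' → ℤ)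
    (x : MTorus (d ⊕ d')) :
    mchar l x = mchar (l ∘ Sum.inl) (x ∘ Sum.inl) * mchar (l ∘ Sum.inr) (x ∘ Sum.inr) := by
  simp [mchar, Fintype.prod_sum_type]

theorem mollifySymbol_scaleShift₂ (χ : Plane → ℝ) (ε : ℝ) (l : Fin 2 ⊕ Fin 2 → ℤ) :
    mollifySymbol volume (fun p : Plane × Plane => χ p.1 * χ p.2) (scaleShift₂ ε) l =
      rho χ (ε • vec (l ∘ Sum.inl)) * rho χ (ε • vec (l ∘ Sum.inr)) := by
  rw [← mollifySymbol_scaleShift, ← mollifySymbol_scaleShift, mollifySymbol, mollifySymbol,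
    mollifySymbol, ← integral_prod_mul]
  refine integral_congr_ae (ae_of_all _ fun p => ?_)
  simp only [mchar_sumElim]
  have h1 : (-scaleShift₂ ε p) ∘ Sum.inl = -scaleShift ε p.1 := rfl
  have h2 : (-scaleShift₂ ε p) ∘ Sum.inr = -scaleShift ε p.2 := rfl
  rw [h1, h2]
  push_cast
  ring

theorem IsMollifier.integrable₂ (hχ : IsMollifier χ) :
    Integrable (fun p : Plane × Plane => χ p.1 * χ p.2) :=
  hχ.integrable.mul_prod hχ.integrable

theorem IsMollifier.integral₂_eq_one (hχ : IsMollifier χ) :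
    ∫ p : Plane × Plane, χ p.1 * χ p.2 = 1 := by
  rw [Measure.volume_eq_prod, integral_prod_mul, hχ.integral_eq_one, one_mul]

end Mollifier

/-! ### Lattice sums -/

section Lattice

theorem norm_vec_sq (n : Freq) : ‖vec n‖ ^ 2 = (n 0 : ℝ) ^ 2 + (n 1 : ℝ) ^ 2 := by
  simp [vec, EuclideanSpace.norm_sq_eq, Fin.sum_univ_two]

theorem vec_add (n m : Freq) : vec (n + m) = vec n + vec m := by
  ext j
  simp [vec]

theorem vec_neg (n : Freq) : vec (-n) = -vec n := by
  ext j
  simp [vec]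

theorem vec_zero : vec 0 = 0 := by
  ext j
  simp [vec]

theorem bracket_neg (n : Freq) : bracket (-n) = bracket n := by
  rw [bracket, bracket, vec_neg, norm_neg]

theorem one_le_bracket (n : Freq) : 1 ≤ bracket n :=
  Real.one_le_sqrt.2 (by linarith [sq_nonneg ‖vec n‖])

theorem norm_vec_le_bracket (n : Freq) : ‖vec n‖ ≤ bracket n :=
  Real.le_sqrt_of_sq_le (by linarith)

theorem one_le_norm_vec {n : Freq} (hn : n ≠ 0) : 1 ≤ ‖vec n‖ := by
  obtain ⟨j, hj⟩ := Function.ne_iff.1 hn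
  have h1 : (1 : ℝ) ≤ |(n j : ℝ)| := by exact_mod_cast Int.one_le_abs hj
  exact h1.trans (by simpa [vec] using abs_apply_le_norm (vec n) j)

theorem bracket_le_two_mul {n : Freq} (hn : n ≠ 0) : bracket n ≤ 2 * ‖vec n‖ := by
  have := one_le_norm_vec hn
  refine Real.sqrt_le_iff.2 ⟨by positivity, by nlinarith⟩

theorem inv_norm_vec_le {n : Freq} (hn : n ≠ 0) : ‖vec n‖⁻¹ ≤ 2 * (bracket n)⁻¹ := by
  have h1 := one_le_norm_vec hn
  have h2 := bracket_le_two_mul hn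
  have h3 := bracket_pos n
  rw [← div_eq_mul_inv, le_div_iff₀ h3, inv_mul_le_iff₀ (by linarith)]
  linarith

/-- Peetre's inequality. -/
theorem bracket_add_le (n m : Freq) : bracket (n + m) ≤ 2 * bracket n * bracket m := by
  have h1 : ‖vec (n + m)‖ ^ 2 ≤ 2 * ‖vec n‖ ^ 2 + 2 * ‖vec m‖ ^ 2 := by
    rw [vec_add]
    have := norm_add_le (vec n) (vec m)
    nlinarith [sq_nonneg (‖vec n‖ - ‖vec m‖), norm_nonneg (vec n + vec m)]
  have h2 := bracket_pos n
  have h3 := bracket_pos m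
  refine Real.sqrt_le_iff.2 ⟨by positivity, ?_⟩
  rw [mul_pow, mul_pow, bracket_sq, bracket_sq]
  nlinarith [mul_nonneg (sq_nonneg ‖vec n‖) (sq_nonneg ‖vec m‖), sq_nonneg ‖vec n‖,
    sq_nonneg ‖vec m‖]

theorem norm_freq_le_bracket (n : Freq) : ‖n‖ ≤ bracket n := by
  refine le_trans ?_ (norm_vec_le_bracket n)
  refine (pi_norm_le_iff_of_nonneg (norm_nonneg _)).2 fun j => ?_
  simpa [vec, Int.norm_eq_abs] using abs_apply_le_norm (vec n) j

theorem summable_bracket_rpow {r : ℝ} (hr : 2 < r) : Summable fun n : Freq => bracket n ^ (-r) := by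
  have h1 := EisensteinSeries.summable_one_div_norm_rpow hr
  have h2 : Summable fun n : Freq => if n = 0 then (1 : ℝ) else 0 :=
    summable_of_ne_finset_zero (s := {0}) fun n hn => if_neg (by simpa using hn)
  refine Summable.of_nonneg_of_le (fun n => (Real.rpow_pos_of_pos (bracket_pos n) _).le)
    (fun n => ?_) (h1.add h2)
  by_cases hn : n = 0
  · rw [if_pos hn]
    have h3 : bracket n ^ (-r) ≤ 1 :=
      Real.rpow_le_one_of_one_le_of_nonpos (one_le_bracket n) (by linarith)
    have h4 : 0 ≤ ‖n‖ ^ (-r) := Real.rpow_nonneg (norm_nonneg _) _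
    linarith
  · rw [if_neg hn, add_zero]
    exact Real.rpow_le_rpow_of_nonpos (norm_pos_iff.2 hn) (norm_freq_le_bracket n) (by linarith)

/-- The weighted arithmetic-geometric mean inequality with three factors. -/
theorem rpow_triple_le {x y z α β γ : ℝ} (hx : 0 < x) (hy : 0 < y) (hz : 0 < z) (hα : α ≤ β + γ)
    (hβ : β ≤ α + γ) (hγ : γ ≤ α + β) (h : 0 < α + β + γ) :
    x ^ (-α) * y ^ (-β) * z ^ (-γ) ≤
      (1 - α / ((α + β + γ) / 2)) *
          (y ^ (-((α + β + γ) / 2)) * z ^ (-((α + β + γ) / 2))) +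
        (1 - β / ((α + β + γ) / 2)) *
          (x ^ (-((α + β + γ) / 2)) * z ^ (-((α + β + γ) / 2))) +
        (1 - γ / ((α + β + γ) / 2)) *
          (x ^ (-((α + β + γ) / 2)) * y ^ (-((α + β + γ) / 2))) := by
  obtain ⟨r, hr⟩ : ∃ r, r = (α + β + γ) / 2 := ⟨_, rfl⟩
  rw [← hr]
  have hr0 : 0 < r := by linarith
  have key := Real.geom_mean_le_arith_mean3_weighted (w₁ := 1 - α / r) (w₂ := 1 - β / r)
    (w₃ := 1 - γ / r) (p₁ := y ^ (-r) * z ^ (-r)) (p₂ := x ^ (-r) * z ^ (-r))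
    (p₃ := x ^ (-r) * y ^ (-r))
    (sub_nonneg.2 ((div_le_one hr0).2 (by linarith)))
    (sub_nonneg.2 ((div_le_one hr0).2 (by linarith)))
    (sub_nonneg.2 ((div_le_one hr0).2 (by linarith)))
    (by positivity) (by positivity) (by positivity) (by field_simp; linarith)
  refine le_trans (le_of_eq ?_) key
  rw [Real.mul_rpow (Real.rpow_nonneg hx.le _) (Real.rpow_nonneg hy.le _),
    Real.mul_rpow (Real.rpow_nonneg hx.le _) (Real.rpow_nonneg hz.le _),
    Real.mul_rpow (Real.rpow_nonneg hy.le _) (Real.rpow_nonneg hz.le _)]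
  simp only [← Real.rpow_mul hx.le, ← Real.rpow_mul hy.le, ← Real.rpow_mul hz.le]
  have ea : -α = -r * (1 - β / r) + -r * (1 - γ / r) := by field_simp; linarith
  have eb : -β = -r * (1 - α / r) + -r * (1 - γ / r) := by field_simp; linarith
  have ec : -γ = -r * (1 - α / r) + -r * (1 - β / r) := by field_simp; linarith
  rw [ea, eb, ec, Real.rpow_add hx, Real.rpow_add hy, Real.rpow_add hz]
  ring

/-- The sum over the triples `(l, r, l + r)` of frequencies; the exponents are a convex combination
of those of three products of two convergent series. -/
theorem summable_bracket_triple {α β γ : ℝ} (hα : α ≤ β + γ) (hβ : β ≤ α + γ) (hγ : γ ≤ α + β)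
    (h : 4 < α + β + γ) : Summable fun p : Freq × Freq =>
      bracket (p.1 + p.2) ^ (-α) * bracket p.1 ^ (-β) * bracket p.2 ^ (-γ) := by
  set r := (α + β + γ) / 2 with hr
  have hr2 : 2 < r := by rw [hr]; linarith
  have hr0 : 0 < r := by linarith
  have hs := summable_bracket_rpow hr2
  have hpos : ∀ n : Freq, 0 ≤ bracket n ^ (-r) := fun n =>
    (Real.rpow_pos_of_pos (bracket_pos n) _).le
  have h1 : Summable fun p : Freq × Freq => bracket p.1 ^ (-r) * bracket p.2 ^ (-r) :=
    hs.mul_of_nonneg hs hpos hpos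
  let e2 : Freq × Freq ≃ Freq × Freq :=
    ⟨fun p => (p.1 + p.2, p.2), fun p => (p.1 - p.2, p.2), fun p => by simp, fun p => by simp⟩
  let e3 : Freq × Freq ≃ Freq × Freq :=
    ⟨fun p => (p.1 + p.2, p.1), fun p => (p.2, p.1 - p.2), fun p => by simp, fun p => by simp⟩
  have h2 : Summable fun p : Freq × Freq => bracket (p.1 + p.2) ^ (-r) * bracket p.2 ^ (-r) :=
    by
    have := (e2.summable_iff
      (f := fun p : Freq × Freq => bracket p.1 ^ (-r) * bracket p.2 ^ (-r))).2 h1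
    exact this
  have h3 : Summable fun p : Freq × Freq => bracket (p.1 + p.2) ^ (-r) * bracket p.1 ^ (-r) :=
    by
    have := (e3.summable_iff
      (f := fun p : Freq × Freq => bracket p.1 ^ (-r) * bracket p.2 ^ (-r))).2 h1
    exact this
  refine Summable.of_nonneg_of_le (fun p => ?_) (fun p => ?_)
    (((h1.mul_left (1 - α / r)).add (h2.mul_left (1 - β / r))).add (h3.mul_left (1 - γ / r)))
  · have := bracket_pos (p.1 + p.2)
    have := bracket_pos p.1
    have := bracket_pos p.2
    positivity
  · exact rpow_triple_le (bracket_pos _) (bracket_pos _) (bracket_pos _) hα hβ hγ (by linarith)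

theorem two_pow_le_norm_of_mem_dyadicBlock {d : Type*} [Fintype d] {j : ℕ} {n : d → ℤ}
    (hn : n ∈ dyadicBlock d j) : (2 : ℝ) ^ j ≤ ‖n‖ := by
  classical
  have h : n ∉ mbox d (2 ^ j) := (Finset.mem_sdiff.1 hn).2
  rw [mem_mbox] at h
  push Not at h
  obtain ⟨i, hi⟩ := h
  have h1 : ((2 ^ j : ℕ) : ℝ) ≤ |(n i : ℝ)| := by exact_mod_cast hi.le
  have h2 := norm_le_pi_norm n i
  rw [Int.norm_eq_abs] at h2
  push_cast at h1
  exact h1.trans h2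

/-- Weighted square summability gives the decay of dyadic blocks. -/
theorem sum_dyadicBlock_le {d : Type*} [Fintype d] {a : (d → ℤ) → ℂ} {b : ℝ} (hb : 0 ≤ b)
    (h : Summable fun n => ‖a n‖ ^ 2 * ‖n‖ ^ (2 * b)) (j : ℕ) :
    ∑ n ∈ dyadicBlock d j, ‖a n‖ ^ 2 ≤
      (∑' n, ‖a n‖ ^ 2 * ‖n‖ ^ (2 * b)) * ((2 : ℝ) ^ (-b)) ^ (2 * j) := by
  have h0 : ∀ n : d → ℤ, 0 ≤ ‖a n‖ ^ 2 * ‖n‖ ^ (2 * b) := fun n => by positivity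
  have h1 : ∑ n ∈ dyadicBlock d j, ‖a n‖ ^ 2 * ((2 : ℝ) ^ j) ^ (2 * b) ≤
      ∑' n, ‖a n‖ ^ 2 * ‖n‖ ^ (2 * b) := by
    refine le_trans (Finset.sum_le_sum fun n hn => ?_) (h.sum_le_tsum _ fun n _ => h0 n)
    gcongr
    exact two_pow_le_norm_of_mem_dyadicBlock hn
  rw [← Finset.sum_mul] at h1
  have h2 : ((2 : ℝ) ^ (-b)) ^ (2 * j) = (((2 : ℝ) ^ j) ^ (2 * b))⁻¹ := by
    rw [← Real.rpow_natCast, ← Real.rpow_natCast, ← Real.rpow_mul (by norm_num),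
      ← Real.rpow_mul (by norm_num), ← Real.rpow_neg (by norm_num)]
    congr 1
    push_cast
    ring
  rw [h2, ← div_eq_mul_inv, le_div_iff₀ (by positivity)]
  exact h1

/-- The sum of `|n|⁻²` diverges logarithmically. -/
theorem sum_inv_norm_sq_le (J : ℕ) :
    ∑ n ∈ mbox (Fin 2) (2 ^ J), (‖vec n‖ ^ 2)⁻¹ ≤ 25 * (J + 1) := by
  classical
  induction J with
  | zero =>
    have : ∀ n ∈ mbox (Fin 2) (2 ^ 0), (‖vec n‖ ^ 2)⁻¹ ≤ 1 := by
      intro n _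
      by_cases hn : n = 0
      · simp [hn, vec_zero]
      · exact inv_le_one_of_one_le₀ (one_le_pow₀ (one_le_norm_vec hn))
    refine (Finset.sum_le_card_nsmul _ _ _ this).trans ?_
    rw [card_mbox]
    norm_num
  | succ J ih =>
    have hsub : mbox (Fin 2) (2 ^ J) ⊆ mbox (Fin 2) (2 ^ (J + 1)) :=
      mbox_mono (Nat.pow_le_pow_right two_pos (Nat.le_succ J))
    rw [← Finset.sum_sdiff hsub]
    have h1 : ∀ n ∈ dyadicBlock (Fin 2) J, (‖vec n‖ ^ 2)⁻¹ ≤ (((2 : ℝ) ^ J) ^ 2)⁻¹ := by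
      intro n hn
      have h2 := two_pow_le_norm_of_mem_dyadicBlock hn
      have h3 : ‖n‖ ≤ ‖vec n‖ := by
        refine (pi_norm_le_iff_of_nonneg (norm_nonneg _)).2 fun j => ?_
        simpa [vec, Int.norm_eq_abs] using abs_apply_le_norm (vec n) j
      have h4 := h2.trans h3
      gcongr
    have h2 := Finset.sum_le_card_nsmul _ _ _ h1
    have h3 : ((dyadicBlock (Fin 2) J).card : ℝ) ≤ 25 * ((2 : ℝ) ^ J) ^ 2 := by
      have h4 : (dyadicBlock (Fin 2) J).card ≤ (2 * 2 ^ (J + 1) + 1) ^ 2 := by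
        refine (Finset.card_le_card (dyadicBlock_subset J)).trans (le_of_eq ?_)
        rw [card_mbox, Fintype.card_fin]
      have h5 : ((dyadicBlock (Fin 2) J).card : ℝ) ≤ (2 * 2 ^ (J + 1) + 1) ^ 2 := by
        exact_mod_cast h4
      have h6 : (1 : ℝ) ≤ 2 ^ J := one_le_pow₀ (by norm_num)
      refine h5.trans ?_
      have h7 : (2 : ℝ) ^ (J + 1) = 2 * 2 ^ J := by ring
      rw [h7]
      nlinarith
    have h5 : ∑ n ∈ dyadicBlock (Fin 2) J, (‖vec n‖ ^ 2)⁻¹ ≤ 25 := by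
      refine h2.trans ?_
      rw [nsmul_eq_mul, ← div_eq_mul_inv, div_le_iff₀ (by positivity)]
      exact h3
    have h6 : ∑ n ∈ mbox (Fin 2) (2 ^ (J + 1)) \ mbox (Fin 2) (2 ^ J), (‖vec n‖ ^ 2)⁻¹ ≤ 25 := h5
    push_cast
    linarith

end Lattice

/-! ### The chaoses of the white noise -/

section Chaos

variable {Ω : Type*} [MeasurableSpace Ω] {P : Measure Ω} {g : Freq → Ω → ℂ}

/-- The white noise with the zero mode removed. -/
def linNoise (g : Freq → Ω → ℂ) (n : Freq) (ω : Ω) : ℂ := if n = 0 then 0 else g n ω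

/-- The second chaos, with frequencies in `ℤ² × ℤ²`: the variable at `(n, -m)` is the Wick product of
`g n` and `conj (g m)`, so that the restriction of the Fourier series to the diagonal of
`𝕋² × 𝕋²` has frequencies `n - m`. -/
def quadNoise (g : Freq → Ω → ℂ) (l : Fin 2 ⊕ Fin 2 → ℤ) (ω : Ω) : ℂ :=
  if l ∘ Sum.inl = 0 ∨ l ∘ Sum.inr = 0 then 0 else wickProd g (l ∘ Sum.inl) (-(l ∘ Sum.inr)) ω

theorem IsWhiteNoise.aemeasurable_wickProd (hg : IsWhiteNoise P g) {n m : Freq} (hn : n ≠ 0)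
    (hm : m ≠ 0) : AEMeasurable (wickProd g n m) P := by
  unfold wickProd
  exact ((hg.aemeasurable hn).mul
    (Complex.continuous_conj.measurable.comp_aemeasurable (hg.aemeasurable hm))).sub_const _

theorem IsWhiteNoise.hasChaosMoments_linNoise [IsProbabilityMeasure P] (hg : IsWhiteNoise P g) :
    HasChaosMoments P (linNoise g) := by
  classical
  refine ⟨fun n => ?_, fun k _ => ⟨linConst k, linConst_ne_top k, fun A c => ?_⟩⟩
  · unfold linNoise
    by_cases hn : n = 0
    · simp [hn]
    · simpa [hn] using hg.aemeasurable hn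
  · have e : ∀ ω, ∑ n ∈ A, c n * linNoise g n ω = ∑ n ∈ A with n ≠ 0, c n * g n ω := by
      intro ω
      rw [Finset.sum_filter]
      refine Finset.sum_congr rfl fun n _ => ?_
      by_cases hn : n = 0 <;> simp [linNoise, hn]
    simp only [e]
    refine (hg.lintegral_linear k (fun n hn => (Finset.mem_filter.1 hn).2) c).trans ?_
    gcongr
    exact Finset.filter_subset _ _

/-- The frequencies of the second chaos as pairs of frequencies of the white noise. -/
def pairEquiv : (Fin 2 ⊕ Fin 2 → ℤ) ≃ Freq × Freq where
  toFun l := (l ∘ Sum.inl, -(l ∘ Sum.inr))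
  invFun p := Sum.elim p.1 (-p.2)
  left_inv l := by
    funext i
    rcases i with i | i <;> simp
  right_inv p := by
    ext i <;> simp

theorem IsWhiteNoise.hasChaosMoments_quadNoise [IsProbabilityMeasure P] (hg : IsWhiteNoise P g) :
    HasChaosMoments P (quadNoise g) := by
  classical
  refine ⟨fun l => ?_, fun k hk => ⟨quadConst k, quadConst_ne_top k, fun A c => ?_⟩⟩
  · unfold quadNoise
    by_cases hl : l ∘ Sum.inl = 0 ∨ l ∘ Sum.inr = 0
    · simp [hl]
    · simp only [if_neg hl]
      push Not at hl
      exact hg.aemeasurable_wickProd hl.1 (neg_ne_zero.2 hl.2)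
  · set B := (A.filter fun l => ¬(l ∘ Sum.inl = 0 ∨ l ∘ Sum.inr = 0)).map pairEquiv.toEmbedding
    have hB : ∀ p ∈ B, p.1 ≠ 0 ∧ p.2 ≠ 0 := by
      intro p hp
      obtain ⟨l, hl, rfl⟩ := Finset.mem_map.1 hp
      have := (Finset.mem_filter.1 hl).2
      push Not at this
      exact ⟨this.1, neg_ne_zero.2 this.2⟩
    have e : ∀ ω, ∑ l ∈ A, c l * quadNoise g l ω =
        ∑ p ∈ B, c (pairEquiv.symm p) * wickProd g p.1 p.2 ω := by
      intro ω
      rw [Finset.sum_map, Finset.sum_filter]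
      refine Finset.sum_congr rfl fun l _ => ?_
      simp only [Equiv.coe_toEmbedding, Equiv.symm_apply_apply]
      by_cases hl : l ∘ Sum.inl = 0 ∨ l ∘ Sum.inr = 0
      · simp [quadNoise, hl]
      · simp only [quadNoise, if_neg hl, if_pos hl]
        rfl
    simp only [e]
    refine (hg.lintegral_quadratic hk hB _).trans ?_
    gcongr
    rw [Finset.sum_map]
    simp only [Equiv.coe_toEmbedding, Equiv.symm_apply_apply]
    exact Finset.sum_le_sum_of_subset (Finset.filter_subset _ _)

/-- The white noise grows at most polynomially. -/
theorem IsWhiteNoise.ae_growth [IsProbabilityMeasure P] (hg : IsWhiteNoise P g) :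
    ∀ᵐ ω ∂P, ∃ M : ℝ, 1 ≤ M ∧ ∀ n, n ≠ 0 → ‖g n ω‖ ≤ M * bracket n ^ 2 := by
  obtain ⟨C, hC, h⟩ := hg.hasChaosMoments_linNoise.moment 1 le_rfl
  have hmeas := hg.hasChaosMoments_linNoise.aemeasurable
  have hb := ae_exists_bound (P := P)
    (F := fun n ω => ‖linNoise g n ω‖ₑ ^ 2 * ENNReal.ofReal (bracket n ^ (-3 : ℝ)))
    (w := fun n => bracket n ^ (-3 : ℝ))
    (fun n => ((hmeas n).enorm.pow_const 2).mul_const _)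
    (fun n => Real.rpow_nonneg (bracket_pos n).le _)
    (summable_bracket_rpow (by norm_num)) hC (fun n => by
      rw [lintegral_mul_const'' _ ((hmeas n).enorm.pow_const 2)]
      gcongr
      simpa using h {n} fun _ => 1)
  filter_upwards [hb] with ω ⟨M, hM1, hM⟩
  refine ⟨M, hM1, fun n hn => ?_⟩
  have h1 := hM n
  have hbp := bracket_pos n
  rw [linNoise, if_neg hn, ← ofReal_norm, ← ENNReal.ofReal_pow (norm_nonneg _),
    ← ENNReal.ofReal_mul (by positivity), ENNReal.ofReal_le_ofReal_iff (by linarith),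
    Real.rpow_neg hbp.le, ← div_eq_mul_inv, div_le_iff₀ (by positivity)] at h1
  have h2 : bracket n ^ (3 : ℝ) = bracket n ^ 3 := by exact_mod_cast Real.rpow_natCast _ 3
  rw [h2] at h1
  refine abs_le_of_sq_le_sq' ?_ (by positivity) |>.2
  refine h1.trans ?_
  rw [mul_pow, ← pow_mul]
  have h3 : M ≤ M ^ 2 := by nlinarith
  have h4 : bracket n ^ 3 ≤ bracket n ^ (2 * 2) :=
    pow_le_pow_right₀ (one_le_bracket n) (by norm_num)
  gcongr

end Chaos

/-! ### Absolutely convergent Fourier series and rapidly decreasing coefficients -/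

section FourierSum

theorem tendsto_mbox_atTop (d : Type*) [Fintype d] :
    Tendsto (fun j : ℕ => mbox d (2 ^ j)) atTop atTop :=
  tendsto_atTop_finset_of_monotone
    (fun _ _ h => mbox_mono (Nat.pow_le_pow_right two_pos h))
    fun n => (exists_mem_mbox n).exists

variable {E : Type*} [NormedAddCommGroup E] [NormedSpace ℂ E] [CompleteSpace E]

theorem summable_character_smul {c : Freq → E} (hc : Summable fun n => ‖c n‖) (x : Torus) :
    Summable fun n => character n x • c n := by
  refine Summable.of_norm ?_
  simpa [norm_smul, character_eq_mchar] using hc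

theorem tendsto_fourierSum {c : Freq → E} (hc : Summable fun n => ‖c n‖) (x : Torus) :
    Tendsto (fun j : ℕ => ∑ n ∈ mbox (Fin 2) (2 ^ j), character n x • c n) atTop
      (𝓝 (fourierSum c x)) :=
  (summable_character_smul hc x).hasSum.comp (tendsto_mbox_atTop _)

theorem norm_sum_character_smul_le {E : Type*} [NormedAddCommGroup E] [NormedSpace ℂ E]
    (A : Finset Freq) (c : Freq → E) (x : Torus) :
    ‖∑ n ∈ A, character n x • c n‖ ≤ ∑ n ∈ A, ‖c n‖ := by
  refine (norm_sum_le _ _).trans (le_of_eq ?_)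
  simp [norm_smul, character_eq_mchar]

theorem continuous_fourierSum {c : Freq → E} (hc : Summable fun n => ‖c n‖) :
    Continuous (fourierSum c) := by
  refine continuous_tsum (fun n => (continuous_mchar n).smul continuous_const) hc fun n x => ?_
  simp [norm_smul, character_eq_mchar]

theorem coeff_fourierSum {c : Freq → E} (hc : Summable fun n => ‖c n‖) (n : Freq) :
    coeff (fourierSum c) n = c n := by
  have h1 := tendsto_coeff (f := fun j x => ∑ n ∈ mbox (Fin 2) (2 ^ j), character n x • c n)
    (C := ∑' n, ‖c n‖)
    (fun j => continuous_finsetSum _ fun n _ => (continuous_mchar n).smul continuous_const)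
    (fun j x => (norm_sum_character_smul_le _ c x).trans
      (hc.sum_le_tsum _ fun _ _ => norm_nonneg _)) (tendsto_fourierSum hc) n
  refine tendsto_nhds_unique h1 (tendsto_const_nhds.congr' ?_)
  filter_upwards [exists_mem_mbox n] with j hj
  rw [coeff_sum_character _ (fun i => i) c n, Finset.sum_ite_eq', if_pos hj]

theorem trigPoly_eq_sum_character (A : Finset Freq) (c : Freq → ℂ) (x : Torus) :
    trigPoly A c x = ∑ n ∈ A, character n x • c n :=
  Finset.sum_congr rfl fun _ _ => mul_comm _ _

theorem IsHolderSeries.fourierSum_eq {c : Freq → ℂ} {θ C : ℝ} {V : Torus → ℂ}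
    (h : IsHolderSeries c θ C V) (hc : Summable fun n => ‖c n‖) (x : Torus) :
    fourierSum c x = V x := by
  have h1 := h.tendsto x
  simp only [trigPoly_eq_sum_character] at h1
  exact tendsto_nhds_unique (tendsto_fourierSum hc x) h1

end FourierSum

section RapidDecay

variable {Ω : Type*} {χ : Plane → ℝ} {g : Freq → Ω → ℂ}

theorem bracket_le_one_add_norm (n : Freq) : bracket n ≤ 1 + ‖vec n‖ :=
  Real.sqrt_le_iff.2 ⟨by positivity, by nlinarith [norm_nonneg (vec n)]⟩

theorem IsMollifier.exists_rho_smul_le (hχ : IsMollifier χ) (k : ℕ) :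
    ∃ C, 0 < C ∧ ∀ ε ∈ Set.Ioo (0 : ℝ) 1, ∀ n,
      ‖rho χ (ε • vec n)‖ * (ε * bracket n) ^ k ≤ C := by
  obtain ⟨C, hC0, hC⟩ := hχ.exists_rho_decay k
  refine ⟨C, hC0, fun ε hε n => ?_⟩
  have h1 := hC (ε • vec n)
  rw [norm_smul, Real.norm_of_nonneg hε.1.le] at h1
  rw [mul_comm]
  refine le_trans ?_ h1
  have hb := bracket_pos n
  have h0 := hε.1
  have h2 : ε * bracket n ≤ 1 + ε * ‖vec n‖ := by
    have := bracket_le_one_add_norm n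
    nlinarith [hε.2, hε.1]
  gcongr

theorem norm_YCoeff_le {M : ℝ} (hM : 0 ≤ M) {ω : Ω} (hg : ∀ n, n ≠ 0 → ‖g n ω‖ ≤ M * bracket n ^ 2)
    (n : Freq) : ‖YCoeff g ω n‖ ≤ M * bracket n ^ 2 := by
  have hb := bracket_pos n
  rw [YCoeff]
  split_ifs with hn
  · simp
    positivity
  · rw [norm_neg, norm_div, norm_pow, Complex.norm_real, norm_norm]
    exact (div_le_self (norm_nonneg _) (one_le_pow₀ (one_le_norm_vec hn))).trans (hg n hn)

theorem IsMollifier.summable_YepsCoeff (hχ : IsMollifier χ) {M : ℝ} (hM : 0 ≤ M) {ω : Ω}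
    (hg : ∀ n, n ≠ 0 → ‖g n ω‖ ≤ M * bracket n ^ 2) {ε : ℝ} (hε : ε ∈ Set.Ioo (0 : ℝ) 1) (k : ℕ) :
    Summable fun n : Freq => bracket n ^ k * ‖YepsCoeff χ g ε ω n‖ := by
  -- two powers for the growth of the noise and three for the convergence of the sum
  obtain ⟨C, hC0, hC⟩ := hχ.exists_rho_smul_le (k + 5)
  have h0 := hε.1
  have hs := (summable_bracket_rpow (r := 3) (by norm_num)).mul_left (C * (ε ^ (k + 5))⁻¹ * M)
  refine Summable.of_nonneg_of_le (fun n => ?_) (fun n => ?_) hs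
  · have := bracket_pos n
    positivity
  · have hb := bracket_pos n
    have h1 := hC ε hε n
    rw [mul_pow, ← mul_assoc, ← le_div_iff₀ (by positivity), ← le_div_iff₀ (by positivity)] at h1
    have h2 := norm_YCoeff_le hM hg n
    rw [YepsCoeff, norm_mul]
    calc bracket n ^ k * (‖rho χ (ε • vec n)‖ * ‖YCoeff g ω n‖)
        ≤ bracket n ^ k * (C / bracket n ^ (k + 5) / ε ^ (k + 5) * (M * bracket n ^ 2)) := by gcongr
      _ = C * (ε ^ (k + 5))⁻¹ * M * bracket n ^ (-3 : ℝ) := by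
        have h3 : bracket n ^ (-3 : ℝ) = (bracket n ^ 3)⁻¹ := by
          rw [Real.rpow_neg hb.le]
          congr 1
          exact_mod_cast Real.rpow_natCast _ 3
        rw [h3]
        field_simp
        ring

theorem IsMollifier.summable_norm_YepsCoeff (hχ : IsMollifier χ) {M : ℝ} (hM : 0 ≤ M) {ω : Ω}
    (hg : ∀ n, n ≠ 0 → ‖g n ω‖ ≤ M * bracket n ^ 2) {ε : ℝ} (hε : ε ∈ Set.Ioo (0 : ℝ) 1) :
    Summable fun n : Freq => ‖YepsCoeff χ g ε ω n‖ := by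
  simpa using hχ.summable_YepsCoeff hM hg hε 0

theorem norm_gradCoeff (c : Freq → ℂ) (n : Freq) : ‖gradCoeff c n‖ = ‖vec n‖ * ‖c n‖ := by
  have h : ‖gradCoeff c n‖ ^ 2 = (‖vec n‖ * ‖c n‖) ^ 2 := by
    rw [mul_pow, norm_vec_sq, EuclideanSpace.norm_sq_eq, Fin.sum_univ_two]
    simp [gradCoeff, mul_pow]
    ring
  exact (pow_left_inj₀ (norm_nonneg _) (by positivity) two_ne_zero).1 h

theorem IsMollifier.summable_norm_gradCoeff (hχ : IsMollifier χ) {M : ℝ} (hM : 0 ≤ M) {ω : Ω}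
    (hg : ∀ n, n ≠ 0 → ‖g n ω‖ ≤ M * bracket n ^ 2) {ε : ℝ} (hε : ε ∈ Set.Ioo (0 : ℝ) 1) :
    Summable fun n : Freq => ‖gradCoeff (YepsCoeff χ g ε ω) n‖ := by
  refine Summable.of_nonneg_of_le (fun _ => norm_nonneg _) (fun n => ?_)
    (hχ.summable_YepsCoeff hM hg hε 1)
  rw [norm_gradCoeff, pow_one]
  exact mul_le_mul_of_nonneg_right (norm_vec_le_bracket n) (norm_nonneg _)

theorem IsMollifier.summable_rho_sq (hχ : IsMollifier χ) {ε : ℝ} (hε : ε ∈ Set.Ioo (0 : ℝ) 1) :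
    Summable fun n : Freq => ‖rho χ (ε • vec n)‖ ^ 2 / ‖vec n‖ ^ 2 := by
  obtain ⟨C, hC0, hC⟩ := hχ.exists_rho_smul_le 2
  have h0 := hε.1
  have hs := (summable_bracket_rpow (r := 4) (by norm_num)).mul_left ((C * (ε ^ 2)⁻¹) ^ 2)
  refine Summable.of_nonneg_of_le (fun n => by positivity) (fun n => ?_) hs
  have hb := bracket_pos n
  have h3 : bracket n ^ (-4 : ℝ) = (bracket n ^ 4)⁻¹ := by
    rw [Real.rpow_neg hb.le]
    congr 1
    exact_mod_cast Real.rpow_natCast _ 4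
  rw [h3]
  by_cases hn : n = 0
  · simp only [hn, vec_zero, norm_zero]
    have := bracket_pos 0
    norm_num
    positivity
  · have h1 := hC ε hε n
    rw [mul_pow, ← mul_assoc, ← le_div_iff₀ (by positivity), ← le_div_iff₀ (by positivity)] at h1
    calc ‖rho χ (ε • vec n)‖ ^ 2 / ‖vec n‖ ^ 2 ≤ ‖rho χ (ε • vec n)‖ ^ 2 :=
          div_le_self (by positivity) (one_le_pow₀ (one_le_norm_vec hn))
      _ ≤ (C / bracket n ^ 2 / ε ^ 2) ^ 2 := by gcongr
      _ = _ := by field_simp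

end RapidDecay

/-! ### Regularity of `Y` and convergence of `Y_ε` -/

section FirstChaos

variable {Ω : Type*} [MeasurableSpace Ω] {P : Measure Ω} {g : Freq → Ω → ℂ} {χ : Plane → ℝ}

theorem two_rpow_neg_mul_lt_one {b θ : ℝ} (h : θ < b) : (2 : ℝ) ^ (-b) * 2 ^ θ < 1 := by
  rw [← Real.rpow_add two_pos]
  exact Real.rpow_lt_one_of_one_lt_of_neg one_lt_two (by linarith)

/-- A random Fourier series is Hölder continuous of any exponent below its fractional order of
differentiability in mean square. -/
theorem HasChaosMoments.ae_exists_isHolderSeries {d : Type*} [Fintype d] [IsProbabilityMeasure P]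
    {ξ : (d → ℤ) → Ω → ℂ} (hξ : HasChaosMoments P ξ) {a : (d → ℤ) → ℂ} {b θ : ℝ} (hθ : 0 < θ)
    (hθ1 : θ ≤ 1) (hθb : θ < b) (h : Summable fun n => ‖a n‖ ^ 2 * ‖n‖ ^ (2 * b)) :
    ∀ᵐ ω ∂P, ∃ V C, IsHolderSeries (fun n => a n * ξ n ω) θ C V :=
  WhiteNoiseNLS.ae_exists_isHolderSeries hξ
    (tsum_nonneg fun n => by positivity) (by positivity) hθ hθ1 (two_rpow_neg_mul_lt_one hθb)
    (sum_dyadicBlock_le (hθ.trans hθb).le h)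

theorem YCoeff_eq {Ω : Type*} (g : Freq → Ω → ℂ) (ω : Ω) (n : Freq) :
    YCoeff g ω n = -((‖vec n‖ : ℂ) ^ 2)⁻¹ * linNoise g n ω := by
  rw [YCoeff, linNoise]
  split_ifs with hn
  · simp
  · rw [div_eq_mul_inv]
    ring

/-- A coefficient bound `|a n| ≤ C ⟨n⟩^{-r}` with `r > 1 + b` gives `b` derivatives in mean
square. -/
theorem summable_norm_sq_mul_rpow {a : Freq → ℂ} {C r b : ℝ} (hb : 0 ≤ b)
    (h : 1 + b < r) (ha : ∀ n, ‖a n‖ ≤ C * bracket n ^ (-r)) :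
    Summable fun n : Freq => ‖a n‖ ^ 2 * ‖n‖ ^ (2 * b) := by
  refine Summable.of_nonneg_of_le (fun n => by positivity) (fun n => ?_)
    ((summable_bracket_rpow (r := 2 * r - 2 * b) (by linarith)).mul_left (C ^ 2))
  have hbp := bracket_pos n
  calc ‖a n‖ ^ 2 * ‖n‖ ^ (2 * b) ≤ (C * bracket n ^ (-r)) ^ 2 * bracket n ^ (2 * b) := by
        have := norm_freq_le_bracket n
        have := ha n
        gcongr
    _ = C ^ 2 * bracket n ^ (-(2 * r - 2 * b)) := by
        rw [mul_pow, mul_assoc, ← Real.rpow_natCast (bracket n ^ (-r)), ← Real.rpow_mul hbp.le,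
          ← Real.rpow_add hbp]
        congr 2
        push_cast
        ring

theorem IsWhiteNoise.ae_exists_isHolderSeries_Y [IsProbabilityMeasure P] (hg : IsWhiteNoise P g)
    {θ : ℝ} (hθ : 0 < θ) (hθ1 : θ < 1) :
    ∀ᵐ ω ∂P, ∃ V C, IsHolderSeries (YCoeff g ω) θ C V := by
  have h := hg.hasChaosMoments_linNoise.ae_exists_isHolderSeries
    (a := fun n => -((‖vec n‖ : ℂ) ^ 2)⁻¹) hθ hθ1.le (b := (θ + 1) / 2) (by linarith)
    (summable_norm_sq_mul_rpow (C := 4) (r := 2) (by linarith) (by linarith) fun n => by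
      have hbp := bracket_pos n
      have h3 : bracket n ^ (-2 : ℝ) = (bracket n)⁻¹ ^ 2 := by
        rw [Real.rpow_neg hbp.le, inv_pow]
        congr 1
        exact_mod_cast Real.rpow_natCast _ 2
      rw [norm_neg, norm_inv, norm_pow, Complex.norm_real, norm_norm, h3]
      by_cases hn : n = 0
      · simp [hn, vec_zero]
        positivity
      · have := inv_norm_vec_le hn
        calc (‖vec n‖ ^ 2)⁻¹ = (‖vec n‖⁻¹) ^ 2 := by rw [inv_pow]
          _ ≤ (2 * (bracket n)⁻¹) ^ 2 := by gcongr
          _ = _ := by ring)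
  filter_upwards [h] with ω ⟨V, C, hV⟩
  refine ⟨V, C, ?_⟩
  have e : YCoeff g ω = fun n => -((‖vec n‖ : ℂ) ^ 2)⁻¹ * linNoise g n ω :=
    funext fun n => YCoeff_eq g ω n
  rwa [e]

/-- Interpolation between a uniform bound and a Hölder bound. -/
theorem holder_interpolation {F : Torus → ℂ} {A B θ α : ℝ} (hα : 0 ≤ α) (hαθ : α < θ)
    (hB : 0 ≤ B) (hFA : ∀ x, ‖F x‖ ≤ A) (hFB : ∀ x y, ‖F x - F y‖ ≤ B * dist x y ^ θ)
    (x y : Torus) :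
    ‖F x - F y‖ ≤ (2 * A) ^ (1 - α / θ) * B ^ (α / θ) * dist x y ^ α := by
  have hθ : 0 < θ := hα.trans_lt hαθ
  have h1 : ‖F x - F y‖ ≤ 2 * A := (norm_sub_le _ _).trans (by linarith [hFA x, hFA y])
  have h2 := le_rpow_mul_rpow_of_le (norm_nonneg _) (by positivity) ((div_le_one hθ).2 hαθ.le) h1
    (hFB x y)
  refine h2.trans (le_of_eq ?_)
  rw [Real.mul_rpow hB (Real.rpow_nonneg dist_nonneg _), ← Real.rpow_mul dist_nonneg,
    mul_div_cancel₀ _ hθ.ne', mul_assoc]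

theorem norm_cexp_sub_cexp_le {u v : ℂ} {R : ℝ} (hu : ‖u‖ ≤ R) (hv : ‖v‖ ≤ R) :
    ‖Complex.exp u - Complex.exp v‖ ≤ Real.exp R * ‖u - v‖ := by
  refine Convex.norm_image_sub_le_of_norm_deriv_le (s := Metric.closedBall 0 R)
    (fun z _ => Complex.differentiable_exp z) (fun z hz => ?_) (convex_closedBall 0 R)
    (mem_closedBall_zero_iff.2 hv) (mem_closedBall_zero_iff.2 hu)
  rw [Complex.deriv_exp, Complex.norm_exp]
  exact Real.exp_le_exp.2 ((Complex.re_le_norm z).trans (mem_closedBall_zero_iff.1 hz))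

theorem norm_cexp_le {u : ℂ} {R : ℝ} (hu : ‖u‖ ≤ R) : ‖Complex.exp u‖ ≤ Real.exp R := by
  rw [Complex.norm_exp]
  exact Real.exp_le_exp.2 ((Complex.re_le_norm u).trans hu)

/-- `Y_ε` is the mollification of `Y` at scale `ε`. -/
theorem IsMollifier.Yeps_eq {Ω : Type*} {g : Freq → Ω → ℂ} (hχ : IsMollifier χ)
    {ω : Ω} {Y : Torus → ℂ} {θ C : ℝ} (hθ : 0 < θ)
    (hY : IsHolderSeries (YCoeff g ω) θ C Y) {ε : ℝ}
    (hs : Summable fun n : Freq => ‖YepsCoeff χ g ε ω n‖) :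
    Yeps χ g ε ω = mollify volume χ (scaleShift ε) Y := by
  funext x
  have h := hY.mollify hχ.integrable (measurable_scaleShift ε) hθ
  have e : (fun n => mollifySymbol volume χ (scaleShift ε) n * YCoeff g ω n) =
      YepsCoeff χ g ε ω := by
    funext n
    rw [mollifySymbol_scaleShift, YepsCoeff]
  rw [e] at h
  exact h.fourierSum_eq hs x

/-- The estimates for `Y_ε` and its exponentials that hold on the event where `Y` is a Hölder
continuous function. -/
theorem IsMollifier.Yeps_estimates {Ω : Type*} {g : Freq → Ω → ℂ} (hχ : IsMollifier χ)
    {s α θ : ℝ} (hs : 0 < s) (hsα : s < α)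
    (hαθ : α < θ) (hθ1 : θ < 1) {ω : Ω} {Y : Torus → ℂ} {C : ℝ}
    (hY : IsHolderSeries (YCoeff g ω) θ C Y)
    (hsum : ∀ ε ∈ Set.Ioo (0 : ℝ) 1, Summable fun n : Freq => ‖YepsCoeff χ g ε ω n‖) :
    ∃ A : ℝ, ∀ ε ∈ Set.Ioo (0 : ℝ) 1, ∀ q : ℝ≥0∞, 1 ≤ q →
      eLpNorm (fun x => Complex.exp (Yeps χ g ε ω x)) q volume ≤ ENNReal.ofReal A ∧
      eLpNorm (fun x => Complex.exp (-Yeps χ g ε ω x)) q volume ≤ ENNReal.ofReal A ∧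
      sobolevNorm s q (coeff fun x => Complex.exp (Yeps χ g ε ω x)) ≤ ENNReal.ofReal A ∧
      sobolevNorm s q (coeff fun x => Complex.exp (-Yeps χ g ε ω x)) ≤ ENNReal.ofReal A ∧
      sobolevNorm s q (coeff fun x => Yeps χ g ε ω x - Y x) ≤
        ENNReal.ofReal (A * ε ^ (θ - α)) ∧
      eLpNorm (fun x => Yeps χ g ε ω x - Y x) q volume ≤ ENNReal.ofReal (A * ε ^ (θ - α)) := by
  have hα : 0 < α := hs.trans hsα
  have hθ : 0 < θ := hα.trans hαθ
  have hC := hY.nonneg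
  obtain ⟨K₁, hK₁, hSob₁⟩ := exists_sobolevNorm_le_of_holder hs (hsα.trans hαθ) hθ1.le
  obtain ⟨K₂, hK₂, hSob₂⟩ := exists_sobolevNorm_le_of_holder hs hsα (hαθ.trans hθ1).le
  set m := ∫ z, |χ z| with hm
  have hm0 : 0 ≤ m := integral_nonneg fun _ => abs_nonneg _
  set R := m * C with hR
  have hR0 : 0 ≤ R := by positivity
  have hpi : 0 ≤ (2 * Real.pi) ^ 2 := by positivity
  set M₁ := Real.exp R + Real.exp R * R with hM₁
  set M₂ := (2 * R) ^ (1 - α / θ) * (R + C) ^ (α / θ) + R with hM₂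
  set A := (2 * Real.pi) ^ 2 * Real.exp R + K₁ * M₁ + K₂ * M₂ + (2 * Real.pi) ^ 2 * R with hA
  have t1 : 0 ≤ (2 * Real.pi) ^ 2 * Real.exp R := by positivity
  have t2 : 0 ≤ K₁ * M₁ := by positivity
  have t3 : 0 ≤ K₂ * M₂ := by positivity
  have t4 : 0 ≤ (2 * Real.pi) ^ 2 * R := by positivity
  refine ⟨A, fun ε hε q hq => ?_⟩
  have hε0 := hε.1
  have hYe := hχ.Yeps_eq hθ hY (hsum ε hε)
  have hser := hY.mollify hχ.integrable (measurable_scaleShift ε) hθ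
  rw [← hYe] at hser
  have hbd : ∀ x, ‖Yeps χ g ε ω x‖ ≤ R := hser.norm_le
  have hbd' : ∀ x, ‖-Yeps χ g ε ω x‖ ≤ R := fun x => by rw [norm_neg]; exact hbd x
  have hdiff : ∀ x, ‖Yeps χ g ε ω x - Y x‖ ≤ R * ε ^ θ := by
    intro x
    rw [hYe]
    refine (norm_mollify_sub_le hχ.integrable hχ.integral_eq_one (measurable_scaleShift ε) hθ hC
      hY.norm_le hY.holder (fun z hz => hχ.norm_scaleShift_le hε0.le hz) x).trans (le_of_eq ?_)
    rw [hR]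
    ring
  have hεα : ε ^ θ ≤ ε ^ (θ - α) := Real.rpow_le_rpow_of_exponent_ge hε0 hε.2.le (by linarith)
  have hεp : 0 < ε ^ (θ - α) := Real.rpow_pos_of_pos hε0 _
  refine ⟨?_, ?_, ?_, ?_, ?_, ?_⟩
  · exact (eLpNorm_le_of_bounded hq fun x => norm_cexp_le (hbd x)).trans
      (ENNReal.ofReal_le_ofReal (by linarith))
  · exact (eLpNorm_le_of_bounded hq fun x => norm_cexp_le (hbd' x)).trans
      (ENNReal.ofReal_le_ofReal (by linarith))
  · refine (hSob₁ _ M₁ (by positivity) (fun x => ?_) (fun x y => ?_) q hq).trans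
      (ENNReal.ofReal_le_ofReal (by linarith))
    · exact (norm_cexp_le (hbd x)).trans (le_add_of_nonneg_right (by positivity))
    · refine (norm_cexp_sub_cexp_le (hbd x) (hbd y)).trans ?_
      have h1 := hser.holder x y
      have h2 : 0 ≤ Real.exp R * dist x y ^ θ := by positivity
      have h3 := mul_le_mul_of_nonneg_left h1 (Real.exp_pos R).le
      linarith
  · refine (hSob₁ _ M₁ (by positivity) (fun x => ?_) (fun x y => ?_) q hq).trans
      (ENNReal.ofReal_le_ofReal (by linarith))
    · exact (norm_cexp_le (hbd' x)).trans (le_add_of_nonneg_right (by positivity))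
    · refine (norm_cexp_sub_cexp_le (hbd' x) (hbd' y)).trans ?_
      have h1 := hser.holder x y
      have h2 : 0 ≤ Real.exp R * dist x y ^ θ := by positivity
      have h3 := mul_le_mul_of_nonneg_left h1 (Real.exp_pos R).le
      rw [← neg_sub', norm_neg]
      linarith
  -- interpolating between the rate in sup norm and the uniform `θ`-Hölder bound leaves the rate
  -- `θ - α` for the `α`-Hölder norm
  · have hF := holder_interpolation (F := fun x => Yeps χ g ε ω x - Y x) hα.le hαθ
      (A := R * ε ^ θ) (B := R + C) (by positivity) hdiff (fun x y => by
        rw [sub_sub_sub_comm, add_mul]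
        exact (norm_sub_le _ _).trans (add_le_add (hser.holder x y) (hY.holder x y)))
    have e : (2 * (R * ε ^ θ)) ^ (1 - α / θ) = (2 * R) ^ (1 - α / θ) * ε ^ (θ - α) := by
      rw [← mul_assoc, Real.mul_rpow (by positivity) (by positivity), ← Real.rpow_mul hε0.le]
      congr 2
      field_simp
    rw [e] at hF
    refine (hSob₂ _ (M₂ * ε ^ (θ - α)) (by positivity) (fun x => ?_) (fun x y => ?_) q hq).trans
      (ENNReal.ofReal_le_ofReal ?_)
    · refine (hdiff x).trans ?_
      have : 0 ≤ (2 * R) ^ (1 - α / θ) * (R + C) ^ (α / θ) := by positivity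
      gcongr
      linarith
    · refine (hF x y).trans ?_
      have h1 : 0 ≤ R * ε ^ (θ - α) := by positivity
      have h2 : (2 * R) ^ (1 - α / θ) * ε ^ (θ - α) * (R + C) ^ (α / θ) ≤ M₂ * ε ^ (θ - α) := by
        rw [hM₂, add_mul]
        linarith
      gcongr
    · rw [← mul_assoc]
      gcongr
      linarith
  · refine (eLpNorm_le_of_bounded hq hdiff).trans (ENNReal.ofReal_le_ofReal ?_)
    calc (2 * Real.pi) ^ 2 * (R * ε ^ θ) ≤ (2 * Real.pi) ^ 2 * (R * ε ^ (θ - α)) := by gcongr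
      _ = ((2 * Real.pi) ^ 2 * R) * ε ^ (θ - α) := by ring
      _ ≤ A * ε ^ (θ - α) := by
        gcongr
        linarith

/-- The exponentials `e^{-pY_ε}` converge uniformly with a rate. -/
theorem IsMollifier.exp_Yeps_estimate {Ω : Type*} {g : Freq → Ω → ℂ} (hχ : IsMollifier χ)
    {θ : ℝ} (hθ : 0 < θ) {ω : Ω}
    {Y : Torus → ℂ} {C : ℝ} (hY : IsHolderSeries (YCoeff g ω) θ C Y)
    (hsum : ∀ ε ∈ Set.Ioo (0 : ℝ) 1, Summable fun n : Freq => ‖YepsCoeff χ g ε ω n‖) (p : ℝ) :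
    ∃ A : ℝ, ∀ ε ∈ Set.Ioo (0 : ℝ) 1,
      eLpNorm (fun x => Complex.exp (-p * Yeps χ g ε ω x) - Complex.exp (-p * Y x)) ∞ volume ≤
        ENNReal.ofReal (A * ε ^ θ) := by
  have hC := hY.nonneg
  set m := ∫ z, |χ z| with hm
  have hm0 : 0 ≤ m := integral_nonneg fun _ => abs_nonneg _
  set R := |p| * (m * C + C) with hR
  refine ⟨(2 * Real.pi) ^ 2 * (Real.exp R * (|p| * (m * C))), fun ε hε => ?_⟩
  have hε0 := hε.1
  have hYe := hχ.Yeps_eq hθ hY (hsum ε hε)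
  have hser := hY.mollify hχ.integrable (measurable_scaleShift ε) hθ
  rw [← hYe] at hser
  refine (eLpNorm_le_of_bounded (by simp) (M := Real.exp R * (|p| * (m * C)) * ε ^ θ)
    fun x => ?_).trans (le_of_eq (by rw [← mul_assoc]))
  have hp : ∀ u : ℂ, ‖-(p : ℂ) * u‖ = |p| * ‖u‖ := fun u => by
    rw [norm_mul, norm_neg, Complex.norm_real, Real.norm_eq_abs]
  refine (norm_cexp_sub_cexp_le (R := R) ?_ ?_).trans ?_
  · rw [hp, hR]
    have := hser.norm_le x
    gcongr
    linarith
  · rw [hp, hR]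
    have := hY.norm_le x
    have : 0 ≤ m * C := by positivity
    gcongr
    linarith
  · rw [← mul_sub, hp, mul_assoc, mul_assoc |p|]
    gcongr
    rw [hYe]
    refine (norm_mollify_sub_le hχ.integrable hχ.integral_eq_one (measurable_scaleShift ε) hθ hC
      hY.norm_le hY.holder (fun z hz => hχ.norm_scaleShift_le hε0.le hz) x).trans (le_of_eq ?_)
    ring

end FirstChaos

/-! ### Convergence of the gradient -/

section Gradient

/-- The components of `D^{-s} ∇Y` are Hölder continuous of every exponent below `s`. -/
theorem IsWhiteNoise.ae_exists_isHolderSeries_grad {Ω : Type*} [MeasurableSpace Ω] {P : Measure Ω}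
    {g : Freq → Ω → ℂ} [IsProbabilityMeasure P] (hg : IsWhiteNoise P g) {s θ : ℝ}
    (hθ : 0 < θ) (hθs : θ < s) (hs1 : s < 1) :
    ∀ᵐ ω ∂P, ∀ j, ∃ V C,
      IsHolderSeries
        (fun n => ((bracket n ^ (-s) : ℝ) : ℂ) * gradCoeff (YCoeff g ω) n j) θ C V := by
  rw [ae_all_iff]
  intro j
  have h := hg.hasChaosMoments_linNoise.ae_exists_isHolderSeries
    (a := fun n => ((bracket n ^ (-s) : ℝ) : ℂ) * (Complex.I * n j * -((‖vec n‖ : ℂ) ^ 2)⁻¹))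
    hθ (hθs.trans hs1).le (b := (θ + s) / 2) (by linarith)
    (summable_norm_sq_mul_rpow (C := 2) (r := s + 1) (by linarith) (by linarith) fun n => by
      have hbp := bracket_pos n
      have h3 : bracket n ^ (-(s + 1)) = bracket n ^ (-s) * (bracket n)⁻¹ := by
        rw [neg_add, Real.rpow_add hbp, Real.rpow_neg_one]
      have h4 : |(n j : ℝ)| ≤ ‖vec n‖ := by simpa [vec] using abs_apply_le_norm (vec n) j
      rw [norm_mul, norm_mul, norm_mul, norm_neg, norm_inv, norm_pow, Complex.norm_real,
        Complex.norm_real, norm_norm, Complex.norm_I, one_mul, Complex.norm_intCast, h3,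
        Real.norm_of_nonneg (by positivity), mul_left_comm 2]
      refine mul_le_mul_of_nonneg_left ?_ (by positivity)
      by_cases hn : n = 0
      · have h0 := bracket_pos 0
        simp [hn]
        positivity
      · have h5 := one_le_norm_vec hn
        refine le_trans ?_ (inv_norm_vec_le hn)
        calc |(n j : ℝ)| * (‖vec n‖ ^ 2)⁻¹ ≤ ‖vec n‖ * (‖vec n‖ ^ 2)⁻¹ := by gcongr
          _ = ‖vec n‖⁻¹ := by field_simp)
  filter_upwards [h] with ω ⟨V, C, hV⟩
  refine ⟨V, C, ?_⟩
  have e : (fun n => ((bracket n ^ (-s) : ℝ) : ℂ) * gradCoeff (YCoeff g ω) n j) = fun n =>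
      ((bracket n ^ (-s) : ℝ) : ℂ) * (Complex.I * n j * -((‖vec n‖ : ℂ) ^ 2)⁻¹) *
        linNoise g n ω := by
    funext n
    simp only [gradCoeff, YCoeff_eq]
    ring
  rwa [e]

theorem coeff_apply {F : Torus → CVec} (hF : Continuous F) (n : Freq) (j : Fin 2) :
    coeff F n j = coeff (fun x => F x j) n := by
  have h := (EuclideanSpace.proj j : CVec →L[ℂ] ℂ).integral_comp_comm
    (integrable_of_continuous ((continuous_mchar (-n)).smul hF))
  simp only [coeff]
  rw [PiLp.smul_apply]
  congr 1
  exact h.symm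

theorem norm_cvec_le {v : CVec} {M : ℝ} (h : ∀ j, ‖v j‖ ≤ M) : ‖v‖ ≤ 2 * M := by
  have hM : 0 ≤ M := (norm_nonneg _).trans (h 0)
  refine abs_le_of_sq_le_sq' ?_ (by positivity) |>.2
  rw [EuclideanSpace.norm_sq_eq, Fin.sum_univ_two]
  have h0 := pow_le_pow_left₀ (norm_nonneg _) (h 0) 2
  have h1 := pow_le_pow_left₀ (norm_nonneg _) (h 1) 2
  nlinarith

variable {Ω : Type*} {χ : Plane → ℝ} {g : Freq → Ω → ℂ}

theorem coeff_sub {E : Type*} [NormedAddCommGroup E] [NormedSpace ℂ E] {F G : Torus → E}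
    (hF : Continuous F) (hG : Continuous G) (n : Freq) :
    coeff (fun x => F x - G x) n = coeff F n - coeff G n := by
  simp only [coeff, smul_sub]
  rw [integral_sub, smul_sub]
  · exact integrable_of_continuous ((continuous_mchar (-n)).smul hF)
  · exact integrable_of_continuous ((continuous_mchar (-n)).smul hG)

/-- The convergence of `∇Y_ε` in `W^{-s,q}`: the difference `D^{-s} (∇Y_ε - ∇Y)` is the error of the
mollification of a Hölder continuous vector field. -/
theorem IsMollifier.gradYeps_estimate (hχ : IsMollifier χ) {s θ : ℝ} (hθ : 0 < θ) {ω : Ω}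
    (hV : ∀ j, ∃ V C,
      IsHolderSeries (fun n => ((bracket n ^ (-s) : ℝ) : ℂ) * gradCoeff (YCoeff g ω) n j) θ C V)
    (hsum : ∀ ε ∈ Set.Ioo (0 : ℝ) 1, Summable fun n : Freq => ‖gradCoeff (YepsCoeff χ g ε ω) n‖) :
    ∃ A : ℝ, ∀ ε ∈ Set.Ioo (0 : ℝ) 1, ∀ q : ℝ≥0∞, 1 ≤ q →
      sobolevNorm (-s) q (fun n => coeff (gradYeps χ g ε ω) n - gradCoeff (YCoeff g ω) n) ≤
        ENNReal.ofReal (A * ε ^ θ) := by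
  choose V C hVC using hV
  have hC : ∀ j, 0 ≤ C j := fun j => (hVC j).nonneg
  have hVc : ∀ j, Continuous (V j) := fun j => (hVC j).continuous hθ
  set m := ∫ z, |χ z| with hm
  have hm0 : 0 ≤ m := integral_nonneg fun _ => abs_nonneg _
  refine ⟨(2 * Real.pi) ^ 2 * (2 * (m * (C 0 + C 1))), fun ε hε q hq => ?_⟩
  have hε0 := hε.1
  have hser := fun j => (hVC j).mollify hχ.integrable (measurable_scaleShift ε) hθ
  have hmc : ∀ j, Continuous (mollify volume χ (scaleShift ε) (V j)) := fun j =>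
    (hser j).continuous hθ
  let F : Torus → CVec := fun x =>
    WithLp.toLp 2 fun j => mollify volume χ (scaleShift ε) (V j) x - V j x
  have hF : Continuous F :=
    (PiLp.continuous_toLp 2 _).comp (continuous_pi fun j => (hmc j).sub (hVc j))
  rw [mul_assoc]
  refine sobolevNorm_le hq hF.aestronglyMeasurable (M := 2 * (m * (C 0 + C 1)) * ε ^ θ)
    (fun x => ?_) fun n => ?_
  · rw [mul_assoc]
    refine norm_cvec_le fun j => ?_
    refine (norm_mollify_sub_le hχ.integrable hχ.integral_eq_one (measurable_scaleShift ε) hθ (hC j)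
      (hVC j).norm_le (hVC j).holder (fun z hz => hχ.norm_scaleShift_le hε0.le hz) x).trans ?_
    rw [← hm, mul_assoc]
    gcongr
    fin_cases j
    · exact le_add_of_nonneg_right (hC 1)
    · exact le_add_of_nonneg_left (hC 0)
  · ext j
    rw [coeff_apply hF]
    have h1 := coeff_sub (hmc j) (hVc j) n
    rw [(hser j).coeff_eq, (hVC j).coeff_eq, mollifySymbol_scaleShift] at h1
    refine h1.trans ?_
    have h2 : coeff (gradYeps χ g ε ω) n = gradCoeff (YepsCoeff χ g ε ω) n :=
      coeff_fourierSum (hsum ε hε) n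
    rw [h2]
    simp only [PiLp.smul_apply, PiLp.sub_apply, gradCoeff, YepsCoeff, smul_eq_mul]
    ring

end Gradient

/-! ### The Wick square as a sum in `L²(Ω)` -/

section WickSum

variable {Ω : Type*} [MeasurableSpace Ω] {P : Measure Ω}

theorem HasChaosMoments.comp_injective {ι κ : Type*} {ξ : ι → Ω → ℂ} (h : HasChaosMoments P ξ)
    {f : κ → ι} (hf : Function.Injective f) : HasChaosMoments P fun i => ξ (f i) := by
  classical
  refine ⟨fun i => h.aemeasurable _, fun k hk => ?_⟩
  obtain ⟨C, hC, hb⟩ := h.moment k hk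
  refine ⟨C, hC, fun A c => ?_⟩
  have h1 := hb (A.map ⟨f, hf⟩) (Function.extend f c 0)
  simpa only [Finset.sum_map, Function.Embedding.coeFn_mk, hf.extend_apply] using h1

theorem eLpNorm_two_sq {f : Ω → ℂ} : eLpNorm f 2 P ^ 2 = ∫⁻ ω, ‖f ω‖ₑ ^ 2 ∂P := by
  rw [eLpNorm_eq_lintegral_rpow_enorm_toReal (by norm_num) (by norm_num), ← ENNReal.rpow_natCast,
    ← ENNReal.rpow_mul]
  simp

/-- Second moment bounds make a random series with square summable coefficients converge
unconditionally in `L²(Ω)`. -/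
theorem HasChaosMoments.exists_isL2Sum {ι : Type*} {ξ : ι → Ω → ℂ} (h : HasChaosMoments P ξ)
    {a : ι → ℂ} (ha : Summable fun i => ‖a i‖ ^ 2) :
    ∃ Z, IsL2Sum P (fun i ω => a i * ξ i ω) Z := by
  classical
  obtain ⟨C, hC, hb⟩ := h.moment 1 le_rfl
  have hb' : ∀ A : Finset ι, eLpNorm (fun ω => ∑ i ∈ A, a i * ξ i ω) 2 P ^ 2 ≤
      ENNReal.ofReal (C.toReal * ∑ i ∈ A, ‖a i‖ ^ 2) := by
    intro A
    rw [eLpNorm_two_sq, ENNReal.ofReal_mul ENNReal.toReal_nonneg, ENNReal.ofReal_toReal hC,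
      ← sum_enorm_sq_eq_ofReal]
    simpa using hb A a
  have hm : ∀ i, MemLp (fun ω => a i * ξ i ω) 2 P := by
    intro i
    refine ⟨((h.aemeasurable i).const_mul _).aestronglyMeasurable, ?_⟩
    have h1 := hb' {i}
    simp only [Finset.sum_singleton] at h1
    have h2 := h1.trans_lt ENNReal.ofReal_lt_top
    rw [lt_top_iff_ne_top] at h2 ⊢
    exact fun h3 => h2 (by rw [h3]; simp)
  let X : ι → Lp ℂ 2 P := fun i => (hm i).toLp _
  have hX : ∀ A : Finset ι, (∑ i ∈ A, X i : Lp ℂ 2 P) =ᵐ[P] fun ω => ∑ i ∈ A, a i * ξ i ω := by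
    intro A
    refine (Lp.coeFn_finsetSum A X).trans ?_
    have h1 : ∀ᵐ ω ∂P, ∀ i ∈ A, X i ω = a i * ξ i ω :=
      (Finset.eventually_all A).2 fun i _ => (hm i).coeFn_toLp
    filter_upwards [h1] with ω hω
    rw [Finset.sum_apply]
    exact Finset.sum_congr rfl hω
  have hsum : Summable X := by
    rw [summable_iff_vanishing_norm]
    intro ε hε
    obtain ⟨s, hs⟩ := summable_iff_vanishing_norm.1 ha (ε ^ 2 / (C.toReal + 1))
      (by have := ENNReal.toReal_nonneg (a := C); positivity)
    refine ⟨s, fun t ht => ?_⟩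
    have h1 := hs t ht
    rw [Real.norm_of_nonneg (Finset.sum_nonneg fun _ _ => sq_nonneg _),
      lt_div_iff₀ (by have := ENNReal.toReal_nonneg (a := C); positivity)] at h1
    have h2 := hb' t
    have h3 : ‖∑ i ∈ t, X i‖ ^ 2 ≤ C.toReal * ∑ i ∈ t, ‖a i‖ ^ 2 := by
      rw [Lp.norm_def, ← ENNReal.toReal_pow, eLpNorm_congr_ae (hX t)]
      exact ENNReal.toReal_le_of_le_ofReal
        (mul_nonneg ENNReal.toReal_nonneg (Finset.sum_nonneg fun _ _ => sq_nonneg _)) h2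
    have h4 : ‖∑ i ∈ t, X i‖ ^ 2 < ε ^ 2 := by
      have : 0 ≤ ∑ i ∈ t, ‖a i‖ ^ 2 := Finset.sum_nonneg fun _ _ => sq_nonneg _
      nlinarith
    exact lt_of_pow_lt_pow_left₀ 2 hε.le h4
  obtain ⟨Z, hZ⟩ := hsum
  refine ⟨Z, hm, Lp.memLp Z, ?_⟩
  have h1 := (Lp.tendsto_Lp_iff_tendsto_eLpNorm' _ Z).1 hZ
  refine h1.congr fun A => ?_
  refine eLpNorm_congr_ae ?_
  filter_upwards [hX A] with ω hω
  simp only [Pi.sub_apply, hω]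

/-- The sum in `L²(Ω)` is the only possible almost sure limit of the partial sums along an
exhausting sequence of finite sets. -/
theorem IsL2Sum.ae_eq_of_tendsto {ι : Type*} {X : ι → Ω → ℂ} {Z : Ω → ℂ} (h : IsL2Sum P X Z)
    {B : ℕ → Finset ι} (hB : Tendsto B atTop atTop) :
    ∀ᵐ ω ∂P, ∀ z, Tendsto (fun j => ∑ i ∈ B j, X i ω) atTop (𝓝 z) → z = Z ω := by
  have h1 : TendstoInMeasure P (fun j ω => ∑ i ∈ B j, X i ω) atTop Z := by
    refine tendstoInMeasure_of_tendsto_eLpNorm (p := 2) (by norm_num) (fun j => ?_)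
      h.memLp_sum.1 (h.tendsto.comp hB)
    exact (memLp_finsetSum (B j) fun i _ => h.memLp_term i).1
  obtain ⟨ns, hns, h2⟩ := h1.exists_seq_tendsto_ae
  filter_upwards [h2] with ω hω z hz
  exact tendsto_nhds_unique (hz.comp hns.tendsto_atTop) hω

/-- The coefficient of `quadNoise` in the expansion of `|∇Y|²`. -/
def wickWeight (l : Fin 2 ⊕ Fin 2 → ℤ) : ℂ :=
  ((inner ℝ (vec (l ∘ Sum.inl)) (vec (-(l ∘ Sum.inr))) : ℝ) : ℂ) *
    (((‖vec (l ∘ Sum.inl)‖ : ℂ) ^ 2)⁻¹ * ((‖vec (l ∘ Sum.inr)‖ : ℂ) ^ 2)⁻¹)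

theorem wickTerm_eq {Ω : Type*} (g : Freq → Ω → ℂ) (m n : Freq) (ω : Ω) :
    wickTerm g m n ω =
      wickWeight (Sum.elim (n + m) (-n)) * quadNoise g (Sum.elim (n + m) (-n)) ω := by
  simp only [wickTerm, wickWeight, quadNoise, Sum.elim_comp_inl, Sum.elim_comp_inr, neg_neg,
    neg_eq_zero, vec_neg n, norm_neg, or_comm (a := n + m = 0)]
  split_ifs with h1 h2
  · simp
  · subst h2
    push Not at h1
    have h3 : (‖vec n‖ : ℂ) ≠ 0 := by
      have := one_le_norm_vec h1.1
      exact_mod_cast (by linarith : ‖vec n‖ ≠ 0)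
    rw [add_zero, real_inner_self_eq_norm_sq, wickProd, if_pos rfl, Complex.mul_conj']
    push_cast
    field_simp
  · have h3 : n + m ≠ n := by simpa using h2
    rw [wickProd, if_neg h3, sub_zero]
    field_simp

theorem norm_wickWeight_le (l : Fin 2 ⊕ Fin 2 → ℤ) :
    ‖wickWeight l‖ ≤ 4 * ((bracket (l ∘ Sum.inl))⁻¹ * (bracket (l ∘ Sum.inr))⁻¹) := by
  have b1 := bracket_pos (l ∘ Sum.inl)
  have b2 := bracket_pos (l ∘ Sum.inr)
  by_cases h1 : l ∘ Sum.inl = 0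
  · simp only [wickWeight, h1, vec_zero, inner_zero_left]
    have := bracket_pos 0
    norm_num
    positivity
  by_cases h2 : l ∘ Sum.inr = 0
  · simp only [wickWeight, h2, neg_zero, vec_zero, inner_zero_right]
    have := bracket_pos 0
    norm_num
    positivity
  have n1 := one_le_norm_vec h1
  have n2 := one_le_norm_vec h2
  have h3 : |inner ℝ (vec (l ∘ Sum.inl)) (vec (-(l ∘ Sum.inr)))| ≤
      ‖vec (l ∘ Sum.inl)‖ * ‖vec (l ∘ Sum.inr)‖ := by
    simpa [vec_neg] using abs_real_inner_le_norm (vec (l ∘ Sum.inl)) (vec (-(l ∘ Sum.inr)))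
  have i1 := inv_norm_vec_le h1
  have i2 := inv_norm_vec_le h2
  rw [wickWeight, norm_mul, norm_mul, norm_inv, norm_inv, norm_pow, norm_pow, Complex.norm_real,
    Complex.norm_real, Complex.norm_real, norm_norm, norm_norm, Real.norm_eq_abs]
  calc |inner ℝ (vec (l ∘ Sum.inl)) (vec (-(l ∘ Sum.inr)))| *
        ((‖vec (l ∘ Sum.inl)‖ ^ 2)⁻¹ * (‖vec (l ∘ Sum.inr)‖ ^ 2)⁻¹)
      ≤ (‖vec (l ∘ Sum.inl)‖ * ‖vec (l ∘ Sum.inr)‖) *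
        ((‖vec (l ∘ Sum.inl)‖ ^ 2)⁻¹ * (‖vec (l ∘ Sum.inr)‖ ^ 2)⁻¹) := by gcongr
    _ = ‖vec (l ∘ Sum.inl)‖⁻¹ * ‖vec (l ∘ Sum.inr)‖⁻¹ := by field_simp
    _ ≤ (2 * (bracket (l ∘ Sum.inl))⁻¹) * (2 * (bracket (l ∘ Sum.inr))⁻¹) := by gcongr
    _ = _ := by ring

theorem summable_wickWeight_sq (m : Freq) :
    Summable fun n : Freq => ‖wickWeight (Sum.elim (n + m) (-n))‖ ^ 2 := by
  refine Summable.of_nonneg_of_le (fun n => by positivity) (fun n => ?_)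
    ((summable_bracket_rpow (r := 4) (by norm_num)).mul_left (64 * bracket m ^ 2))
  have b1 := bracket_pos n
  have b2 := bracket_pos (n + m)
  have b3 := bracket_pos m
  have h1 := norm_wickWeight_le (Sum.elim (n + m) (-n))
  simp only [Sum.elim_comp_inl, Sum.elim_comp_inr, bracket_neg] at h1
  have h2 : bracket n ≤ 2 * bracket (n + m) * bracket m := by
    have := bracket_add_le (n + m) (-m)
    simpa [bracket_neg] using this
  have h3 : (bracket (n + m))⁻¹ ≤ 2 * bracket m * (bracket n)⁻¹ := by
    rw [inv_le_iff_one_le_mul₀ b2, ← div_eq_mul_inv, div_mul_eq_mul_div, one_le_div b1]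
    linarith
  have h4 : bracket n ^ (-4 : ℝ) = (bracket n ^ 4)⁻¹ := by
    rw [Real.rpow_neg b1.le]
    congr 1
    exact_mod_cast Real.rpow_natCast _ 4
  calc ‖wickWeight (Sum.elim (n + m) (-n))‖ ^ 2
      ≤ (4 * ((2 * bracket m * (bracket n)⁻¹) * (bracket n)⁻¹)) ^ 2 := by
        gcongr
        exact h1.trans (by gcongr)
    _ = 64 * bracket m ^ 2 * bracket n ^ (-4 : ℝ) := by
        rw [h4]
        field_simp
        ring

theorem IsWhiteNoise.exists_isWickSq {g : Freq → Ω → ℂ} [IsProbabilityMeasure P]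
    (hg : IsWhiteNoise P g) : ∃ W, IsWickSq P g W := by
  have h : ∀ m, ∃ Z, IsL2Sum P (fun n => wickTerm g m n) Z := by
    intro m
    have hinj : Function.Injective fun n : Freq => (Sum.elim (n + m) (-n) : Fin 2 ⊕ Fin 2 → ℤ) := by
      intro n n' hn
      have := congrArg (fun l : Fin 2 ⊕ Fin 2 → ℤ => -(l ∘ Sum.inr)) hn
      simpa using this
    obtain ⟨Z, hZ⟩ := (hg.hasChaosMoments_quadNoise.comp_injective hinj).exists_isL2Sum
      (summable_wickWeight_sq m)
    refine ⟨Z, ?_⟩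
    convert hZ using 3 with n ω
    exact wickTerm_eq g m _ _
  choose Z hZ using h
  exact ⟨fun ω m => Z m ω, hZ⟩

end WickSum

/-! ### The Wick square as the diagonal of a Hölder function of two points -/

section WickDiagonal

/-- The diagonal embedding `𝕋² → 𝕋² × 𝕋²`. -/
def diag (x : Torus) : MTorus (Fin 2 ⊕ Fin 2) := Sum.elim x x

theorem continuous_diag : Continuous diag := by
  refine continuous_pi fun i => ?_
  rcases i with i | i
  · exact continuous_apply i
  · exact continuous_apply i

theorem mchar_diag (l : Fin 2 ⊕ Fin 2 → ℤ) (x : Torus) :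
    mchar l (diag x) = character (l ∘ Sum.inl + l ∘ Sum.inr) x := by
  rw [mchar_sumElim, character_eq_mchar, mchar_add]
  rfl

theorem coeff_trigPoly_diag (A : Finset (Fin 2 ⊕ Fin 2 → ℤ)) (c : (Fin 2 ⊕ Fin 2 → ℤ) → ℂ)
    (n : Freq) : coeff (fun x => trigPoly A c (diag x)) n =
      ∑ l ∈ A, if l ∘ Sum.inl + l ∘ Sum.inr = n then c l else 0 := by
  rw [← coeff_sum_character A (fun l => l ∘ Sum.inl + l ∘ Sum.inr) c n]
  congr 1
  funext x
  refine Finset.sum_congr rfl fun l _ => ?_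
  rw [mchar_diag, smul_eq_mul, mul_comm]

theorem norm_le_bracket_or (l : Fin 2 ⊕ Fin 2 → ℤ) :
    ‖l‖ ≤ bracket (l ∘ Sum.inl) ∨ ‖l‖ ≤ bracket (l ∘ Sum.inr) := by
  have h : ‖l‖ ≤ max (bracket (l ∘ Sum.inl)) (bracket (l ∘ Sum.inr)) := by
    refine (pi_norm_le_iff_of_nonneg ((bracket_pos _).le.trans (le_max_left _ _))).2 fun i => ?_
    rcases i with i | i
    · exact ((norm_le_pi_norm (l ∘ Sum.inl) i).trans (norm_freq_le_bracket _)).trans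
        (le_max_left _ _)
    · exact ((norm_le_pi_norm (l ∘ Sum.inr) i).trans (norm_freq_le_bracket _)).trans
        (le_max_right _ _)
  exact le_max_iff.1 h

theorem summable_wick_weight {s b : ℝ} (hb : 0 < b) (hbs : b < s) (hs1 : s < 1) :
    Summable fun l : Fin 2 ⊕ Fin 2 → ℤ =>
      ‖((bracket (l ∘ Sum.inl + l ∘ Sum.inr) ^ (-s) : ℝ) : ℂ) * wickWeight l‖ ^ 2 *
        ‖l‖ ^ (2 * b) := by
  have h1 := summable_bracket_triple (α := 2 * s) (β := 2 - 2 * b) (γ := 2) (by linarith)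
    (by linarith) (by linarith) (by linarith)
  have h2 := summable_bracket_triple (α := 2 * s) (β := 2) (γ := 2 - 2 * b) (by linarith)
    (by linarith) (by linarith) (by linarith)
  have h3 := (Equiv.sumArrowEquivProdArrow (Fin 2) (Fin 2) ℤ).summable_iff.2
    ((h1.add h2).mul_left 16)
  refine Summable.of_nonneg_of_le (fun l => by positivity) (fun l => ?_) h3
  change _ ≤ 16 * (bracket (l ∘ Sum.inl + l ∘ Sum.inr) ^ (-(2 * s)) *
      bracket (l ∘ Sum.inl) ^ (-(2 - 2 * b)) * bracket (l ∘ Sum.inr) ^ (-2 : ℝ) +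
    bracket (l ∘ Sum.inl + l ∘ Sum.inr) ^ (-(2 * s)) *
      bracket (l ∘ Sum.inl) ^ (-2 : ℝ) * bracket (l ∘ Sum.inr) ^ (-(2 - 2 * b)))
  have hw := norm_wickWeight_le l
  have hl := norm_le_bracket_or l
  have b0 := bracket_pos (l ∘ Sum.inl + l ∘ Sum.inr)
  have b1 := bracket_pos (l ∘ Sum.inl)
  have b2 := bracket_pos (l ∘ Sum.inr)
  generalize bracket (l ∘ Sum.inl + l ∘ Sum.inr) = x at *
  generalize bracket (l ∘ Sum.inl) = y at *
  generalize bracket (l ∘ Sum.inr) = z at *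
  have e : ∀ u : ℝ, 0 < u → u ^ (-(2 - 2 * b)) = u ^ (-2 : ℝ) * u ^ (2 * b) := by
    intro u hu
    rw [← Real.rpow_add hu]
    congr 1
    ring
  have e2 : ∀ u : ℝ, 0 < u → u ^ (-2 : ℝ) = (u⁻¹) ^ 2 := by
    intro u hu
    rw [Real.rpow_neg hu.le, inv_pow]
    congr 1
    exact_mod_cast Real.rpow_natCast _ 2
  have e3 : x ^ (-(2 * s)) = (x ^ (-s)) ^ 2 := by
    rw [← Real.rpow_natCast, ← Real.rpow_mul b0.le]
    congr 1
    push_cast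
    ring
  have hlb : ‖l‖ ^ (2 * b) ≤ y ^ (2 * b) + z ^ (2 * b) := by
    rcases hl with hl | hl
    · exact (Real.rpow_le_rpow (norm_nonneg _) hl (by linarith)).trans
        (le_add_of_nonneg_right (by positivity))
    · exact (Real.rpow_le_rpow (norm_nonneg _) hl (by linarith)).trans
        (le_add_of_nonneg_left (by positivity))
  rw [norm_mul, Complex.norm_real, Real.norm_of_nonneg (by positivity), e y b1, e z b2, e2 y b1,
    e2 z b2, e3]
  calc (x ^ (-s) * ‖wickWeight l‖) ^ 2 * ‖l‖ ^ (2 * b)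
      ≤ (x ^ (-s) * (4 * (y⁻¹ * z⁻¹))) ^ 2 * (y ^ (2 * b) + z ^ (2 * b)) := by gcongr
    _ = _ := by ring

/-- The random function on `𝕋² × 𝕋²` whose restriction to the diagonal is `D^{-s} :|∇Y|²:` is
Hölder continuous: the weight `⟨n₁ - n₂⟩^{-s}` gives almost `s` derivatives in both variables. -/
theorem IsWhiteNoise.ae_exists_isHolderSeries_wick {Ω : Type*} [MeasurableSpace Ω] {P : Measure Ω}
    {g : Freq → Ω → ℂ} [IsProbabilityMeasure P] (hg : IsWhiteNoise P g) {s θ : ℝ}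
    (hθ : 0 < θ) (hθs : θ < s) (hs1 : s < 1) :
    ∀ᵐ ω ∂P, ∃ V C, IsHolderSeries (fun l : Fin 2 ⊕ Fin 2 → ℤ =>
      ((bracket (l ∘ Sum.inl + l ∘ Sum.inr) ^ (-s) : ℝ) : ℂ) *
        (wickWeight l * quadNoise g l ω)) θ C V := by
  have h := hg.hasChaosMoments_quadNoise.ae_exists_isHolderSeries hθ (hθs.trans hs1).le
    (b := (θ + s) / 2) (by linarith)
    (summable_wick_weight (s := s) (by linarith) (by linarith) hs1)
  filter_upwards [h] with ω ⟨V, C, hV⟩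
  refine ⟨V, C, ?_⟩
  simp only [mul_assoc] at hV
  exact hV

variable {Ω : Type*} {χ : Plane → ℝ} {g : Freq → Ω → ℂ}

theorem sum_mbox_pair {E : Type*} [AddCommMonoid E] (N : ℕ) (F : (Fin 2 ⊕ Fin 2 → ℤ) → E) :
    ∑ l ∈ mbox (Fin 2 ⊕ Fin 2) N, F l =
      ∑ n ∈ mbox (Fin 2) N, ∑ m ∈ mbox (Fin 2) N, F (Sum.elim n (-m)) := by
  rw [← Finset.sum_product']
  refine Finset.sum_equiv pairEquiv (fun l => ?_) fun l _ => ?_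
  · simp only [mem_mbox, Finset.mem_product, pairEquiv, Equiv.coe_fn_mk, Sum.forall,
      Function.comp_apply, Pi.neg_apply, abs_neg]
  · exact congrArg F (pairEquiv.symm_apply_apply l).symm

theorem inner_gradCoeff (c : Freq → ℂ) (n m : Freq) :
    inner ℂ (gradCoeff c m) (gradCoeff c n) =
      (inner ℝ (vec n) (vec m) : ℝ) * (c n * (starRingEnd ℂ) (c m)) := by
  simp only [PiLp.inner_apply, gradCoeff, vec, Fin.sum_univ_two, RCLike.inner_apply, map_mul,
    Complex.conj_I, map_intCast]
  push_cast
  linear_combination (-((n 0 : ℂ) * (m 0 : ℂ) + n 1 * m 1) * c n * (starRingEnd ℂ) (c m)) *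
    Complex.I_sq

/-- The truncations of `|∇Y_ε|² - C_ε` are restrictions to the diagonal of trigonometric
polynomials with coefficients in the second chaos. -/
theorem wick_partial_sum (χ : Plane → ℝ) (g : Freq → Ω → ℂ) (ε : ℝ) (ω : Ω) (N : ℕ) (x : Torus) :
    ((‖∑ n ∈ mbox (Fin 2) N, character n x • gradCoeff (YepsCoeff χ g ε ω) n‖ ^ 2 -
        ∑ n ∈ mbox (Fin 2) N, ‖rho χ (ε • vec n)‖ ^ 2 / ‖vec n‖ ^ 2 : ℝ) : ℂ) =
      trigPoly (mbox (Fin 2 ⊕ Fin 2) N) (fun l =>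
        (rho χ (ε • vec (l ∘ Sum.inl)) * rho χ (ε • vec (l ∘ Sum.inr))) *
          (wickWeight l * quadNoise g l ω)) (diag x) := by
  rw [trigPoly, sum_mbox_pair]
  have h1 : ∀ f : Freq → ℂ, ∑ n ∈ mbox (Fin 2) N, f n =
      ∑ n ∈ mbox (Fin 2) N, ∑ m ∈ mbox (Fin 2) N, if n = m then f n else 0 := by
    intro f
    refine Finset.sum_congr rfl fun n hn => ?_
    rw [Finset.sum_ite_eq, if_pos hn]
  push_cast
  have h2 : ∀ v : CVec, (‖v‖ : ℂ) ^ 2 = inner ℂ v v := fun v =>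
    (inner_self_eq_norm_sq_to_K (𝕜 := ℂ) v).symm
  rw [h1, h2, inner_sum, ← Finset.sum_sub_distrib]
  refine Finset.sum_congr rfl fun n _ => ?_
  rw [sum_inner, ← Finset.sum_sub_distrib]
  refine Finset.sum_congr rfl fun m _ => ?_
  rw [inner_smul_left, inner_smul_right, inner_gradCoeff, mchar_diag, Sum.elim_comp_inl,
    Sum.elim_comp_inr, character_eq_mchar, character_eq_mchar, character_eq_mchar, mchar_add,
    mchar_neg, vec_neg, smul_neg, rho_neg]
  simp only [wickWeight, quadNoise, Sum.elim_comp_inl, Sum.elim_comp_inr, neg_neg, neg_eq_zero,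
    vec_neg, norm_neg, YepsCoeff, YCoeff]
  by_cases hn : n = 0
  · by_cases hm : m = 0
    · simp [hn, hm, vec_zero]
    · simp [hn, Ne.symm hm]
  by_cases hm : m = 0
  · simp [hn, hm]
  have hn' : (‖vec n‖ : ℂ) ≠ 0 := by
    have := one_le_norm_vec hn
    exact_mod_cast (by linarith : ‖vec n‖ ≠ 0)
  simp only [hn, hm, or_self, if_false, wickProd]
  by_cases h : n = m
  · subst h
    have h3 : mchar n x * (starRingEnd ℂ) (mchar n x) = 1 := by
      rw [Complex.mul_conj', norm_mchar]
      simp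
    have h4 : ((‖rho χ (ε • vec n)‖ : ℂ)) ^ 2 =
        rho χ (ε • vec n) * (starRingEnd ℂ) (rho χ (ε • vec n)) := (Complex.mul_conj' _).symm
    simp only [if_true, real_inner_self_eq_norm_sq, h4, map_mul, map_neg, map_div₀, map_pow,
      Complex.conj_ofReal]
    push_cast
    field_simp
    linear_combination ((rho χ (ε • vec n) * (starRingEnd ℂ) (rho χ (ε • vec n)))) * h3
  · have hm' : (‖vec m‖ : ℂ) ≠ 0 := by
      have := one_le_norm_vec hm
      exact_mod_cast (by linarith : ‖vec m‖ ≠ 0)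
    simp only [if_neg h, map_mul, map_neg, map_div₀, map_pow, Complex.conj_ofReal]
    field_simp
    ring

end WickDiagonal

/-! ### Convergence of the Wick square -/

section WickConvergence

variable {Ω : Type*} {χ : Plane → ℝ} {g : Freq → Ω → ℂ}

/-- The frequencies `n` such that `n` and `n + m` belong to the box of size `2^j`. -/
def pairBox (m : Freq) (j : ℕ) : Finset Freq :=
  open Classical in (mbox (Fin 2) (2 ^ j)).filter fun n => n + m ∈ mbox (Fin 2) (2 ^ j)

theorem tendsto_pairBox (m : Freq) : Tendsto (pairBox m) atTop atTop := by
  refine tendsto_atTop_finset_of_monotone (fun i j h n hn => ?_) fun n => ?_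
  · simp only [pairBox, Finset.mem_filter] at hn ⊢
    have h1 := mbox_mono (d := Fin 2) (Nat.pow_le_pow_right two_pos h)
    exact ⟨h1 hn.1, h1 hn.2⟩
  · obtain ⟨j, h1, h2⟩ := ((exists_mem_mbox n).and (exists_mem_mbox (n + m))).exists
    exact ⟨j, by simpa [pairBox] using ⟨h1, h2⟩⟩

theorem sum_wick_eq (g : Freq → Ω → ℂ) (ω : Ω) (m : Freq) (j : ℕ) :
    (∑ l ∈ mbox (Fin 2 ⊕ Fin 2) (2 ^ j), if l ∘ Sum.inl + l ∘ Sum.inr = m then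
      wickWeight l * quadNoise g l ω else 0) = ∑ n ∈ pairBox m j, wickTerm g m n ω := by
  classical
  rw [sum_mbox_pair, Finset.sum_comm, pairBox, Finset.sum_filter]
  refine Finset.sum_congr rfl fun k _ => ?_
  simp only [Sum.elim_comp_inl, Sum.elim_comp_inr, ← sub_eq_add_neg, sub_eq_iff_eq_add',
    eq_comm (b := k + m)]
  rw [Finset.sum_ite_eq, wickTerm_eq]

theorem renormConst_eq (χ : Plane → ℝ) (ε : ℝ) :
    renormConst χ ε = ∑' n : Freq, ‖rho χ (ε • vec n)‖ ^ 2 / ‖vec n‖ ^ 2 := by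
  refine tsum_subtype_eq_of_support_subset (f := fun n : Freq =>
    ‖rho χ (ε • vec n)‖ ^ 2 / ‖vec n‖ ^ 2) (s := {n : Freq | n ≠ 0}) fun n hn => ?_
  rintro rfl
  simp [vec_zero] at hn

theorem tendsto_wick_partial_sum {ε : ℝ} {ω : Ω}
    (hsum : Summable fun n : Freq => ‖gradCoeff (YepsCoeff χ g ε ω) n‖)
    (hrho : Summable fun n : Freq => ‖rho χ (ε • vec n)‖ ^ 2 / ‖vec n‖ ^ 2) (x : Torus) :
    Tendsto (fun j : ℕ => trigPoly (mbox (Fin 2 ⊕ Fin 2) (2 ^ j)) (fun l =>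
        (rho χ (ε • vec (l ∘ Sum.inl)) * rho χ (ε • vec (l ∘ Sum.inr))) *
          (wickWeight l * quadNoise g l ω)) (diag x)) atTop (𝓝 (wickSqEps χ g ε ω x)) := by
  simp only [← wick_partial_sum]
  refine (Complex.continuous_ofReal.tendsto _).comp
    (((tendsto_fourierSum hsum x).norm.pow 2).sub ?_)
  rw [renormConst_eq]
  exact hrho.hasSum.comp (tendsto_mbox_atTop _)

theorem norm_wick_partial_sum_le {ε : ℝ} {ω : Ω}
    (hsum : Summable fun n : Freq => ‖gradCoeff (YepsCoeff χ g ε ω) n‖)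
    (hrho : Summable fun n : Freq => ‖rho χ (ε • vec n)‖ ^ 2 / ‖vec n‖ ^ 2) (N : ℕ) (x : Torus) :
    ‖trigPoly (mbox (Fin 2 ⊕ Fin 2) N) (fun l =>
        (rho χ (ε • vec (l ∘ Sum.inl)) * rho χ (ε • vec (l ∘ Sum.inr))) *
          (wickWeight l * quadNoise g l ω)) (diag x)‖ ≤
      (∑' n, ‖gradCoeff (YepsCoeff χ g ε ω) n‖) ^ 2 +
        ∑' n : Freq, ‖rho χ (ε • vec n)‖ ^ 2 / ‖vec n‖ ^ 2 := by
  rw [← wick_partial_sum, Complex.norm_real]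
  refine (norm_sub_le _ _).trans (add_le_add ?_ ?_)
  · rw [norm_pow, norm_norm]
    have h1 := (norm_sum_character_smul_le (mbox (Fin 2) N) _ x).trans
      (hsum.sum_le_tsum _ fun _ _ => norm_nonneg _)
    gcongr
  · rw [Real.norm_of_nonneg (Finset.sum_nonneg fun _ _ => by positivity)]
    exact hrho.sum_le_tsum _ fun _ _ => by positivity

/-- A Hölder function of two points with the coefficients of `D^{-s}` of the Wick square, restricted
to the diagonal, has the coefficients of `D^{-s}` of the Wick square. -/
theorem IsHolderSeries.tendsto_coeff_diag {s θ C : ℝ} {d : (Fin 2 ⊕ Fin 2 → ℤ) → ℂ}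
    {V : MTorus (Fin 2 ⊕ Fin 2) → ℂ}
    (hV : IsHolderSeries (fun l =>
      ((bracket (l ∘ Sum.inl + l ∘ Sum.inr) ^ (-s) : ℝ) : ℂ) * d l) θ C V) (n : Freq) :
    Tendsto (fun j : ℕ => ((bracket n ^ (-s) : ℝ) : ℂ) *
      ∑ l ∈ mbox (Fin 2 ⊕ Fin 2) (2 ^ j), if l ∘ Sum.inl + l ∘ Sum.inr = n then d l else 0) atTop
      (𝓝 (coeff (fun x => V (diag x)) n)) := by
  have h1 := tendsto_coeff
    (fun j => (continuous_trigPoly (mbox (Fin 2 ⊕ Fin 2) (2 ^ j)) _).comp continuous_diag)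
    (fun j x => hV.bound j (diag x)) (fun x => hV.tendsto (diag x)) n
  refine h1.congr fun j => ?_
  refine (coeff_trigPoly_diag _ _ n).trans ?_
  rw [Finset.mul_sum]
  refine Finset.sum_congr rfl fun l _ => ?_
  split_ifs with h
  · rw [h]
  · simp

/-- The bound for `:|∇Y_ε|²:` in `W^{-s,q}` and its convergence to the distribution with coefficients
`W`, which are the limits of the partial sums over the sets `pairBox m j`. -/
theorem IsMollifier.wickSqEps_estimates (hχ : IsMollifier χ) {s θ : ℝ} (hθ : 0 < θ) {ω : Ω}
    {V : MTorus (Fin 2 ⊕ Fin 2) → ℂ} {C : ℝ}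
    (hV : IsHolderSeries (fun l : Fin 2 ⊕ Fin 2 → ℤ =>
      ((bracket (l ∘ Sum.inl + l ∘ Sum.inr) ^ (-s) : ℝ) : ℂ) *
        (wickWeight l * quadNoise g l ω)) θ C V)
    (hsum : ∀ ε ∈ Set.Ioo (0 : ℝ) 1, Summable fun n : Freq => ‖gradCoeff (YepsCoeff χ g ε ω) n‖)
    {W : Freq → ℂ} (hW : ∀ m z, Tendsto (fun j => ∑ n ∈ pairBox m j, wickTerm g m n ω) atTop (𝓝 z) →
      z = W m) :
    ∃ A : ℝ, ∀ ε ∈ Set.Ioo (0 : ℝ) 1, ∀ q : ℝ≥0∞, 1 ≤ q →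
      sobolevNorm (-s) q (coeff (wickSqEps χ g ε ω)) ≤ ENNReal.ofReal A ∧
      sobolevNorm (-s) q (fun n => coeff (wickSqEps χ g ε ω) n - W n) ≤
        ENNReal.ofReal (A * ε ^ θ) := by
  have hC := hV.nonneg
  set k : Plane × Plane → ℝ := fun p => χ p.1 * χ p.2 with hk
  set m := ∫ p, |k p| with hm
  have hm0 : 0 ≤ m := integral_nonneg fun _ => abs_nonneg _
  have hVdiag : Continuous fun x => V (diag x) := (hV.continuous hθ).comp continuous_diag
  -- the coefficients of the limit
  have hlim : ∀ n, coeff (fun x => V (diag x)) n = ((bracket n ^ (-s) : ℝ) : ℂ) * W n := by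
    intro n
    have h0 : ((bracket n ^ (-s) : ℝ) : ℂ) ≠ 0 := by
      exact_mod_cast (Real.rpow_pos_of_pos (bracket_pos n) _).ne'
    have h1 := (hV.tendsto_coeff_diag n).const_mul ((bracket n ^ (-s) : ℝ) : ℂ)⁻¹
    simp only [inv_mul_cancel_left₀ h0, sum_wick_eq] at h1
    rw [← hW n _ h1, mul_inv_cancel_left₀ h0]
  refine ⟨(2 * Real.pi) ^ 2 * (m * C), fun ε hε q hq => ?_⟩
  have hε0 := hε.1
  have hrho := hχ.summable_rho_sq hε
  have hser := hV.mollify hχ.integrable₂ (measurable_scaleShift₂ ε) hθ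
  have hUdiag : Continuous fun x => mollify volume k (scaleShift₂ ε) V (diag x) :=
    (hser.continuous hθ).comp continuous_diag
  -- the coefficients of the mollification
  have hcoef : ∀ n, coeff (fun x => mollify volume k (scaleShift₂ ε) V (diag x)) n =
      ((bracket n ^ (-s) : ℝ) : ℂ) * coeff (wickSqEps χ g ε ω) n := by
    intro n
    have e : (fun l : Fin 2 ⊕ Fin 2 → ℤ => mollifySymbol volume k (scaleShift₂ ε) l *
        (((bracket (l ∘ Sum.inl + l ∘ Sum.inr) ^ (-s) : ℝ) : ℂ) *
          (wickWeight l * quadNoise g l ω))) = fun l =>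
        ((bracket (l ∘ Sum.inl + l ∘ Sum.inr) ^ (-s) : ℝ) : ℂ) *
          ((rho χ (ε • vec (l ∘ Sum.inl)) * rho χ (ε • vec (l ∘ Sum.inr))) *
            (wickWeight l * quadNoise g l ω)) := by
      funext l
      rw [hk, mollifySymbol_scaleShift₂]
      ring
    have hser' := hser
    rw [e] at hser'
    have h1 := hser'.tendsto_coeff_diag n
    have h2 := tendsto_coeff
      (fun j => (continuous_trigPoly (mbox (Fin 2 ⊕ Fin 2) (2 ^ j)) _).comp continuous_diag)
      (fun j x => norm_wick_partial_sum_le (hsum ε hε) hrho (2 ^ j) x)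
      (tendsto_wick_partial_sum (hsum ε hε) hrho) n
    refine tendsto_nhds_unique h1 ((h2.const_mul _).congr fun j => ?_)
    congr 1
    exact coeff_trigPoly_diag _ _ n
  refine ⟨?_, ?_⟩
  · refine sobolevNorm_le hq hUdiag.aestronglyMeasurable (fun x => hser.norm_le (diag x)) hcoef
  · rw [mul_assoc]
    refine sobolevNorm_le hq (hUdiag.sub hVdiag).aestronglyMeasurable (M := m * C * ε ^ θ)
      (fun x => ?_) fun n => ?_
    · refine (norm_mollify_sub_le hχ.integrable₂ hχ.integral₂_eq_one (measurable_scaleShift₂ ε) hθ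
        hC hV.norm_le hV.holder (fun p hp => hχ.norm_scaleShift₂_le hε0.le hp) (diag x)).trans
        (le_of_eq ?_)
      rw [mul_assoc]
    · refine (coeff_sub hUdiag hVdiag n).trans ?_
      rw [hcoef, hlim, smul_eq_mul, mul_sub]

end WickConvergence

/-! ### Logarithmic bounds for the gradient -/

section LogBounds

theorem eLpNorm_natCast_pow {α E : Type*} [MeasurableSpace α] [NormedAddCommGroup E]
    {μ : Measure α} (f : α → E) {r : ℕ} (hr : r ≠ 0) :
    eLpNorm f r μ ^ r = ∫⁻ x, ‖f x‖ₑ ^ r ∂μ := by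
  have hr' : ((r : ℝ≥0) : ℝ≥0∞) = r := by simp
  have h := eLpNorm_nnreal_pow_eq_lintegral (μ := μ) (f := f) (p := (r : ℝ≥0))
    (by exact_mod_cast hr)
  simpa only [hr', NNReal.coe_natCast, ENNReal.rpow_natCast] using h

/-- Young's inequality for the convolution with a finite signed measure. -/
theorem eLpNorm_mollify_le {H : Type*} [MeasurableSpace H] {ν : Measure H} [SFinite ν]
    {d : Type*} [Fintype d] {k : H → ℝ}
    (hk : Measurable k) (hki : Integrable k ν) {τ : H → MTorus d} (hτ : Measurable τ)
    {V : MTorus d → ℂ} (hV : Continuous V) {r : ℕ} (hr : r ≠ 0) :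
    eLpNorm (mollify ν k τ V) r volume ≤ (∫⁻ h, ‖k h‖ₑ ∂ν) * eLpNorm V r volume := by
  set w : H → ℝ≥0∞ := fun h => ‖k h‖ₑ with hw
  have hwm : Measurable w := hk.enorm
  set μ := ν.withDensity w with hμ
  set m := ∫⁻ h, w h ∂ν with hm
  have hmtop : m ≠ ∞ := hki.2.ne
  have hμu : μ Set.univ = m := by rw [hμ, withDensity_apply _ MeasurableSet.univ, setLIntegral_univ]
  have hfin : IsFiniteMeasure μ := ⟨by rw [hμu]; exact hmtop.lt_top⟩
  have hVτ : ∀ x, Measurable fun h => V (x - τ h) := fun x =>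
    hV.measurable.comp (measurable_const.sub hτ)
  have h1 : ∀ x, ‖mollify ν k τ V x‖ₑ ≤ eLpNorm (fun h => V (x - τ h)) 1 μ := by
    intro x
    rw [eLpNorm_one_eq_lintegral_enorm, hμ,
      lintegral_withDensity_eq_lintegral_mul _ hwm (hVτ x).enorm]
    refine (enorm_integral_le_lintegral_enorm _).trans (le_of_eq ?_)
    refine lintegral_congr fun h => ?_
    rw [enorm_mul, Pi.mul_apply]
    congr 1
    change _ = ‖k h‖ₑ
    rw [← ofReal_norm, ← ofReal_norm, Complex.norm_real]
  have hr1 : (1 : ℝ≥0∞) ≤ r := by exact_mod_cast Nat.one_le_iff_ne_zero.2 hr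
  have hr0 : (r : ℝ) ≠ 0 := by exact_mod_cast hr
  have h2 : ∀ x, ‖mollify ν k τ V x‖ₑ ^ r ≤ m ^ (r - 1) * ∫⁻ h, ‖V (x - τ h)‖ₑ ^ r ∂μ := by
    intro x
    rw [← eLpNorm_natCast_pow _ hr]
    refine (pow_le_pow_left₀ (zero_le) ((h1 x).trans
      (eLpNorm_le_eLpNorm_mul_rpow_measure_univ hr1 (hVτ x).aestronglyMeasurable)) r).trans ?_
    rw [mul_pow, mul_comm, hμu]
    refine mul_le_mul_left ?_ _
    rw [← ENNReal.rpow_natCast, ← ENNReal.rpow_mul, ← ENNReal.rpow_natCast,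
      Nat.cast_sub (Nat.one_le_iff_ne_zero.2 hr)]
    refine le_of_eq ?_
    congr 1
    simp only [ENNReal.toReal_one, ENNReal.toReal_natCast]
    field_simp
    simp
  have hjoint : Measurable fun p : MTorus d × H => ‖V (p.1 - τ p.2)‖ₑ ^ r :=
    (hV.measurable.comp (measurable_fst.sub (hτ.comp measurable_snd))).enorm.pow_const r
  have h3 : eLpNorm (mollify ν k τ V) r volume ^ r ≤ (m * eLpNorm V r volume) ^ r := by
    rw [eLpNorm_natCast_pow _ hr, mul_pow, eLpNorm_natCast_pow _ hr]
    calc ∫⁻ x, ‖mollify ν k τ V x‖ₑ ^ r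
        ≤ ∫⁻ x, m ^ (r - 1) * ∫⁻ h, ‖V (x - τ h)‖ₑ ^ r ∂μ := lintegral_mono h2
      _ = m ^ (r - 1) * ∫⁻ h, (∫⁻ x, ‖V (x - τ h)‖ₑ ^ r) ∂μ := by
        rw [lintegral_const_mul _ hjoint.lintegral_prod_right',
          lintegral_lintegral_swap hjoint.aemeasurable]
      _ = m ^ (r - 1) * ∫⁻ _ : H, (∫⁻ x, ‖V x‖ₑ ^ r) ∂μ := by
        congr 1
        refine lintegral_congr fun h => ?_
        exact lintegral_sub_right_eq_self (fun x => ‖V x‖ₑ ^ r) (τ h)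
      _ = m ^ r * ∫⁻ x, ‖V x‖ₑ ^ r := by
        rw [lintegral_const, hμu, mul_comm (∫⁻ x, ‖V x‖ₑ ^ r), ← mul_assoc, ← pow_succ,
          Nat.sub_add_cancel (Nat.one_le_iff_ne_zero.2 hr)]
  exact (ENNReal.pow_le_pow_left_iff hr).1 h3

/-- The `L^{2k}` norms of the dyadic partial sums of `∇Y` grow at most linearly: their expected
`2k`-th powers are `O(J^k)`. -/
theorem IsWhiteNoise.ae_eLpNorm_grad_le {Ω : Type*} [MeasurableSpace Ω] {P : Measure Ω}
    {g : Freq → Ω → ℂ} [IsProbabilityMeasure P] (hg : IsWhiteNoise P g) {k : ℕ} (hk : 2 ≤ k) :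
    ∀ᵐ ω ∂P, ∀ i, ∃ M : ℝ, 1 ≤ M ∧ ∀ J : ℕ,
      eLpNorm (trigPoly (mbox (Fin 2) (2 ^ J)) fun n => gradCoeff (YCoeff g ω) n i)
        (2 * k : ℕ) volume ≤ ENNReal.ofReal (M * (J + 1)) := by
  rw [ae_all_iff]
  intro i
  set a : Freq → ℂ := fun n => Complex.I * n i * -((‖vec n‖ : ℂ) ^ 2)⁻¹ with ha
  have e : ∀ ω, (fun n => gradCoeff (YCoeff g ω) n i) = fun n => a n * linNoise g n ω := by
    intro ω
    funext n
    simp only [gradCoeff, YCoeff_eq, ha]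
    ring
  simp only [e]
  have han : ∀ n, ‖a n‖ ^ 2 ≤ (‖vec n‖ ^ 2)⁻¹ := by
    intro n
    have h4 : |(n i : ℝ)| ≤ ‖vec n‖ := by simpa [vec] using abs_apply_le_norm (vec n) i
    rw [ha, norm_mul, norm_mul, norm_neg, norm_inv, norm_pow, Complex.norm_real, norm_norm,
      Complex.norm_I, one_mul, Complex.norm_intCast]
    by_cases hn : n = 0
    · simp [hn, vec_zero]
    · have h5 := one_le_norm_vec hn
      calc (|(n i : ℝ)| * (‖vec n‖ ^ 2)⁻¹) ^ 2 ≤ (‖vec n‖ * (‖vec n‖ ^ 2)⁻¹) ^ 2 := by gcongr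
        _ = (‖vec n‖ ^ 2)⁻¹ := by field_simp
  obtain ⟨C, hC, hmom⟩ := hg.hasChaosMoments_linNoise.moment k (by omega)
  have hmeas := hg.hasChaosMoments_linNoise.aemeasurable
  set I : ℕ → Ω → ℝ≥0∞ := fun J ω => ∫⁻ x : Torus,
    ‖trigPoly (mbox (Fin 2) (2 ^ J)) (fun n => a n * linNoise g n ω) x‖ₑ ^ (2 * k) with hI
  have hIm : ∀ J, AEMeasurable (I J) P := fun J =>
    ((aemeasurable_trigPoly_prod hmeas _ a).enorm.pow_const _).lintegral_prod_right'
  have hw : Summable fun J : ℕ => (((J : ℝ) + 1) ^ 2)⁻¹ := by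
    have := (summable_nat_add_iff 1).2 (Real.summable_nat_pow_inv.2 one_lt_two)
    simpa using this
  -- the expectation of the `2k`-th power is `O((J+1)^k)`; two more powers make it summable in `J`
  have hbd := ae_exists_bound (P := P)
    (F := fun (J : ℕ) ω => ENNReal.ofReal (((J : ℝ) + 1) ^ (k + 2))⁻¹ * I J ω)
    (fun J => (hIm J).const_mul _) (w := fun J : ℕ => (((J : ℝ) + 1) ^ 2)⁻¹)
    (fun J => by positivity) hw
    (C := ENNReal.ofReal (2 * Real.pi) ^ Fintype.card (Fin 2) * (C * ENNReal.ofReal 25 ^ k))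
    (by finiteness) (fun J => by
      rw [lintegral_const_mul'' _ (hIm J)]
      have h1 := lintegral_lintegral_trigPoly_le hmeas hmom (mbox (Fin 2) (2 ^ J)) a
      have h2 : ∑ n ∈ mbox (Fin 2) (2 ^ J), ‖a n‖ₑ ^ 2 ≤ ENNReal.ofReal (25 * (J + 1)) := by
        rw [sum_enorm_sq_eq_ofReal]
        exact ENNReal.ofReal_le_ofReal
          ((Finset.sum_le_sum fun n _ => han n).trans (sum_inv_norm_sq_le J))
      have h3 : (((J : ℝ) + 1) ^ 2)⁻¹ = (((J : ℝ) + 1) ^ (k + 2))⁻¹ * (J + 1) ^ k := by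
        rw [pow_add]
        field_simp
      calc ENNReal.ofReal (((J : ℝ) + 1) ^ (k + 2))⁻¹ * ∫⁻ ω, I J ω ∂P
          ≤ ENNReal.ofReal (((J : ℝ) + 1) ^ (k + 2))⁻¹ *
            (ENNReal.ofReal (2 * Real.pi) ^ Fintype.card (Fin 2) *
              (C * ENNReal.ofReal (25 * (J + 1)) ^ k)) := by
            gcongr
            exact h1.trans (by gcongr)
        _ = _ := by
            have h4 : ENNReal.ofReal (25 * ((J : ℝ) + 1)) =
                ENNReal.ofReal 25 * ENNReal.ofReal ((J : ℝ) + 1) :=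
              ENNReal.ofReal_mul (by norm_num)
            have h5 : ENNReal.ofReal (((J : ℝ) + 1) ^ 2)⁻¹ =
                ENNReal.ofReal (((J : ℝ) + 1) ^ (k + 2))⁻¹ * ENNReal.ofReal ((J : ℝ) + 1) ^ k := by
              rw [h3, ENNReal.ofReal_mul (by positivity), ENNReal.ofReal_pow (by positivity)]
            rw [h4, h5, mul_pow]
            ring)
  filter_upwards [hbd] with ω ⟨M, hM1, hM⟩
  refine ⟨M, hM1, fun J => ?_⟩
  refine (ENNReal.pow_le_pow_left_iff (n := 2 * k) (by omega)).1 ?_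
  rw [eLpNorm_natCast_pow _ (by omega), ← ENNReal.ofReal_pow (by positivity)]
  have hJ : (1 : ℝ) ≤ J + 1 := by
    have : (0 : ℝ) ≤ J := Nat.cast_nonneg J
    linarith
  calc I J ω = ENNReal.ofReal (((J : ℝ) + 1) ^ (k + 2)) *
        (ENNReal.ofReal (((J : ℝ) + 1) ^ (k + 2))⁻¹ * I J ω) := by
        rw [← mul_assoc, ← ENNReal.ofReal_mul (by positivity), mul_inv_cancel₀ (by positivity)]
        simp
    _ ≤ ENNReal.ofReal (((J : ℝ) + 1) ^ (k + 2)) * ENNReal.ofReal M := by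
        gcongr
        exact hM J
    _ ≤ ENNReal.ofReal ((M * (J + 1)) ^ (2 * k)) := by
        rw [← ENNReal.ofReal_mul (by positivity), mul_pow, mul_comm]
        refine ENNReal.ofReal_le_ofReal ?_
        have h1 : M ≤ M ^ (2 * k) := le_self_pow₀ hM1 (by omega)
        have h2 : ((J : ℝ) + 1) ^ (k + 2) ≤ (J + 1) ^ (2 * k) := pow_le_pow_right₀ hJ (by omega)
        gcongr

variable {Ω : Type*} {χ : Plane → ℝ} {g : Freq → Ω → ℂ}

/-- The number `J` of dyadic scales used at the mollification scale `ε`. Frequencies above `ε⁻²`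
are strongly damped by the mollifier, and there are `O(|ln ε|)` scales below. -/
theorem exists_dyadic_scale {ε : ℝ} (hε : ε ∈ Set.Ioo (0 : ℝ) 1) :
    ∃ J : ℕ, 1 ≤ ε ^ 2 * 2 ^ J ∧ (J : ℝ) + 1 ≤ 3 * (1 + |Real.log ε|) := by
  have hl : Real.log ε < 0 := Real.log_neg hε.1 hε.2
  have h2 : 0.69 < Real.log 2 := lt_trans (by norm_num) Real.log_two_gt_d9
  have h20 : 0 < Real.log 2 := by linarith
  refine ⟨⌈2 * |Real.log ε| / Real.log 2⌉₊, ?_, ?_⟩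
  · have h3 := Nat.le_ceil (2 * |Real.log ε| / Real.log 2)
    rw [div_le_iff₀ h20, abs_of_neg hl] at h3
    rw [abs_of_neg hl]
    set J := ⌈2 * -Real.log ε / Real.log 2⌉₊
    have h4 : 0 ≤ Real.log (ε ^ 2 * 2 ^ J) := by
      rw [Real.log_mul (by have := hε.1; positivity) (by positivity), Real.log_pow, Real.log_pow]
      push_cast
      linarith
    have h5 : 0 < ε ^ 2 * 2 ^ J := by
      have := hε.1
      positivity
    exact (Real.log_nonneg_iff h5).1 h4
  · have h3 := Nat.ceil_lt_add_one (a := 2 * |Real.log ε| / Real.log 2) (by positivity)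
    have h4 : 2 * |Real.log ε| / Real.log 2 ≤ 3 * |Real.log ε| := by
      rw [div_le_iff₀ h20]
      nlinarith [abs_nonneg (Real.log ε)]
    linarith

/-- Above the frequency `ε⁻²` the product `ε⟨n⟩` is at least `⟨n⟩^{1/2}`, so that `ρ(εn)` is small
uniformly in `ε`. -/
theorem IsMollifier.exists_rho_tail (hχ : IsMollifier χ) : ∃ C, 0 < C ∧ ∀ ε ∈ Set.Ioo (0 : ℝ) 1,
    ∀ (J : ℕ), 1 ≤ ε ^ 2 * 2 ^ J → ∀ n ∉ mbox (Fin 2) (2 ^ J),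
      ‖rho χ (ε • vec n)‖ ≤ C * (bracket n ^ 6)⁻¹ := by
  obtain ⟨C, hC0, hC⟩ := hχ.exists_rho_smul_le 12
  refine ⟨C, hC0, fun ε hε J hJ n hn => ?_⟩
  have h0 := hε.1
  have hb := bracket_pos n
  have h1 : (2 : ℝ) ^ J ≤ bracket n := by
    refine le_trans ?_ (norm_freq_le_bracket n)
    rw [mem_mbox] at hn
    push Not at hn
    obtain ⟨i, hi⟩ := hn
    have h2 : ((2 ^ J : ℕ) : ℝ) ≤ |(n i : ℝ)| := by exact_mod_cast hi.le
    have h3 := norm_le_pi_norm n i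
    rw [Int.norm_eq_abs] at h3
    push_cast at h2
    exact h2.trans h3
  have h2 : 1 ≤ ε ^ 2 * bracket n := hJ.trans (by gcongr)
  have h3 : bracket n ^ 6 ≤ (ε * bracket n) ^ 12 := by
    have : (ε * bracket n) ^ 12 = (ε ^ 2 * bracket n) ^ 6 * bracket n ^ 6 := by ring
    rw [this]
    exact le_mul_of_one_le_left (by positivity) (one_le_pow₀ h2)
  rw [← div_eq_mul_inv, le_div_iff₀ (by positivity)]
  refine le_trans ?_ (hC ε hε n)
  gcongr

theorem sum_mbox_le_of_tail {f w : Freq → ℝ} {J : ℕ} {B : ℝ} (hw0 : ∀ n, 0 ≤ w n)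
    (hw : Summable w) (hB : ∑ n ∈ mbox (Fin 2) (2 ^ J), f n ≤ B)
    (h : ∀ n ∉ mbox (Fin 2) (2 ^ J), f n ≤ w n) {j : ℕ} (hj : J ≤ j) :
    ∑ n ∈ mbox (Fin 2) (2 ^ j), f n ≤ B + ∑' n, w n := by
  classical
  rw [← Finset.sum_sdiff (mbox_mono (d := Fin 2) (Nat.pow_le_pow_right two_pos hj)), add_comm]
  refine add_le_add hB ?_
  exact (Finset.sum_le_sum fun n hn => h n (Finset.mem_sdiff.1 hn).2).trans
    (hw.sum_le_tsum _ fun n _ => hw0 n)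

/-- The renormalization constant diverges at most logarithmically. -/
theorem IsMollifier.exists_renormConst_le (hχ : IsMollifier χ) :
    ∃ A, 0 ≤ A ∧ ∀ ε ∈ Set.Ioo (0 : ℝ) 1, renormConst χ ε ≤ A * (1 + |Real.log ε|) := by
  obtain ⟨C, hC0, hC⟩ := hχ.exists_rho_tail
  set m := ∫ x, |χ x| with hm
  have hm0 : 0 ≤ m := integral_nonneg fun _ => abs_nonneg _
  set w : Freq → ℝ := fun n => C ^ 2 * bracket n ^ (-12 : ℝ) with hw
  have hws : Summable w := (summable_bracket_rpow (by norm_num)).mul_left _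
  have hw0 : ∀ n, 0 ≤ w n := fun n => by
    have := bracket_pos n
    positivity
  have hS : 0 ≤ ∑' n, w n := tsum_nonneg hw0
  refine ⟨75 * m ^ 2 + ∑' n, w n, by positivity, fun ε hε => ?_⟩
  obtain ⟨J, hJ1, hJ2⟩ := exists_dyadic_scale hε
  rw [renormConst_eq]
  have hlim := (hχ.summable_rho_sq hε).hasSum.comp (tendsto_mbox_atTop (Fin 2))
  have hbound : ∑ n ∈ mbox (Fin 2) (2 ^ J), ‖rho χ (ε • vec n)‖ ^ 2 / ‖vec n‖ ^ 2 ≤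
      m ^ 2 * (25 * (J + 1)) := by
    refine le_trans ?_ (mul_le_mul_of_nonneg_left (sum_inv_norm_sq_le J) (by positivity))
    rw [Finset.mul_sum]
    refine Finset.sum_le_sum fun n _ => ?_
    rw [div_eq_mul_inv]
    have := norm_rho_le χ (ε • vec n)
    gcongr
  have htail : ∀ n ∉ mbox (Fin 2) (2 ^ J), ‖rho χ (ε • vec n)‖ ^ 2 / ‖vec n‖ ^ 2 ≤ w n := by
    intro n hn
    have hb := bracket_pos n
    have hn0 : n ≠ 0 := by
      rintro rfl
      exact hn (mem_mbox.2 (by simp))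
    have h1 := hC ε hε J hJ1 n hn
    have h3 : bracket n ^ (-12 : ℝ) = (bracket n ^ 12)⁻¹ := by
      rw [Real.rpow_neg hb.le]
      congr 1
      exact_mod_cast Real.rpow_natCast _ 12
    calc ‖rho χ (ε • vec n)‖ ^ 2 / ‖vec n‖ ^ 2 ≤ ‖rho χ (ε • vec n)‖ ^ 2 :=
          div_le_self (by positivity) (one_le_pow₀ (one_le_norm_vec hn0))
      _ ≤ (C * (bracket n ^ 6)⁻¹) ^ 2 := by gcongr
      _ = w n := by
        rw [hw]
        simp only [h3]
        field_simp
  have hle := le_of_tendsto hlim ((eventually_ge_atTop J).mono fun j hj =>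
    sum_mbox_le_of_tail hw0 hws hbound htail hj)
  refine hle.trans ?_
  have hL : 1 ≤ 1 + |Real.log ε| := le_add_of_nonneg_right (abs_nonneg _)
  have h4 : m ^ 2 * (25 * (J + 1)) ≤ 75 * m ^ 2 * (1 + |Real.log ε|) := by nlinarith [sq_nonneg m]
  have h5 : ∑' n, w n ≤ (∑' n, w n) * (1 + |Real.log ε|) := le_mul_of_one_le_right hS hL
  rw [add_mul]
  exact add_le_add h4 h5

end LogBounds

section LogEstimates

variable {Ω : Type*} {χ : Plane → ℝ} {g : Freq → Ω → ℂ}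

theorem norm_cvec_le_add (v : CVec) : ‖v‖ ≤ ‖v 0‖ + ‖v 1‖ := by
  refine abs_le_of_sq_le_sq' ?_ (by positivity) |>.2
  rw [EuclideanSpace.norm_sq_eq, Fin.sum_univ_two]
  nlinarith [mul_nonneg (norm_nonneg (v 0)) (norm_nonneg (v 1))]

/-- The contribution of the high frequencies to `∇Y_ε` is bounded, uniformly in `ε`. -/
theorem IsMollifier.exists_gradYeps_tail (hχ : IsMollifier χ) {M : ℝ} (hM : 0 ≤ M) {ω : Ω}
    (hg : ∀ n, n ≠ 0 → ‖g n ω‖ ≤ M * bracket n ^ 2) :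
    ∃ B, 0 ≤ B ∧ ∀ ε ∈ Set.Ioo (0 : ℝ) 1, ∀ J : ℕ, 1 ≤ ε ^ 2 * 2 ^ J → ∀ x,
      ‖gradYeps χ g ε ω x -
        ∑ n ∈ mbox (Fin 2) (2 ^ J), character n x • gradCoeff (YepsCoeff χ g ε ω) n‖ ≤ B := by
  classical
  obtain ⟨C, hC0, hC⟩ := hχ.exists_rho_tail
  set w : Freq → ℝ := fun n => C * M * bracket n ^ (-3 : ℝ) with hw
  have hws : Summable w := (summable_bracket_rpow (by norm_num)).mul_left _
  have hw0 : ∀ n, 0 ≤ w n := fun n => by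
    have := bracket_pos n
    positivity
  refine ⟨∑' n, w n, tsum_nonneg hw0, fun ε hε J hJ x => ?_⟩
  have htail : ∀ n ∉ mbox (Fin 2) (2 ^ J), ‖gradCoeff (YepsCoeff χ g ε ω) n‖ ≤ w n := by
    intro n hn
    have hb := bracket_pos n
    have h1 := hC ε hε J hJ n hn
    have h2 := norm_YCoeff_le hM hg n
    have h4 := norm_vec_le_bracket n
    have h3 : bracket n ^ (-3 : ℝ) = (bracket n ^ 3)⁻¹ := by
      rw [Real.rpow_neg hb.le]
      congr 1
      exact_mod_cast Real.rpow_natCast _ 3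
    rw [norm_gradCoeff, YepsCoeff, norm_mul]
    calc ‖vec n‖ * (‖rho χ (ε • vec n)‖ * ‖YCoeff g ω n‖)
        ≤ bracket n * ((C * (bracket n ^ 6)⁻¹) * (M * bracket n ^ 2)) := by gcongr
      _ = w n := by
        rw [hw]
        simp only [h3]
        field_simp
  have hlim := ((tendsto_fourierSum (hχ.summable_norm_gradCoeff hM hg hε) x).sub_const
    (∑ n ∈ mbox (Fin 2) (2 ^ J), character n x • gradCoeff (YepsCoeff χ g ε ω) n)).norm
  refine le_of_tendsto hlim ((eventually_ge_atTop J).mono fun j hj => ?_)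
  rw [← Finset.sum_sdiff (mbox_mono (d := Fin 2) (Nat.pow_le_pow_right two_pos hj)),
    add_sub_cancel_right]
  refine (norm_sum_character_smul_le _ _ x).trans ?_
  exact (Finset.sum_le_sum fun n hn => htail n (Finset.mem_sdiff.1 hn).2).trans
    (hws.sum_le_tsum _ fun n _ => hw0 n)

theorem IsMollifier.eLpNorm_gradYeps_le (hχ : IsMollifier χ) {M : ℝ} (hM : 0 ≤ M) {ω : Ω}
    (hg : ∀ n, n ≠ 0 → ‖g n ω‖ ≤ M * bracket n ^ 2) {r : ℕ} (hr : r ≠ 0)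
    (hT : ∀ i, ∃ N : ℝ, 1 ≤ N ∧ ∀ J : ℕ,
      eLpNorm (trigPoly (mbox (Fin 2) (2 ^ J)) fun n => gradCoeff (YCoeff g ω) n i)
        r volume ≤ ENNReal.ofReal (N * (J + 1))) :
    ∃ A : ℝ, 0 ≤ A ∧ ∀ ε ∈ Set.Ioo (0 : ℝ) 1,
      eLpNorm (gradYeps χ g ε ω) r volume ≤ ENNReal.ofReal (A * (1 + |Real.log ε|)) := by
  obtain ⟨B, hB0, hB⟩ := hχ.exists_gradYeps_tail hM hg
  choose N hN1 hN using hT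
  have hN0 : ∀ i, 0 ≤ N i := fun i => zero_le_one.trans (hN1 i)
  set m := ∫ x, ‖χ x‖ with hm
  have hm0 : 0 ≤ m := integral_nonneg fun _ => norm_nonneg _
  have hmm : ENNReal.ofReal m = ∫⁻ x, ‖χ x‖ₑ :=
    ofReal_integral_norm_eq_lintegral_enorm hχ.integrable
  have h01 := hN0 0
  have h02 := hN0 1
  refine ⟨3 * (m * (N 0 + N 1)) + (2 * Real.pi) ^ 2 * B, by positivity, fun ε hε => ?_⟩
  obtain ⟨J, hJ1, hJ2⟩ := exists_dyadic_scale hε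
  set T : Fin 2 → Torus → ℂ := fun i =>
    trigPoly (mbox (Fin 2) (2 ^ J)) fun n => gradCoeff (YCoeff g ω) n i with hTdef
  -- the components of the low frequency part of `∇Y_ε`
  set U : Fin 2 → Torus → ℂ := fun i => mollify volume χ (scaleShift ε) (T i) with hU
  have hUc : ∀ i, U i = trigPoly (mbox (Fin 2) (2 ^ J)) (fun n =>
      mollifySymbol volume χ (scaleShift ε) n * gradCoeff (YCoeff g ω) n i) := fun i =>
    funext fun x => mollify_trigPoly hχ.integrable (measurable_scaleShift ε) _ _ x
  have hUcont : ∀ i, Continuous (U i) := fun i => by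
    rw [hUc]
    exact continuous_trigPoly _ _
  have hUe : ∀ i x, (∑ n ∈ mbox (Fin 2) (2 ^ J),
      character n x • gradCoeff (YepsCoeff χ g ε ω) n) i = U i x := by
    intro i x
    rw [hUc, trigPoly_eq_sum_character, WithLp.ofLp_sum, Finset.sum_apply]
    refine Finset.sum_congr rfl fun n _ => ?_
    rw [mollifySymbol_scaleShift]
    simp only [PiLp.smul_apply, gradCoeff, YepsCoeff, smul_eq_mul]
    ring
  have hpt : ∀ x, ‖gradYeps χ g ε ω x‖ ≤ ‖U 0 x‖ + ‖U 1 x‖ + B := by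
    intro x
    have h1 := hB ε hε J hJ1 x
    have h2 := norm_cvec_le_add (∑ n ∈ mbox (Fin 2) (2 ^ J),
      character n x • gradCoeff (YepsCoeff χ g ε ω) n)
    rw [hUe, hUe] at h2
    have h3 := norm_le_norm_add_norm_sub' (gradYeps χ g ε ω x) (∑ n ∈ mbox (Fin 2) (2 ^ J),
      character n x • gradCoeff (YepsCoeff χ g ε ω) n)
    linarith
  have hr1 : (1 : ℝ≥0∞) ≤ r := by exact_mod_cast Nat.one_le_iff_ne_zero.2 hr
  have hUn : ∀ i, eLpNorm (fun x => ‖U i x‖) r volume ≤ ENNReal.ofReal (m * (N i * (J + 1))) := by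
    intro i
    rw [eLpNorm_norm, ENNReal.ofReal_mul hm0, hmm]
    refine (eLpNorm_mollify_le hχ.continuous.measurable hχ.integrable (measurable_scaleShift ε)
      (continuous_trigPoly _ _) hr).trans ?_
    gcongr
    exact hN i J
  calc eLpNorm (gradYeps χ g ε ω) r volume
      ≤ eLpNorm (fun x => (‖U 0 x‖ + ‖U 1 x‖) + B) r volume := eLpNorm_mono_real hpt
    _ ≤ eLpNorm (fun x => ‖U 0 x‖ + ‖U 1 x‖) r volume + eLpNorm (fun _ : Torus => B) r volume :=
        eLpNorm_add_le ((hUcont 0).norm.add (hUcont 1).norm).aestronglyMeasurable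
          aestronglyMeasurable_const hr1
    _ ≤ (eLpNorm (fun x => ‖U 0 x‖) r volume + eLpNorm (fun x => ‖U 1 x‖) r volume) +
          eLpNorm (fun _ : Torus => B) r volume := by
        gcongr
        exact eLpNorm_add_le (hUcont 0).norm.aestronglyMeasurable
          (hUcont 1).norm.aestronglyMeasurable hr1
    _ ≤ (ENNReal.ofReal (m * (N 0 * (J + 1))) + ENNReal.ofReal (m * (N 1 * (J + 1)))) +
          ENNReal.ofReal ((2 * Real.pi) ^ 2 * B) := by
        gcongr
        · exact hUn 0
        · exact hUn 1
        · exact eLpNorm_le_of_bounded hr1 fun x => (Real.norm_of_nonneg hB0).le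
    _ ≤ _ := by
        rw [← ENNReal.ofReal_add (by positivity) (by positivity),
          ← ENNReal.ofReal_add (by positivity) (by positivity)]
        refine ENNReal.ofReal_le_ofReal ?_
        have hL : 1 ≤ 1 + |Real.log ε| := le_add_of_nonneg_right (abs_nonneg _)
        have h1 : m * (N 0 + N 1) * (J + 1) ≤ m * (N 0 + N 1) * (3 * (1 + |Real.log ε|)) := by
          gcongr
        have h2 : (2 * Real.pi) ^ 2 * B ≤ (2 * Real.pi) ^ 2 * B * (1 + |Real.log ε|) :=
          le_mul_of_one_le_right (by positivity) hL
        nlinarith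

/-- The bounds for `∇Y_ε` and its renormalized square in `L^q`, with the logarithmic divergence. -/
theorem IsMollifier.log_estimates (hχ : IsMollifier χ) {M : ℝ} (hM : 0 ≤ M) {ω : Ω}
    (hg : ∀ n, n ≠ 0 → ‖g n ω‖ ≤ M * bracket n ^ 2) {q : ℝ≥0∞} (hq : 1 ≤ q) {r : ℕ}
    (hqr : q * 2 ≤ r) (hT : ∀ i, ∃ N : ℝ, 1 ≤ N ∧ ∀ J : ℕ,
      eLpNorm (trigPoly (mbox (Fin 2) (2 ^ J)) fun n => gradCoeff (YCoeff g ω) n i)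
        r volume ≤ ENNReal.ofReal (N * (J + 1))) :
    ∃ A : ℝ, 0 ≤ A ∧ ∀ ε ∈ Set.Ioo (0 : ℝ) 1,
      eLpNorm (gradYeps χ g ε ω) q volume ≤ ENNReal.ofReal (A * (1 + |Real.log ε|)) ∧
      eLpNorm (wickSqEps χ g ε ω) q volume ≤ ENNReal.ofReal (A * (1 + |Real.log ε|) ^ 2) := by
  have hr : r ≠ 0 := by
    rintro rfl
    have : (1 : ℝ≥0∞) ≤ q * 2 := hq.trans (le_mul_of_one_le_right (zero_le) one_le_two)
    simpa using this.trans hqr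
  have hqtop : q ≠ ∞ := by
    rintro rfl
    simp at hqr
  obtain ⟨A, hA0, hA⟩ := hχ.eLpNorm_gradYeps_le hM hg hr hT
  obtain ⟨A', hA'0, hA'⟩ := hχ.exists_renormConst_le
  -- comparison of the exponents on a space of finite measure
  have hcomp : ∀ p : ℝ≥0∞, 1 ≤ p → p ≤ r → ∃ D : ℝ, 0 ≤ D ∧ ∀ ε ∈ Set.Ioo (0 : ℝ) 1,
      eLpNorm (gradYeps χ g ε ω) p volume ≤ ENNReal.ofReal (D * (1 + |Real.log ε|)) := by
    intro p hp1 hp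
    set D := (volume : Measure Torus) Set.univ ^ (1 / p.toReal - 1 / (r : ℝ≥0∞).toReal) with hD
    have hDtop : D ≠ ∞ := by
      refine (ENNReal.rpow_lt_top_of_nonneg ?_ (measure_ne_top _ _)).ne
      have h1 : 0 < p.toReal :=
        ENNReal.toReal_pos (zero_lt_one.trans_le hp1).ne' (ne_top_of_le_ne_top (by simp) hp)
      have h2 : p.toReal ≤ (r : ℝ≥0∞).toReal := ENNReal.toReal_mono (by simp) hp
      exact sub_nonneg.2 (one_div_le_one_div_of_le h1 h2)
    refine ⟨A * D.toReal, by positivity, fun ε hε => ?_⟩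
    refine (eLpNorm_le_eLpNorm_mul_rpow_measure_univ hp (continuous_fourierSum
      (hχ.summable_norm_gradCoeff hM hg hε)).aestronglyMeasurable).trans ?_
    rw [← hD, mul_right_comm, ENNReal.ofReal_mul (by positivity), ENNReal.ofReal_toReal hDtop]
    gcongr
    exact hA ε hε
  obtain ⟨D₁, hD₁0, hD₁⟩ := hcomp q hq
    ((le_mul_of_one_le_right (zero_le) one_le_two).trans hqr)
  obtain ⟨D₂, hD₂0, hD₂⟩ := hcomp (q * 2)
    (hq.trans (le_mul_of_one_le_right (zero_le) one_le_two)) hqr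
  refine ⟨D₁ + D₂ ^ 2 + (2 * Real.pi) ^ 2 * A', by positivity, fun ε hε => ⟨?_, ?_⟩⟩
  · refine (hD₁ ε hε).trans (ENNReal.ofReal_le_ofReal ?_)
    have : 0 ≤ D₂ ^ 2 + (2 * Real.pi) ^ 2 * A' := by positivity
    gcongr
    linarith
  · have hsum := hχ.summable_norm_gradCoeff hM hg hε
    have hcont := continuous_fourierSum hsum
    have hL : 1 ≤ 1 + |Real.log ε| := le_add_of_nonneg_right (abs_nonneg _)
    have hR0 : 0 ≤ renormConst χ ε := tsum_nonneg fun _ => by positivity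
    have hpt : ∀ x, ‖wickSqEps χ g ε ω x‖ ≤ ‖gradYeps χ g ε ω x‖ ^ (2 : ℝ) + renormConst χ ε := by
      intro x
      rw [wickSqEps, Complex.norm_real]
      refine (norm_sub_le _ _).trans (le_of_eq ?_)
      rw [norm_pow, norm_norm, Real.norm_of_nonneg hR0, Real.rpow_two]
    have hsq : eLpNorm (fun x => ‖gradYeps χ g ε ω x‖ ^ (2 : ℝ)) q volume ≤
        ENNReal.ofReal (D₂ ^ 2 * (1 + |Real.log ε|) ^ 2) := by
      rw [eLpNorm_norm_rpow _ two_pos, ENNReal.ofReal_ofNat, ENNReal.rpow_two, ← mul_pow,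
        ENNReal.ofReal_pow (by positivity)]
      gcongr
      exact hD₂ ε hε
    calc eLpNorm (wickSqEps χ g ε ω) q volume
        ≤ eLpNorm (fun x => ‖gradYeps χ g ε ω x‖ ^ (2 : ℝ) + renormConst χ ε) q volume :=
          eLpNorm_mono_real hpt
      _ ≤ eLpNorm (fun x => ‖gradYeps χ g ε ω x‖ ^ (2 : ℝ)) q volume +
            eLpNorm (fun _ : Torus => renormConst χ ε) q volume :=
          eLpNorm_add_le (hcont.norm.rpow_const fun _ => Or.inr two_pos.le).aestronglyMeasurable
            aestronglyMeasurable_const hq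
      _ ≤ ENNReal.ofReal (D₂ ^ 2 * (1 + |Real.log ε|) ^ 2) +
            ENNReal.ofReal ((2 * Real.pi) ^ 2 * renormConst χ ε) := by
          gcongr
          exact eLpNorm_le_of_bounded hq fun x => (Real.norm_of_nonneg hR0).le
      _ ≤ _ := by
          rw [← ENNReal.ofReal_add (by positivity) (by positivity)]
          refine ENNReal.ofReal_le_ofReal ?_
          have h1 : renormConst χ ε ≤ A' * (1 + |Real.log ε|) ^ 2 :=
            (hA' ε hε).trans (mul_le_mul_of_nonneg_left (le_self_pow₀ hL two_ne_zero) hA'0)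
          have h2 : (2 * Real.pi) ^ 2 * renormConst χ ε ≤
              (2 * Real.pi) ^ 2 * (A' * (1 + |Real.log ε|) ^ 2) := by gcongr
          have h3 : 0 ≤ D₁ * (1 + |Real.log ε|) ^ 2 := by positivity
          linarith

end LogEstimates

/-! ### The almost sure estimates -/

theorem lt_ofReal_mul_of_le {x : ℝ≥0∞} {A C w w' : ℝ} (h : x ≤ ENNReal.ofReal (A * w))
    (hw : 0 ≤ w) (hww : w ≤ w') (hw' : 0 < w') (hAC : |A| < C) : x < ENNReal.ofReal (C * w') := by
  refine h.trans_lt ?_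
  have h1 : A * w ≤ |A| * w' :=
    (mul_le_mul_of_nonneg_right (le_abs_self A) hw).trans
      (mul_le_mul_of_nonneg_left hww (abs_nonneg A))
  have h2 : |A| * w' < C * w' := mul_lt_mul_of_pos_right hAC hw'
  have h3 : 0 < C * w' := mul_pos ((abs_nonneg A).trans_lt hAC) hw'
  exact (ENNReal.ofReal_lt_ofReal_iff h3).2 (h1.trans_lt h2)

theorem lt_ofReal_of_le {x : ℝ≥0∞} {A C : ℝ} (h : x ≤ ENNReal.ofReal A) (hAC : |A| < C) :
    x < ENNReal.ofReal C := by
  have := lt_ofReal_mul_of_le (w := 1) (w' := 1) (by simpa using h) zero_le_one le_rfl one_pos hAC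
  simpa using this

end WhiteNoiseNLS

end

open WhiteNoiseNLS in
theorem mainTheorem5 {Ω : Type*} [MeasurableSpace Ω] (P : Measure Ω) [IsProbabilityMeasure P]
    (g : Freq → Ω → ℂ) (hg : IsWhiteNoise P g) (χ : Plane → ℝ) (hχ : IsMollifier χ)
    (s : ℝ) (hs : s ∈ Set.Ioo (0 : ℝ) 1) (q : ℝ≥0∞) (hq : 1 < q) (hq' : q < ∞) :
    ∃ W : Ω → Freq → ℂ, IsWickSq P g W ∧
    ∃ κ : ℝ, 0 < κ ∧
    ∃ S : Set Ω, MeasurableSet S ∧ P S = 1 ∧ ∀ ω ∈ S,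
      -- the series defining `Y_ε`, `∇Y_ε` and `C_ε` have rapidly decreasing coefficients
      (∀ ε ∈ Set.Ioo (0 : ℝ) 1,
        (∀ k : ℕ, Summable fun n : Freq => bracket n ^ k * ‖YepsCoeff χ g ε ω n‖) ∧
        Summable fun n : {n : Freq // n ≠ 0} => ‖rho χ (ε • vec n)‖ ^ 2 / ‖vec n‖ ^ 2) ∧
      -- the distribution `Y(·, ω)` is a continuous function
      ∃ Y : Torus → ℂ, Continuous Y ∧ (∀ n, coeff Y n = YCoeff g ω n) ∧
        (∃ C : ℝ, 0 < C ∧ ∀ ε ∈ Set.Ioo (0 : ℝ) 1,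
          eLpNorm (fun x => Complex.exp (Yeps χ g ε ω x)) ∞ volume < ENNReal.ofReal C ∧
          eLpNorm (fun x => Complex.exp (-Yeps χ g ε ω x)) ∞ volume < ENNReal.ofReal C ∧
          sobolevNorm s q (coeff fun x => Complex.exp (Yeps χ g ε ω x)) < ENNReal.ofReal C ∧
          sobolevNorm s q (coeff fun x => Complex.exp (-Yeps χ g ε ω x)) < ENNReal.ofReal C ∧
          eLpNorm (gradYeps χ g ε ω) q volume < ENNReal.ofReal (C * (1 + |Real.log ε|)) ∧
          eLpNorm (wickSqEps χ g ε ω) q volume < ENNReal.ofReal (C * (1 + |Real.log ε|) ^ 2) ∧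
          sobolevNorm (-s) q (coeff (wickSqEps χ g ε ω)) < ENNReal.ofReal C ∧
          sobolevNorm s q (coeff fun x => Yeps χ g ε ω x - Y x) < ENNReal.ofReal (C * ε ^ κ) ∧
          eLpNorm (fun x => Yeps χ g ε ω x - Y x) ∞ volume < ENNReal.ofReal (C * ε ^ κ) ∧
          sobolevNorm (-s) q (fun n => coeff (gradYeps χ g ε ω) n - gradCoeff (YCoeff g ω) n)
            < ENNReal.ofReal (C * ε ^ κ) ∧
          sobolevNorm (-s) q (fun n => coeff (wickSqEps χ g ε ω) n - W ω n)
            < ENNReal.ofReal (C * ε ^ κ)) ∧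
        (∀ p : ℝ, ∃ C : ℝ, 0 < C ∧ ∀ ε ∈ Set.Ioo (0 : ℝ) 1,
          eLpNorm (fun x => Complex.exp (-p * Yeps χ g ε ω x) - Complex.exp (-p * Y x)) ∞ volume
            < ENNReal.ofReal (C * ε ^ κ)) := by
  obtain ⟨hs0, hs1⟩ := hs
  obtain ⟨W, hW⟩ := hg.exists_isWickSq
  -- an even exponent above `2q`, for the moments of the gradient
  obtain ⟨k, hk⟩ := ENNReal.exists_nat_gt hq'.ne
  have hk2 : 2 ≤ k := by
    have h1 : ((1 : ℕ) : ℝ≥0∞) < k := by simpa using hq.trans hk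
    exact Nat.cast_lt.1 h1
  have hqk : q * 2 ≤ (2 * k : ℕ) := by
    push_cast
    rw [mul_comm]
    gcongr
  -- Hölder exponents `s < (2s+1)/3 < (s+2)/3 < 1` for `Y`, and `s/2 < s` for the distributions
  have hY := hg.ae_exists_isHolderSeries_Y (θ := (s + 2) / 3) (by linarith) (by linarith)
  have hG := hg.ae_exists_isHolderSeries_grad (s := s) (θ := s / 2) (by linarith) (by linarith) hs1
  have hV := hg.ae_exists_isHolderSeries_wick (s := s) (θ := s / 2) (by linarith) (by linarith) hs1
  have hT := hg.ae_eLpNorm_grad_le hk2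
  have hWlim : ∀ᵐ ω ∂P, ∀ m z,
      Tendsto (fun j => ∑ n ∈ pairBox m j, wickTerm g m n ω) atTop (𝓝 z) → z = W ω m :=
    ae_all_iff.2 fun m => (hW m).ae_eq_of_tendsto (tendsto_pairBox m)
  have hall := hg.ae_growth.and (hY.and (hG.and (hV.and (hT.and hWlim))))
  obtain ⟨N, hN, hNm, hN0⟩ := exists_measurable_superset_of_null (ae_iff.1 hall)
  refine ⟨W, hW, min ((1 - s) / 3) (s / 2), lt_min (by linarith) (by linarith), Nᶜ, hNm.compl,
    (prob_compl_eq_one_iff hNm).2 hN0, fun ω hω => ?_⟩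
  have hgood := not_not.1 fun h => hω (hN h)
  obtain ⟨⟨M, hM1, hM⟩, ⟨Y, CY, hYω⟩, hGω, ⟨V, CV, hVω⟩, hTω, hWω⟩ := hgood
  have hM0 : 0 ≤ M := zero_le_one.trans hM1
  have hθ : 0 < (s + 2) / 3 := by linarith
  have hsumY : ∀ ε ∈ Set.Ioo (0 : ℝ) 1, Summable fun n : Freq => ‖YepsCoeff χ g ε ω n‖ :=
    fun ε hε => hχ.summable_norm_YepsCoeff hM0 hM hε
  have hsumG : ∀ ε ∈ Set.Ioo (0 : ℝ) 1,
      Summable fun n : Freq => ‖gradCoeff (YepsCoeff χ g ε ω) n‖ :=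
    fun ε hε => hχ.summable_norm_gradCoeff hM0 hM hε
  obtain ⟨A₁, hA₁⟩ := hχ.Yeps_estimates hs0 (α := (2 * s + 1) / 3) (by linarith) (by linarith)
    (by linarith) hYω hsumY
  obtain ⟨A₂, hA₂⟩ := hχ.gradYeps_estimate (by linarith) hGω hsumG
  obtain ⟨A₃, hA₃⟩ := hχ.wickSqEps_estimates (by linarith) hVω hsumG hWω
  obtain ⟨A₄, -, hA₄⟩ := hχ.log_estimates hM0 hM hq.le hqk hTω
  have hrate : ∀ ε ∈ Set.Ioo (0 : ℝ) 1, ∀ r, min ((1 - s) / 3) (s / 2) ≤ r →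
      ε ^ r ≤ ε ^ min ((1 - s) / 3) (s / 2) := fun ε hε r hr =>
    Real.rpow_le_rpow_of_exponent_ge hε.1 hε.2.le hr
  have hpos : ∀ ε ∈ Set.Ioo (0 : ℝ) 1, ∀ r : ℝ, 0 < ε ^ r := fun ε hε r =>
    Real.rpow_pos_of_pos hε.1 r
  have e₁ : (s + 2) / 3 - (2 * s + 1) / 3 = (1 - s) / 3 := by ring
  rw [e₁] at hA₁
  refine ⟨fun ε hε => ⟨hχ.summable_YepsCoeff hM0 hM hε, (hχ.summable_rho_sq hε).subtype _⟩,
    Y, hYω.continuous hθ, hYω.coeff_eq, ?_, fun p => ?_⟩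
  · refine ⟨|A₁| + |A₂| + |A₃| + |A₄| + 1, by positivity, fun ε hε => ?_⟩
    have p₁ := abs_nonneg A₁
    have p₂ := abs_nonneg A₂
    have p₃ := abs_nonneg A₃
    have p₄ := abs_nonneg A₄
    have hL : 0 < 1 + |Real.log ε| := by positivity
    obtain ⟨a1, a2, -, -, -, a6⟩ := hA₁ ε hε ∞ le_top
    obtain ⟨-, -, a3, a4, a5, -⟩ := hA₁ ε hε q hq.le
    obtain ⟨c1, c2⟩ := hA₃ ε hε q hq.le
    obtain ⟨d1, d2⟩ := hA₄ ε hε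
    refine ⟨?_, ?_, ?_, ?_, ?_, ?_, ?_, ?_, ?_, ?_, ?_⟩
    · exact lt_ofReal_of_le a1 (by linarith)
    · exact lt_ofReal_of_le a2 (by linarith)
    · exact lt_ofReal_of_le a3 (by linarith)
    · exact lt_ofReal_of_le a4 (by linarith)
    · exact lt_ofReal_mul_of_le d1 hL.le le_rfl hL (by linarith)
    · exact lt_ofReal_mul_of_le d2 (by positivity) le_rfl (by positivity) (by linarith)
    · exact lt_ofReal_of_le c1 (by linarith)
    · exact lt_ofReal_mul_of_le a5 (hpos ε hε _).le (hrate ε hε _ (min_le_left _ _)) (hpos ε hε _)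
        (by linarith)
    · exact lt_ofReal_mul_of_le a6 (hpos ε hε _).le (hrate ε hε _ (min_le_left _ _)) (hpos ε hε _)
        (by linarith)
    · exact lt_ofReal_mul_of_le (hA₂ ε hε q hq.le) (hpos ε hε _).le
        (hrate ε hε _ (min_le_right _ _)) (hpos ε hε _) (by linarith)
    · exact lt_ofReal_mul_of_le c2 (hpos ε hε _).le (hrate ε hε _ (min_le_right _ _)) (hpos ε hε _)
        (by linarith)
  · obtain ⟨A, hA⟩ := hχ.exp_Yeps_estimate hθ hYω hsumY p
    refine ⟨|A| + 1, by positivity, fun ε hε => ?_⟩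
    exact lt_ofReal_mul_of_le (hA ε hε) (hpos ε hε _).le
      (hrate ε hε _ ((min_le_left _ _).trans (by linarith))) (hpos ε hε _) (by linarith)
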